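/- **Setting.** Agents $1,\dots,d$ are the nodes of a connected graph. Agent $i$ owns sample costs $f_i^{[j]}:\mathbb R^{n\times p}\to\mathbb R$, $j=1,\dots,l$ ($l\ge1$); put $f_i=\frac1l\sum_j f_i^{[j]}$ and $f=\frac1d\sum_i f_i$. Norms are Frobenius norms, $\mathrm{sym}(B)=(B+B^\top)/2$, $E(X)=X(X^\top X-I_p)$. For a differentiable function $g$ let $$G_g(X)=\nabla g(X)\big(\tfrac32I_p-\tfrac12X^\top X\big)-X\,\mathrm{sym}(X^\top\nabla g(X)),\qquad H_g=G_g+\beta E ,$$ and write $G_i,H_i,G_i^{[j]},H_i^{[j]}$ for $g=f_i$ and $g=f_i^{[j]}$. With $\bar X=\frac1d\sum_iX_i$, $$\mathtt{StaGap}(\mathbf X)=\Big\|\tfrac1d\sum_iG_i(\bar X)\Big\|^2+\tfrac1d\sum_i\|X_i-\bar X\|^2+\|\bar X^\top\bar X-I_p\|^2 .$$ **Assumptions.** The mixing matrix $W$ is symmetric, nonnegative, doubly stochastic, with $W(i,j)=0$ whenever $i\ne j$ are not adjacent, and its second largest eigenvalue in magnitude, $\lambda$, is less than $1$ ($\lambda=0$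 if $d=1$). Every $f_i^{[j]}$ is differentiable, and for every bounded set $S$ containing $\{X: X^\top X=I_p\}$ there is $L>0$ with $\big(\frac1l\sum_j\|\nabla f_i^{[j]}(X)-\nabla f_i^{[j]}(Z)\|^2\big)^{1/2}\le L\|X-Z\|$ for all $i$ and $X,Z\in S$. **Algorithm (VRSGT).** Start with $X_i^{(0,0)}=X_{\rm init}$, $S_i^{(0,0)}=D_i^{(0,0)}=H_i(X_{\rm init})$. Every step replaces $(X_i,S_i,D_i)$ by $X_i^+=\sum_rW(i,r)(X_r-\eta D_r)$, some $S_i^+$, and $D_i^+=\sum_rW(i,r)D_r+S_i^+-S_i$. Outer iteration $k+1$ ($k\ge 0$) goes from index $(k,0)$ to $(k+1,1)$ with $S_i^+=H_i(X_i^+)$, and then, for $t=1,\dots,q$, from $(k+1,t)$ to $(k+1,t+1)$ with $S_i^+=S_i+\frac1\tau\sum_{j}(H_i^{[j]}(X_i^+)-H_i^{[j]}(X_i))$, the sum being over $\tau$ indices drawn by agent $i$ uniformly from $\{1,\dots,l\}$ with replacement, independently of all other steps (different agents may draw independently or share their draws). Finally $(k+1,0):=(k+1,q+1)$. Each step costs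 two communication rounds; the initialization and each step to an index $(k+1,1)$ cost $dl$ samples, each other step $d\tau$. **Constants.** $\mathcal R=\{X:\|X^\top X-I_p\|\le\frac16\}$, $\mathcal B=\{X:\|X\|\le\sqrt{7dp/6}+\sqrt d\}$, $M=\sup_{\mathcal R}\|\nabla f\|$, $\underline\beta=\max\{1,(6+21M)/5\}$, $\underline f=\inf_{\mathcal B}f$; $M_G$ is the supremum of $\|G_i^{[j]}(X)\|$ over $X\in\mathcal B$, $i$, $j$, and $L_G$ is the smallest common Lipschitz constant of the $G_i^{[j]}$ on $\mathcal B$. **Theorem.** There are a constant $C_1>0$ depending only on $n,p,d$ and on $\beta$ and upper bounds for $\lambda$ (less than $1$) and $L_G$, and a constant $c>0$ depending only on these and on an upper bound for $M_G$, such that the following holds. Suppose that $\tau=q=\sqrt l$ is an integer, $X_{\rm init}\in\mathcal R$, $\beta>\underline\beta$ and $0<\eta<\bar\eta:=c/\sqrt l$, and put $$C=\frac{C_1\,(f(X_{\rm init})-\underline f+1)}{\eta}>0 .$$ Then every $\mathtt{StaGap}(\mathbf X^{(k,t)})$ is integrable, and for every $K\ge1$ $$\min\ \mathbb E\big[\mathtt{StaGap}(\mathbf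 X^{(k,t)})\big]\le\frac{C}{\sqrt l\,K},$$ where the minimum is over $(0,0)$ and all $(k,t)$ with $1\le k\le K$, $0\le t\le q$. Consequently, for every $0<\epsilon\le C/\sqrt l$ an iterate with $\mathbb E[\mathtt{StaGap}]\le\epsilon$ is reached after at most $8C/\epsilon$ communication rounds and at most $8C\,d\sqrt l/\epsilon$ samples across the network. -/

import Mathlib

open MeasureTheory ProbabilityTheory

attribute [local instance] Matrix.frobeniusNormedAddCommGroup Matrix.frobeniusNormedSpace

noncomputable section

/-! ### Matrices, gradients and the two direction fields

All matrix norms are Frobenius norms. -/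

/-- Real `n × p` matrices. -/
abbrev Mat (n p : ℕ) := Matrix (Fin n) (Fin p) ℝ

/-- The gradient of `g` at `X` with respect to the inner product `tr (Yᵀ Z)`, that is, the matrix of
the partial derivatives of `g`. -/
def matGrad {n p : ℕ} (g : Mat n p → ℝ) (X : Mat n p) : Mat n p :=
  Matrix.of fun a b => fderiv ℝ g X (Matrix.single a b 1)

/-- The symmetric part of a square matrix. -/
def symPart {p : ℕ} (B : Mat p p) : Mat p p := (1 / 2 : ℝ) • (B + B.transpose)

/-- The residual `Xᵀ X - I` of the orthogonality constraint. -/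
def orthResidual {n p : ℕ} (X : Mat n p) : Mat p p := X.transpose * X - 1

/-- `E(X) = X (Xᵀ X - I)`, the gradient of `‖Xᵀ X - I‖² / 4`. -/
def orthField {n p : ℕ} (X : Mat n p) : Mat n p := X * orthResidual X

/-- The generalized Riemannian gradient
`∇g(X) (3/2 I - 1/2 Xᵀ X) - X sym(Xᵀ ∇g(X))` of a function `g`. -/
def genRiemGrad {n p : ℕ} (g : Mat n p → ℝ) (X : Mat n p) : Mat n p :=
  matGrad g X * ((3 / 2 : ℝ) • (1 : Mat p p) - (1 / 2 : ℝ) • (X.transpose * X))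
    - X * symPart (X.transpose * matGrad g X)

/-- The search direction: generalized Riemannian gradient plus `β E(X)`. -/
def searchDir {n p : ℕ} (β : ℝ) (g : Mat n p → ℝ) (X : Mat n p) : Mat n p :=
  genRiemGrad g X + β • orthField X

/-! ### The cost functions -/

/-- Sample costs: `f i j` is the cost of the `j`-th sample of the `i`-th agent. -/
abbrev Costs (n p d l : ℕ) := Fin d → Fin l → Mat n p → ℝ

/-- The local cost of agent `i`. -/
def localCost {n p d l : ℕ} (f : Costs n p d l) (i : Fin d) (X : Mat n p) : ℝ :=
  (1 / (l : ℝ)) * ∑ j, f i j X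

/-- The global cost. -/
def globalCost {n p d l : ℕ} (f : Costs n p d l) (X : Mat n p) : ℝ :=
  (1 / (d : ℝ)) * ∑ i, localCost f i X

/-- The Stiefel manifold. -/
def stiefel (n p : ℕ) : Set (Mat n p) := {X | X.transpose * X = 1}

/-- The region `‖Xᵀ X - I‖ ≤ 1/6`. -/
def region (n p : ℕ) : Set (Mat n p) := {X | ‖orthResidual X‖ ≤ 1 / 6}

/-- The ball of radius `√(7dp/6) + √d`. -/
def bigBall (n p d : ℕ) : Set (Mat n p) :=
  {X | ‖X‖ ≤ Real.sqrt (7 * (d : ℝ) * (p : ℝ) / 6) + Real.sqrt (d : ℝ)}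

/-- Every sample cost is differentiable and, on every bounded set that contains the Stiefel
manifold, the sample gradients of each agent are Lipschitz in mean square, with a constant that may
depend on the set. -/
structure IsMeanSquareLocallySmooth {n p d l : ℕ} (f : Costs n p d l) : Prop where
  differentiable : ∀ i j, Differentiable ℝ (f i j)
  lipschitz : ∀ S : Set (Mat n p), Bornology.IsBounded S → stiefel n p ⊆ S →
    ∃ Λ : ℝ, 0 < Λ ∧ ∀ i, ∀ X ∈ S, ∀ Z ∈ S,
      Real.sqrt ((1 / (l : ℝ)) * ∑ j, ‖matGrad (f i j) X - matGrad (f i j) Z‖ ^ 2) ≤ Λ * ‖X - Z‖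

/-- `M`, the supremum over the region of the norm of the gradient of the global cost. -/
def gradSup {n p d l : ℕ} (f : Costs n p d l) : ℝ :=
  sSup {r | ∃ X ∈ region n p, r = ‖matGrad (globalCost f) X‖}

/-- `M_G`, the supremum over samples and over the ball of the norm of the generalized Riemannian
gradient. -/
def dirSup {n p d l : ℕ} (f : Costs n p d l) : ℝ :=
  sSup {r | ∃ i j, ∃ X ∈ bigBall n p d, r = ‖genRiemGrad (f i j) X‖}

/-- `L_G`, the common Lipschitz constant over the ball of the generalized Riemannian gradients of
the samples. -/
def dirLip {n p d l : ℕ} (f : Costs n p d l) : ℝ :=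
  sSup {r | ∃ i j, ∃ X ∈ bigBall n p d, ∃ Y ∈ bigBall n p d, X ≠ Y ∧
    r = ‖genRiemGrad (f i j) X - genRiemGrad (f i j) Y‖ / ‖X - Y‖}

/-- The infimum over the ball of the global cost. -/
def costInf {n p d l : ℕ} (f : Costs n p d l) : ℝ := sInf (globalCost f '' bigBall n p d)

/-- The lower bound `max {1, (6 + 21 M) / 5}` on the penalty parameter. -/
def penaltyThreshold {n p d l : ℕ} (f : Costs n p d l) : ℝ := max 1 ((6 + 21 * gradSup f) / 5)

/-! ### The network -/

/-- `W` is a mixing matrix of the graph `G`: symmetric, nonnegative, doubly stochastic and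
supported on the edges and the diagonal. -/
structure IsMixingMatrix {d : ℕ} (G : SimpleGraph (Fin d)) (W : Mat d d) : Prop where
  symm : W.IsSymm
  nonneg : ∀ i j, 0 ≤ W i j
  row_sum : ∀ i, ∑ j, W i j = 1
  col_sum : ∀ j, ∑ i, W i j = 1
  supported : ∀ i j, i ≠ j → ¬ G.Adj i j → W i j = 0

/-- The second largest eigenvalue in magnitude of a symmetric doubly stochastic matrix, that is,
the largest magnitude of an eigenvalue on the orthogonal complement of the all-ones vector
(and `0` if `d = 1`). -/
def secondEigenvalue {d : ℕ} (W : Mat d d) : ℝ :=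
  sSup {r | ∃ (μ : ℝ) (v : Fin d → ℝ), v ≠ 0 ∧ ∑ i, v i = 0 ∧ W.mulVec v = μ • v ∧ r = |μ|}

/-! ### The stationarity gap -/

/-- The average of the local variables. -/
def average {n p d : ℕ} (X : Fin d → Mat n p) : Mat n p := (1 / (d : ℝ)) • ∑ i, X i

/-- The stationarity gap: squared norm of the averaged generalized Riemannian gradient at the
average, plus consensus error, plus orthogonality violation. -/
def staGap {n p d l : ℕ} (f : Costs n p d l) (X : Fin d → Mat n p) : ℝ :=
  ‖(1 / (d : ℝ)) • ∑ i, genRiemGrad (localCost f i) (average X)‖ ^ 2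
    + (1 / (d : ℝ)) * ∑ i, ‖X i - average X‖ ^ 2
    + ‖orthResidual (average X)‖ ^ 2

/-! ### The algorithm -/

/-- The state of the network: the local variables of all agents, together with the numbers of
communication rounds performed and of samples evaluated across the network so far. -/
structure NetState (n p d : ℕ) where
  X : Fin d → Mat n p
  S : Fin d → Mat n p
  D : Fin d → Mat n p
  rounds : ℕ
  samples : ℕ

/-- A batch: each agent `i` has drawn `τ` sample indices, with repetitions allowed. -/
abbrev Batch (d l τ : ℕ) := Fin d → Fin τ → Fin l

/-- One round of communication: each agent forms a weighted average over its neighbours. -/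
def mix {n p d : ℕ} (W : Mat d d) (Z : Fin d → Mat n p) (i : Fin d) : Mat n p := ∑ r, W i r • Z r

/-- The `X`-update. -/
def stepX {n p d : ℕ} (W : Mat d d) (η : ℝ) (s : NetState n p d) : Fin d → Mat n p :=
  mix W fun r => s.X r - η • s.D r

/-- Initialization. -/
def initState {n p d l : ℕ} (f : Costs n p d l) (β : ℝ) (Xinit : Mat n p) : NetState n p d where
  X := fun _ => Xinit
  S := fun i => searchDir β (localCost f i) Xinit
  D := fun i => searchDir β (localCost f i) Xinit
  rounds := 0
  samples := d * l

/-- The step that opens an outer iteration: full local directions are evaluated. It takes two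
rounds of communication (of `X` and of `D`) and `l` samples per agent. -/
def outerStep {n p d l : ℕ} (f : Costs n p d l) (W : Mat d d) (η β : ℝ) (s : NetState n p d) :
    NetState n p d where
  X := stepX W η s
  S := fun i => searchDir β (localCost f i) (stepX W η s i)
  D := fun i => mix W s.D i + searchDir β (localCost f i) (stepX W η s i) - s.S i
  rounds := s.rounds + 2
  samples := s.samples + d * l

/-- The recursive estimate of the local directions after the `X`-update. -/
def innerS {n p d l τ : ℕ} (f : Costs n p d l) (W : Mat d d) (η β : ℝ) (C : Batch d l τ)
    (s : NetState n p d) (i : Fin d) : Mat n p :=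
  (1 / (τ : ℝ)) • ∑ m, (searchDir β (f i (C i m)) (stepX W η s i)
    - searchDir β (f i (C i m)) (s.X i)) + s.S i

/-- An inner step with batch `C`. It takes two rounds of communication and `τ` samples per
agent. -/
def innerStep {n p d l τ : ℕ} (f : Costs n p d l) (W : Mat d d) (η β : ℝ) (C : Batch d l τ)
    (s : NetState n p d) : NetState n p d where
  X := stepX W η s
  S := innerS f W η β C s
  D := fun i => mix W s.D i + innerS f W η β C s i - s.S i
  rounds := s.rounds + 2
  samples := s.samples + d * τ

/-- The state after `t` inner steps from `s`; the `t`-th one uses the batch `C t`. -/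
def innerLoop {n p d l τ : ℕ} (f : Costs n p d l) (W : Mat d d) (η β : ℝ) (C : ℕ → Batch d l τ)
    (s : NetState n p d) : ℕ → NetState n p d
  | 0 => s
  | t + 1 => innerStep f W η β (C (t + 1)) (innerLoop f W η β C s t)

/-- The state with index `(k, 0)`, that is, after `k` outer iterations, each of which consists of
an opening step and `q` inner steps. The batch `C k t` is used in the `t`-th inner step of the
`k`-th outer iteration. -/
def vrsgtOuter {n p d l τ : ℕ} (f : Costs n p d l) (W : Mat d d) (η β : ℝ) (q : ℕ)
    (Xinit : Mat n p) (C : ℕ → ℕ → Batch d l τ) : ℕ → NetState n p d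
  | 0 => initState f β Xinit
  | k + 1 => innerLoop f W η β (C (k + 1))
      (outerStep f W η β (vrsgtOuter f W η β q Xinit C k)) q

/-- The state with index `(k, t)`, for `k = t = 0`, or `k ≥ 1` and `0 ≤ t ≤ q + 1`. The states
`(k, q + 1)` and `(k, 0)` are the same for `k ≥ 1`. (The algorithm has no states `(0, t)` with
`t ≥ 1`; the value there is irrelevant.) -/
def vrsgt {n p d l τ : ℕ} (f : Costs n p d l) (W : Mat d d) (η β : ℝ) (q : ℕ)
    (Xinit : Mat n p) (C : ℕ → ℕ → Batch d l τ) : ℕ → ℕ → NetState n p d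
  | k, 0 => vrsgtOuter f W η β q Xinit C k
  | 0, _ + 1 => initState f β Xinit
  | k + 1, t + 1 => innerLoop f W η β (C (k + 1))
      (outerStep f W η β (vrsgtOuter f W η β q Xinit C k)) t

/-- The indices of the iterates produced in the first `K` outer iterations. -/
def iterIndices (K q : ℕ) : Finset (ℕ × ℕ) :=
  (Finset.range (K + 1) ×ˢ Finset.range (q + 1)).filter fun kt => kt.1 = 0 → kt.2 = 0

theorem iterIndices_nonempty (K q : ℕ) : (iterIndices K q).Nonempty :=
  ⟨(0, 0), by simp [iterIndices]⟩

/-- Random batches: the batches of different iterations are independent, and in every iteration the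
`τ` indices drawn by each agent are independent and uniform. Nothing is assumed on the
joint law of the draws of different agents within one iteration: the agents may draw
independently of each other or share one batch. -/
structure IsSampling {d l τ : ℕ} {Ω : Type*} [MeasurableSpace Ω] (P : Measure Ω)
    (ξ : ℕ → ℕ → Ω → Batch d l τ) : Prop where
  measurable : ∀ k t, Measurable (ξ k t)
  indep : iIndepFun (fun kt : ℕ × ℕ => ξ kt.1 kt.2) P
  law : ∀ k t i, P.map (fun ω => ξ k t ω i) = uniformOn (Set.univ : Set (Fin τ → Fin l))

/-- The expected stationarity gap of the iterate with index `(k, t)`. -/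
def expectedGap {n p d l τ : ℕ} {Ω : Type*} [MeasurableSpace Ω] (P : Measure Ω)
    (f : Costs n p d l) (W : Mat d d) (η β : ℝ) (q : ℕ) (Xinit : Mat n p)
    (ξ : ℕ → ℕ → Ω → Batch d l τ) (kt : ℕ × ℕ) : ℝ :=
  ∫ ω, staGap f (vrsgt f W η β q Xinit (fun k t => ξ k t ω) kt.1 kt.2).X ∂P

end

noncomputable section

/-! ### The Frobenius inner product -/

/-! The proof runs a descent argument for the averaged iterate and couples it with the consensus
errors and the sampling errors.

Descent. One Newton-Schulz step `schulz X` sends X near the Stiefel manifold even closer to it. Its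
derivative at X is the self-adjoint map `riemMap X`, so the gradient of f ∘ `schulz` is `riemMap X`
applied to the gradient of f at `schulz X`. This differs from the generalized Riemannian gradient at
X by a multiple of the residual norm, with a constant that involves the Lipschitz constant of the
generalized gradient and no smoothness of f beyond that. The merit function adds a large multiple of
the squared residual. Along `orthField`, the generalized gradient contributes only to second order
in the residual (`inner_orthField_riemMap`), so the term with β dominates above the penalty
threshold. Hence the averaged direction, up to an error e, decreases the merit function by a
multiple of η times the stationarity measure minus a multiple of η‖e‖²
(`IsRiemSmooth.merit_step_le`).

Deterministic control. All Lipschitz constants are local, so moment bounds alone would not suffice: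
every realization has to stay in the region. Mixing contracts deviations, the local directions are
bounded on the ball, and the estimation error grows by O(η) per inner step and vanishes at each
opening step. Over q inner steps it stays below a fixed constant when qη is small. This is the
origin of the step size c/√l, and it makes the region invariant (`IsControlled`,
`isControlled_linState`).

Expectations. Given the past, an inner step adds to an agent's mean squared error at most 1/τ times
a squared Lipschitz constant times its squared displacement, because centred i.i.d. draws are
orthogonal (`integral_batch_le`). An increment survives for at most q steps, so for τ = q the summed
errors are bounded by the summed displacements with a constant free of l. The summed recursions for
consensus, tracking, displacement, estimation error and descent form a closed linear system, whose
feedback is absorbed for small η (`sum_gap_le`). The initial dispersion of the tracking variables,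
the only place where the bound on the directions enters, is multiplied by powers of η and absorbed
too, so the leading constant does not see it.

Thus the expected gaps of all iterates have a sum bounded uniformly in the number of steps. There
are more than qK indices in K outer iterations, which gives the rate; counting rounds and samples
gives the complexity. -/

instance matInnerProductSpace (n p : ℕ) : InnerProductSpace ℝ (Mat n p) where
  toNormedSpace := Matrix.frobeniusNormedSpace
  inner A B := ∑ i, ∑ j, A i j * B i j
  norm_sq_eq_re_inner A := by
    rw [Matrix.frobenius_norm_def, ← Real.sqrt_eq_rpow, Real.sq_sqrt (by positivity)]
    simp [sq]
  conj_inner_symm A B := by simp [mul_comm]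
  add_left A B C := by simp [add_mul, Finset.sum_add_distrib]
  smul_left A B r := by simp [Finset.mul_sum, mul_assoc]

section FrobeniusInner

variable {m n p : ℕ}

theorem mat_inner_eq_trace (A B : Mat n p) : inner ℝ A B = (A.transpose * B).trace := by
  simp only [inner, Matrix.trace, Matrix.diag, Matrix.mul_apply, Matrix.transpose_apply]
  exact Finset.sum_comm

theorem mat_norm_sq (A : Mat n p) : ‖A‖ ^ 2 = ∑ i, ∑ j, A i j ^ 2 := by
  rw [← real_inner_self_eq_norm_sq]
  simp [inner, sq]

theorem mat_inner_mul_left (A : Mat m n) (B : Mat n p) (C : Mat m p) :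
    inner ℝ (A * B) C = inner ℝ B (A.transpose * C) := by
  simp [mat_inner_eq_trace, Matrix.transpose_mul, Matrix.mul_assoc]

theorem mat_inner_mul_right (A : Mat m n) (B : Mat n p) (C : Mat m p) :
    inner ℝ (A * B) C = inner ℝ A (C * B.transpose) := by
  simp only [mat_inner_eq_trace, Matrix.transpose_mul]
  rw [Matrix.mul_assoc, Matrix.trace_mul_comm, Matrix.mul_assoc]

theorem mat_inner_transpose (A B : Mat n p) :
    inner ℝ A.transpose B.transpose = inner ℝ A B := by
  simp only [inner, Matrix.transpose_apply]
  exact Finset.sum_comm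

theorem mat_norm_transpose (A : Mat n p) : ‖A.transpose‖ = ‖A‖ :=
  Matrix.frobenius_norm_transpose A

theorem mat_norm_mul_le (A : Mat m n) (B : Mat n p) : ‖A * B‖ ≤ ‖A‖ * ‖B‖ :=
  Matrix.frobenius_norm_mul A B

theorem mat_norm_one_sq : ‖(1 : Mat p p)‖ ^ 2 = p := by
  rw [← real_inner_self_eq_norm_sq, mat_inner_eq_trace]
  simp

theorem symPart_transpose (B : Mat p p) : (symPart B).transpose = symPart B := by
  simp [symPart, add_comm]

theorem symPart_add (A B : Mat p p) : symPart (A + B) = symPart A + symPart B := by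
  simp only [symPart, Matrix.transpose_add]; module

theorem symPart_sub (A B : Mat p p) : symPart (A - B) = symPart A - symPart B := by
  simp only [symPart, Matrix.transpose_sub]; module

theorem symPart_smul (r : ℝ) (A : Mat p p) : symPart (r • A) = r • symPart A := by
  simp only [symPart, Matrix.transpose_smul]; module

theorem norm_symPart_le (B : Mat p p) : ‖symPart B‖ ≤ ‖B‖ := by
  unfold symPart
  rw [norm_smul]
  have := norm_add_le B B.transpose
  rw [mat_norm_transpose] at this
  norm_num
  linarith

theorem inner_symPart_of_symm {S : Mat p p} (hS : S.transpose = S) (B : Mat p p) :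
    inner ℝ S (symPart B) = inner ℝ S B := by
  have h : inner ℝ S B.transpose = inner ℝ S B := by
    rw [← mat_inner_transpose, hS, Matrix.transpose_transpose]
  simp only [symPart, inner_smul_right, inner_add_right, h]
  ring

theorem inner_symPart_left (A B : Mat p p) :
    inner ℝ (symPart A) B = inner ℝ A (symPart B) := by
  rw [← inner_symPart_of_symm (symPart_transpose A), real_inner_comm,
    inner_symPart_of_symm (symPart_transpose B), real_inner_comm]

end FrobeniusInner

/-! ### The orthogonality residual and the region around the Stiefel manifold -/

section Residual

variable {n p d : ℕ}

theorem orthResidual_transpose (X : Mat n p) : (orthResidual X).transpose = orthResidual X := by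
  simp [orthResidual]

theorem transpose_mul_self_eq (X : Mat n p) : X.transpose * X = 1 + orthResidual X := by
  simp [orthResidual]

/-- The Gram matrix of X is the identity plus the residual. In the region all squared singular
values of X therefore lie between 5/6 and 7/6; the factor 11/10 used below is a rational upper bound
for the square root of 7/6. -/
theorem norm_mul_sq_eq (X : Mat n p) (B : Mat p m) :
    ‖X * B‖ ^ 2 = ‖B‖ ^ 2 + inner ℝ B (orthResidual X * B) := by
  rw [← real_inner_self_eq_norm_sq, mat_inner_mul_left, ← Matrix.mul_assoc,
    transpose_mul_self_eq, Matrix.add_mul, Matrix.one_mul, inner_add_right,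
    real_inner_self_eq_norm_sq]

theorem abs_inner_mul_le (D : Mat p p) (B : Mat p m) :
    |inner ℝ B (D * B)| ≤ ‖D‖ * ‖B‖ ^ 2 := by
  calc |inner ℝ B (D * B)| ≤ ‖B‖ * ‖D * B‖ := abs_real_inner_le_norm _ _
    _ ≤ ‖B‖ * (‖D‖ * ‖B‖) := by gcongr; exact mat_norm_mul_le _ _
    _ = _ := by ring

theorem norm_mul_sq_le_of_mem_region {X : Mat n p} (hX : X ∈ region n p) (B : Mat p m) :
    ‖X * B‖ ^ 2 ≤ 7 / 6 * ‖B‖ ^ 2 := by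
  have h1 := abs_le.1 (abs_inner_mul_le (orthResidual X) B)
  have h2 : ‖orthResidual X‖ ≤ 1 / 6 := hX
  rw [norm_mul_sq_eq]
  nlinarith [sq_nonneg ‖B‖]

theorem le_norm_mul_sq_of_mem_region {X : Mat n p} (hX : X ∈ region n p) (B : Mat p m) :
    5 / 6 * ‖B‖ ^ 2 ≤ ‖X * B‖ ^ 2 := by
  have h1 := abs_le.1 (abs_inner_mul_le (orthResidual X) B)
  have h2 : ‖orthResidual X‖ ≤ 1 / 6 := hX
  rw [norm_mul_sq_eq]
  nlinarith [sq_nonneg ‖B‖]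

theorem norm_mul_le_of_mem_region {X : Mat n p} (hX : X ∈ region n p) (B : Mat p m) :
    ‖X * B‖ ≤ 11 / 10 * ‖B‖ := by
  have := norm_mul_sq_le_of_mem_region hX B
  refine (sq_le_sq₀ (norm_nonneg _) (by positivity)).1 ?_
  nlinarith [sq_nonneg ‖B‖]

/-- By duality: a map and its adjoint have the same operator norm. -/
theorem norm_transpose_mul_le_of_mem_region {X : Mat n p} (hX : X ∈ region n p) (A : Mat n m) :
    ‖X.transpose * A‖ ≤ 11 / 10 * ‖A‖ := by
  have h1 : ‖X.transpose * A‖ ^ 2 = inner ℝ A (X * (X.transpose * A)) := by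
    rw [← real_inner_self_eq_norm_sq, mat_inner_mul_left, Matrix.transpose_transpose]
  have h2 : ‖X.transpose * A‖ ^ 2 ≤ ‖A‖ * (11 / 10 * ‖X.transpose * A‖) := by
    rw [h1]
    refine (real_inner_le_norm _ _).trans ?_
    gcongr
    exact norm_mul_le_of_mem_region hX _
  by_contra! h
  nlinarith [norm_nonneg (X.transpose * A), norm_nonneg A]

theorem norm_sq_le_of_mem_region {X : Mat n p} (hX : X ∈ region n p) :
    ‖X‖ ^ 2 ≤ 7 * p / 6 := by
  have h := norm_mul_sq_le_of_mem_region hX (1 : Mat p p)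
  rw [Matrix.mul_one, mat_norm_one_sq] at h
  linarith

/-- The spare unit is room for the deviation of a single agent: if the average is in the region and
the agent is within distance one of it, the agent is in `bigBall`. -/
theorem norm_le_of_mem_region (hd : 1 ≤ d) {X : Mat n p} (hX : X ∈ region n p) :
    ‖X‖ + 1 ≤ Real.sqrt (7 * (d : ℝ) * (p : ℝ) / 6) + Real.sqrt (d : ℝ) := by
  have hd' : (1 : ℝ) ≤ d := by exact_mod_cast hd
  have h := norm_sq_le_of_mem_region hX
  have h1 : ‖X‖ ≤ Real.sqrt (7 * (d : ℝ) * (p : ℝ) / 6) := by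
    apply Real.le_sqrt_of_sq_le
    have : (p : ℝ) ≤ d * p := by nlinarith [(Nat.cast_nonneg p : (0 : ℝ) ≤ p)]
    linarith
  have h2 : 1 ≤ Real.sqrt (d : ℝ) := Real.one_le_sqrt.2 hd'
  linarith

theorem region_subset_bigBall (hd : 1 ≤ d) : region n p ⊆ bigBall n p d := fun X hX => by
  have := norm_le_of_mem_region hd hX
  change ‖X‖ ≤ _
  linarith

theorem norm_orthField_le {X : Mat n p} (hX : X ∈ region n p) :
    ‖orthField X‖ ≤ 11 / 10 * ‖orthResidual X‖ := norm_mul_le_of_mem_region hX _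

theorem orthResidual_sub (X Y : Mat n p) :
    orthResidual (X - Y) = orthResidual X - (X.transpose * Y + Y.transpose * X)
      + Y.transpose * Y := by
  simp only [orthResidual, Matrix.transpose_sub, Matrix.sub_mul, Matrix.mul_sub]
  abel

theorem norm_orthResidual_sub_le {ρ : ℝ} {X : Mat n p} (hX : ‖X‖ ≤ ρ) {Y : Mat n p}
    (hY : ‖Y‖ ≤ 1) : ‖orthResidual (X - Y) - orthResidual X‖ ≤ (2 * ρ + 1) * ‖Y‖ := by
  have e : orthResidual (X - Y) - orthResidual X
      = Y.transpose * Y - (X.transpose * Y + Y.transpose * X) := by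
    rw [orthResidual_sub]; abel
  rw [e]
  have h1 := mat_norm_mul_le Y.transpose Y
  have h2 := mat_norm_mul_le X.transpose Y
  have h3 := mat_norm_mul_le Y.transpose X
  have h4 := norm_sub_le (Y.transpose * Y) (X.transpose * Y + Y.transpose * X)
  have h5 := norm_add_le (X.transpose * Y) (Y.transpose * X)
  rw [mat_norm_transpose] at h1 h2 h3
  nlinarith [norm_nonneg Y, norm_nonneg X]

/-- The change of the squared residual along a small step. -/
theorem norm_orthResidual_sub_sq_le {ρ : ℝ} {X : Mat n p} (hX : X ∈ region n p) (hρ : ‖X‖ ≤ ρ)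
    {Y : Mat n p} (hY : ‖Y‖ ≤ 1) :
    ‖orthResidual (X - Y)‖ ^ 2 ≤ ‖orthResidual X‖ ^ 2 - 4 * inner ℝ (orthField X) Y
      + (1 + (2 * ρ + 1) ^ 2) * ‖Y‖ ^ 2 := by
  have h1 := norm_orthResidual_sub_le hρ hY
  have h0 : ‖orthResidual X‖ ≤ 1 / 6 := hX
  set R := orthResidual X with hR
  have e : orthResidual (X - Y) = R + (orthResidual (X - Y) - R) := by abel
  have e1 : ‖orthResidual (X - Y)‖ ^ 2 = ‖R‖ ^ 2 + 2 * inner ℝ R (orthResidual (X - Y) - R)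
      + ‖orthResidual (X - Y) - R‖ ^ 2 := by
    rw [← norm_add_sq_real, ← e]
  -- Since the residual is symmetric, only the symmetric part of XᵀY matters, and pairing it with
  -- the residual moves X to the other side, which produces `orthField`.
  have e2 : inner ℝ R (orthResidual (X - Y) - R)
      = inner ℝ R (Y.transpose * Y) - 2 * inner ℝ (orthField X) Y := by
    have : orthResidual (X - Y) - R = Y.transpose * Y - (2 : ℝ) • symPart (X.transpose * Y) := by
      rw [orthResidual_sub, symPart, Matrix.transpose_mul, Matrix.transpose_transpose]; module
    rw [this, inner_sub_right, inner_smul_right, inner_symPart_of_symm (orthResidual_transpose X),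
      orthField, mat_inner_mul_left]
  have h2 : inner ℝ R (Y.transpose * Y) ≤ 1 / 6 * ‖Y‖ ^ 2 := by
    refine (real_inner_le_norm _ _).trans ?_
    have := mat_norm_mul_le Y.transpose Y
    rw [mat_norm_transpose] at this
    nlinarith [norm_nonneg R, norm_nonneg Y, norm_nonneg (Y.transpose * Y), sq_nonneg ‖Y‖]
  have h3 : ‖orthResidual (X - Y) - R‖ ^ 2 ≤ (2 * ρ + 1) ^ 2 * ‖Y‖ ^ 2 := by
    rw [← mul_pow]
    gcongr
  rw [e1, e2]
  nlinarith [sq_nonneg ‖Y‖]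

end Residual

/-! ### The tangent map -/

section Tangent

variable {n p : ℕ}

/-- The linear map that sends the gradient of a function at `X` to its generalized Riemannian
gradient. -/
def riemMap (X A : Mat n p) : Mat n p :=
  A * ((3 / 2 : ℝ) • (1 : Mat p p) - (1 / 2 : ℝ) • (X.transpose * X))
    - X * symPart (X.transpose * A)

theorem genRiemGrad_eq (g : Mat n p → ℝ) (X : Mat n p) :
    genRiemGrad g X = riemMap X (matGrad g X) := rfl

theorem riemMap_add (X A B : Mat n p) :
    riemMap X (A + B) = riemMap X A + riemMap X B := by
  simp only [riemMap, Matrix.add_mul, Matrix.mul_add, symPart_add]; abel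

theorem riemMap_sub (X A B : Mat n p) :
    riemMap X (A - B) = riemMap X A - riemMap X B := by
  simp only [riemMap, Matrix.sub_mul, Matrix.mul_sub, symPart_sub]; abel

theorem riemMap_smul (X : Mat n p) (r : ℝ) (A : Mat n p) :
    riemMap X (r • A) = r • riemMap X A := by
  simp only [riemMap, Matrix.smul_mul, Matrix.mul_smul, symPart_smul, smul_sub]

theorem riemMap_sum {ι : Type*} (s : Finset ι) (X : Mat n p) (A : ι → Mat n p) :
    riemMap X (∑ i ∈ s, A i) = ∑ i ∈ s, riemMap X (A i) :=
  map_sum (⟨⟨riemMap X, riemMap_add X⟩, riemMap_smul X⟩ : Mat n p →ₗ[ℝ] Mat n p) A s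

/-- Self-adjointness is what turns the derivative of `schulz` into a formula for the gradient of a
composition with `schulz`. -/
theorem inner_riemMap (X A B : Mat n p) :
    inner ℝ (riemMap X A) B = inner ℝ A (riemMap X B) := by
  have hP : ((3 / 2 : ℝ) • (1 : Mat p p) - (1 / 2 : ℝ) • (X.transpose * X)).transpose
      = (3 / 2 : ℝ) • (1 : Mat p p) - (1 / 2 : ℝ) • (X.transpose * X) := by simp
  have h : inner ℝ A (X * symPart (X.transpose * B))
      = inner ℝ (X.transpose * A) (symPart (X.transpose * B)) := by
    rw [mat_inner_mul_left, Matrix.transpose_transpose]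
  rw [riemMap, riemMap, inner_sub_left, inner_sub_right, mat_inner_mul_right, hP,
    mat_inner_mul_left, h, inner_symPart_left]

/-- With R the residual, the two halves of `riemMap` pair to R - R²/2 and R + R² against XᵀA. The
terms linear in R cancel. The generalized gradient is thus orthogonal to `orthField` up to second
order in R, and a finite β can outweigh it. -/
theorem inner_orthField_riemMap (X A : Mat n p) :
    inner ℝ (orthField X) (riemMap X A)
      = -(3 / 2) * inner ℝ (orthResidual X * orthResidual X) (X.transpose * A) := by
  have hR := orthResidual_transpose X
  have hRR : (orthResidual X * orthResidual X).transpose = orthResidual X * orthResidual X := by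
    rw [Matrix.transpose_mul, hR]
  have e1 : (3 / 2 : ℝ) • (1 : Mat p p) - (1 / 2 : ℝ) • (X.transpose * X)
      = 1 - (1 / 2 : ℝ) • orthResidual X := by
    rw [transpose_mul_self_eq]; module
  rw [riemMap, inner_sub_right, orthField, e1]
  have e2 : inner ℝ (X * orthResidual X) (A * (1 - (1 / 2 : ℝ) • orthResidual X))
      = inner ℝ (orthResidual X - (1 / 2 : ℝ) • (orthResidual X * orthResidual X))
        (X.transpose * A) := by
    rw [real_inner_comm, mat_inner_mul_right, real_inner_comm, Matrix.mul_assoc,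
      mat_inner_mul_left]
    simp [hR, Matrix.mul_sub]
  have e3 : inner ℝ (X * orthResidual X) (X * symPart (X.transpose * A))
      = inner ℝ (orthResidual X + orthResidual X * orthResidual X) (X.transpose * A) := by
    rw [real_inner_comm, mat_inner_mul_left, ← Matrix.mul_assoc, transpose_mul_self_eq,
      Matrix.add_mul, Matrix.one_mul, real_inner_comm, inner_symPart_of_symm]
    simp [hR, hRR]
  rw [e2, e3, inner_sub_left, inner_add_left, inner_smul_left]
  simp only [conj_trivial]
  ring

/-- The map is quadratic in its base point, so differences telescope into three products, each with
one factor X - Y. It allows the base point of `riemMap` to be changed while the matrix it acts on is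
kept. -/
theorem norm_riemMap_sub_le {ρ : ℝ} {X Y : Mat n p} (hX : ‖X‖ ≤ ρ) (hY : ‖Y‖ ≤ ρ)
    (A : Mat n p) : ‖riemMap X A - riemMap Y A‖ ≤ 3 * ρ * ‖X - Y‖ * ‖A‖ := by
  have e : riemMap X A - riemMap Y A
      = -((1 / 2 : ℝ) • (A * (X.transpose * (X - Y) + (X - Y).transpose * Y)))
        - (X * symPart ((X - Y).transpose * A) + (X - Y) * symPart (Y.transpose * A)) := by
    simp only [riemMap, Matrix.transpose_sub, Matrix.sub_mul, Matrix.mul_sub, Matrix.mul_add,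
      symPart_sub, Matrix.mul_smul]
    module
  rw [e]
  have hX0 := norm_nonneg X
  have hA0 := norm_nonneg A
  have hZ0 := norm_nonneg (X - Y)
  have hT : ‖(X - Y).transpose‖ = ‖X - Y‖ := mat_norm_transpose _
  have h1 : ‖(1 / 2 : ℝ) • (A * (X.transpose * (X - Y) + (X - Y).transpose * Y))‖
      ≤ ρ * ‖X - Y‖ * ‖A‖ := by
    rw [norm_smul]
    have a1 := mat_norm_mul_le A (X.transpose * (X - Y) + (X - Y).transpose * Y)
    have a2 : ‖X.transpose * (X - Y) + (X - Y).transpose * Y‖ ≤ 2 * ρ * ‖X - Y‖ := by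
      refine (norm_add_le _ _).trans ?_
      have b1 := mat_norm_mul_le X.transpose (X - Y)
      have b2 := mat_norm_mul_le (X - Y).transpose Y
      rw [mat_norm_transpose] at b1 b2
      nlinarith
    have a3 := mul_le_mul_of_nonneg_left a2 hA0
    rw [Real.norm_of_nonneg (by norm_num)]
    linarith
  have hs : ∀ (U V : Mat n p) {r s : ℝ}, ‖U‖ ≤ r → ‖V‖ ≤ s →
      ‖U * symPart (V.transpose * A)‖ ≤ r * (s * ‖A‖) := by
    intro U V r s hU hV
    have hr : 0 ≤ r := (norm_nonneg U).trans hU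
    refine (mat_norm_mul_le _ _).trans ?_
    gcongr
    refine (norm_symPart_le _).trans ((mat_norm_mul_le _ _).trans ?_)
    rw [mat_norm_transpose]
    gcongr
  have h2 := hs X (X - Y) hX le_rfl
  have h3 := hs (X - Y) Y le_rfl hY
  have h4 := norm_add_le (X * symPart ((X - Y).transpose * A)) ((X - Y) * symPart (Y.transpose * A))
  refine (norm_sub_le _ _).trans ?_
  rw [norm_neg]
  linarith

theorem norm_riemMap_le {ρ : ℝ} {X : Mat n p} (hX : ‖X‖ ≤ ρ) (A : Mat n p) :
    ‖riemMap X A‖ ≤ (3 / 2 + 3 * ρ ^ 2) * ‖A‖ := by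
  have h := norm_riemMap_sub_le hX (Y := 0) (by simpa using (norm_nonneg X).trans hX) A
  have h0 : riemMap 0 A = (3 / 2 : ℝ) • A := by simp [riemMap]
  have h1 : ‖(3 / 2 : ℝ) • A‖ = 3 / 2 * ‖A‖ := by rw [norm_smul]; norm_num
  have h2 := norm_le_norm_add_norm_sub' (riemMap X A) (riemMap 0 A)
  rw [h0, h1] at h2
  rw [h0, sub_zero] at h
  nlinarith [mul_le_mul_of_nonneg_left hX ((norm_nonneg X).trans hX), norm_nonneg A,
    mul_le_mul_of_nonneg_right (mul_le_mul_of_nonneg_left hX ((norm_nonneg X).trans hX))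
      (norm_nonneg A)]

end Tangent

/-! ### The approximate retraction -/

section Retract

variable {n p : ℕ}

/-- `X (3/2 I - 1/2 Xᵀ X)`, one step of the Newton-Schulz iteration for the polar factor. -/
def schulz (X : Mat n p) : Mat n p :=
  X * ((3 / 2 : ℝ) • (1 : Mat p p) - (1 / 2 : ℝ) • (X.transpose * X))

theorem schulz_eq (X : Mat n p) : schulz X = X - (1 / 2 : ℝ) • orthField X := by
  have e1 : (3 / 2 : ℝ) • (1 : Mat p p) - (1 / 2 : ℝ) • (X.transpose * X)
      = 1 - (1 / 2 : ℝ) • orthResidual X := by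
    rw [transpose_mul_self_eq]; module
  rw [schulz, e1, orthField, Matrix.mul_sub, Matrix.mul_one, Matrix.mul_smul]

/-- Every term is a polynomial in the residual alone. At s = 1 the linear term vanishes, the
quadratic convergence of Newton-Schulz; for s between 0 and 1 it yields that the segment from X to
`schulz X` does not leave the region. -/
theorem orthResidual_sub_orthField (X : Mat n p) (s : ℝ) :
    orthResidual (X - (s / 2) • orthField X) = (1 - s) • orthResidual X
      + (s ^ 2 / 4 - s) • (orthResidual X * orthResidual X)
      + (s ^ 2 / 4) • (orthResidual X * (orthResidual X * orthResidual X)) := by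
  have h1 : X.transpose * orthField X
      = orthResidual X + orthResidual X * orthResidual X := by
    rw [orthField, ← Matrix.mul_assoc, transpose_mul_self_eq, Matrix.add_mul, Matrix.one_mul]
  have h2 : (orthField X).transpose * X = orthResidual X + orthResidual X * orthResidual X := by
    rw [orthField, Matrix.transpose_mul, orthResidual_transpose, Matrix.mul_assoc,
      transpose_mul_self_eq, Matrix.mul_add, Matrix.mul_one]
  have h3 : (orthField X).transpose * orthField X = orthResidual X * orthResidual X
      + orthResidual X * (orthResidual X * orthResidual X) := by
    nth_rw 1 [orthField]
    rw [Matrix.transpose_mul, orthResidual_transpose, Matrix.mul_assoc, h1, Matrix.mul_add]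
  rw [orthResidual_sub, Matrix.transpose_smul, Matrix.mul_smul, Matrix.smul_mul, Matrix.mul_smul,
    Matrix.smul_mul, h1, h2, h3]
  module

theorem sub_orthField_mem_region {X : Mat n p} (hX : X ∈ region n p) {s : ℝ} (h0 : 0 ≤ s)
    (h1 : s ≤ 1) : X - (s / 2) • orthField X ∈ region n p := by
  have hR : ‖orthResidual X‖ ≤ 1 / 6 := hX
  change ‖_‖ ≤ _
  set r := ‖orthResidual X‖ with hr
  have hr0 : 0 ≤ r := norm_nonneg _
  have a2 : ‖orthResidual X * orthResidual X‖ ≤ r / 6 := by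
    refine (mat_norm_mul_le _ _).trans ?_
    rw [← hr]; nlinarith
  have a3 : ‖orthResidual X * (orthResidual X * orthResidual X)‖ ≤ r / 36 := by
    refine (mat_norm_mul_le _ _).trans ?_
    rw [← hr]; nlinarith [norm_nonneg (orthResidual X * orthResidual X)]
  rw [orthResidual_sub_orthField]
  have b1 : ‖(1 - s) • orthResidual X‖ = (1 - s) * r := by
    rw [norm_smul, Real.norm_of_nonneg (by linarith)]
  have b2 : ‖(s ^ 2 / 4 - s) • (orthResidual X * orthResidual X)‖ ≤ s * (r / 6) := by
    rw [norm_smul]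
    have : ‖s ^ 2 / 4 - s‖ ≤ s := by
      rw [Real.norm_eq_abs, abs_le]; constructor <;> nlinarith
    gcongr
  have b3 : ‖(s ^ 2 / 4) • (orthResidual X * (orthResidual X * orthResidual X))‖
      ≤ s * (r / 36) := by
    rw [norm_smul]
    have : ‖s ^ 2 / 4‖ ≤ s := by
      rw [Real.norm_eq_abs, abs_le]; constructor <;> nlinarith
    gcongr
  refine (norm_add₃_le).trans ?_
  nlinarith

theorem schulz_mem_region {X : Mat n p} (hX : X ∈ region n p) : schulz X ∈ region n p := by
  rw [schulz_eq]
  exact sub_orthField_mem_region hX zero_le_one le_rfl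

theorem norm_sub_schulz_le {X : Mat n p} (hX : X ∈ region n p) :
    ‖X - schulz X‖ ≤ ‖orthResidual X‖ := by
  have := norm_orthField_le hX
  rw [schulz_eq, sub_sub_cancel, norm_smul]
  norm_num
  linarith [norm_nonneg (orthResidual X)]

/-- Along a line `schulz` is an exact cubic polynomial, so its derivative can be read off by
expanding at the point in question. -/
theorem schulz_add_smul (X V : Mat n p) : ∃ A B : Mat n p, ∀ t : ℝ,
    schulz (X + t • V) = schulz X + t • riemMap X V + t ^ 2 • A + t ^ 3 • B := by
  refine ⟨-((1 / 2 : ℝ) • (X * (V.transpose * V) + V * (X.transpose * V)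
    + V * (V.transpose * X))), -((1 / 2 : ℝ) • (V * (V.transpose * V))), fun t => ?_⟩
  simp only [schulz, riemMap, symPart, Matrix.transpose_add, Matrix.transpose_smul,
    Matrix.transpose_mul, Matrix.transpose_transpose, Matrix.add_mul, Matrix.mul_add,
    Matrix.mul_sub, Matrix.smul_mul, Matrix.mul_smul, Matrix.mul_one]
  module

theorem hasDerivAt_schulz (X V : Mat n p) (s : ℝ) :
    HasDerivAt (fun t : ℝ => schulz (X + t • V)) (riemMap (X + s • V) V) s := by
  obtain ⟨A, B, h⟩ := schulz_add_smul (X + s • V) V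
  have e : (fun t : ℝ => schulz (X + t • V)) = fun t => schulz (X + s • V)
      + (t - s) • riemMap (X + s • V) V + (t - s) ^ 2 • A + (t - s) ^ 3 • B := by
    funext t
    rw [← h]
    congr 1
    module
  rw [e]
  have h0 : HasDerivAt (fun t : ℝ => t - s) 1 s := (hasDerivAt_id s).sub_const s
  have h1 := h0.smul_const (riemMap (X + s • V) V)
  have h2 := (h0.pow 2).smul_const A
  have h3 := (h0.pow 3).smul_const B
  have h4 := ((h1.const_add (schulz (X + s • V))).add h2).add h3
  have e2 : (1 : ℝ) • riemMap (X + s • V) V + (((2 : ℕ) : ℝ) * (s - s) ^ (2 - 1) * 1) • A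
      + (((3 : ℕ) : ℝ) * (s - s) ^ (3 - 1) * 1) • B = riemMap (X + s • V) V := by simp
  rw [e2] at h4
  exact h4

end Retract

/-! ### Gradients -/

section Gradient

variable {n p d l : ℕ}

theorem fderiv_eq_inner_matGrad (g : Mat n p → ℝ) (X V : Mat n p) :
    fderiv ℝ g X V = inner ℝ (matGrad g X) V := by
  conv_lhs => rw [Matrix.matrix_eq_sum_single V]
  simp only [map_sum, inner]
  refine Finset.sum_congr rfl fun a _ => Finset.sum_congr rfl fun b _ => ?_
  have h : Matrix.single a b (V a b) = V a b • Matrix.single a b (1 : ℝ) := by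
    rw [Matrix.smul_single, smul_eq_mul, mul_one]
  rw [h, map_smul, smul_eq_mul, matGrad, Matrix.of_apply, mul_comm]

theorem matGrad_const_mul_sum {ι : Type*} [Fintype ι] (c : ℝ) {g : ι → Mat n p → ℝ}
    (hg : ∀ j, Differentiable ℝ (g j)) (X : Mat n p) :
    matGrad (fun X => c * ∑ j, g j X) X = c • ∑ j, matGrad (g j) X := by
  have h : HasFDerivAt (fun X => c * ∑ j, g j X) (c • ∑ j, fderiv ℝ (g j) X) X :=
    (HasFDerivAt.fun_sum fun j _ => (hg j X).hasFDerivAt).const_mul c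
  ext a b
  rw [matGrad, Matrix.of_apply, h.fderiv]
  simp [Matrix.sum_apply, matGrad]

theorem differentiable_localCost {f : Costs n p d l} (hf : ∀ i j, Differentiable ℝ (f i j))
    (i : Fin d) : Differentiable ℝ (localCost f i) :=
  (Differentiable.fun_sum fun j _ => hf i j).const_mul _

theorem differentiable_globalCost {f : Costs n p d l} (hf : ∀ i j, Differentiable ℝ (f i j)) :
    Differentiable ℝ (globalCost f) :=
  (Differentiable.fun_sum fun i _ => differentiable_localCost hf i).const_mul _

theorem genRiemGrad_const_mul_sum {ι : Type*} [Fintype ι] (c : ℝ) {g : ι → Mat n p → ℝ}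
    (hg : ∀ j, Differentiable ℝ (g j)) (X : Mat n p) :
    genRiemGrad (fun X => c * ∑ j, g j X) X = c • ∑ j, genRiemGrad (g j) X := by
  simp only [genRiemGrad_eq, matGrad_const_mul_sum c hg, riemMap_smul, riemMap_sum]

theorem genRiemGrad_localCost {f : Costs n p d l} (hf : ∀ i j, Differentiable ℝ (f i j))
    (i : Fin d) (X : Mat n p) :
    genRiemGrad (localCost f i) X = (1 / (l : ℝ)) • ∑ j, genRiemGrad (f i j) X :=
  genRiemGrad_const_mul_sum _ (hf i) X

theorem genRiemGrad_globalCost {f : Costs n p d l} (hf : ∀ i j, Differentiable ℝ (f i j))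
    (X : Mat n p) :
    genRiemGrad (globalCost f) X = (1 / (d : ℝ)) • ∑ i, genRiemGrad (localCost f i) X :=
  genRiemGrad_const_mul_sum _ (differentiable_localCost hf) X

theorem searchDir_localCost (hl : 0 < l) {f : Costs n p d l}
    (hf : ∀ i j, Differentiable ℝ (f i j)) (β : ℝ) (i : Fin d) (X : Mat n p) :
    searchDir β (localCost f i) X = (1 / (l : ℝ)) • ∑ j, searchDir β (f i j) X := by
  have : (l : ℝ) ≠ 0 := by positivity
  simp only [searchDir, genRiemGrad_localCost hf, Finset.sum_add_distrib, smul_add,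
    Finset.sum_const, Finset.card_univ, Fintype.card_fin, ← Nat.cast_smul_eq_nsmul ℝ]
  rw [smul_smul, one_div_mul_cancel this, one_smul]

theorem searchDir_globalCost (hd : 0 < d) {f : Costs n p d l}
    (hf : ∀ i j, Differentiable ℝ (f i j)) (β : ℝ) (X : Mat n p) :
    searchDir β (globalCost f) X = (1 / (d : ℝ)) • ∑ i, searchDir β (localCost f i) X := by
  have : (d : ℝ) ≠ 0 := by positivity
  simp only [searchDir, genRiemGrad_globalCost hf, Finset.sum_add_distrib, smul_add,
    Finset.sum_const, Finset.card_univ, Fintype.card_fin, ← Nat.cast_smul_eq_nsmul ℝ]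
  rw [smul_smul, one_div_mul_cancel this, one_smul]

theorem hasDerivAt_comp_line {f : Mat n p → ℝ} (hf : Differentiable ℝ f) (X V : Mat n p) (s : ℝ) :
    HasDerivAt (fun t : ℝ => f (X + t • V)) (inner ℝ (matGrad f (X + s • V)) V) s := by
  have h1 : HasDerivAt (fun t : ℝ => X + t • V) V s := by
    have := ((hasDerivAt_id s).smul_const V).const_add X
    rw [one_smul] at this
    exact this
  have h2 := (hf (X + s • V)).hasFDerivAt.comp_hasDerivAt s h1
  rw [← fderiv_eq_inner_matGrad]
  exact h2

/-- The chain rule gives the gradient paired with `riemMap` of V, and self-adjointness moves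
`riemMap` onto the gradient. -/
theorem hasDerivAt_comp_schulz_line {f : Mat n p → ℝ} (hf : Differentiable ℝ f) (X V : Mat n p)
    (s : ℝ) : HasDerivAt (fun t : ℝ => f (schulz (X + t • V)))
      (inner ℝ (riemMap (X + s • V) (matGrad f (schulz (X + s • V)))) V) s := by
  have h2 := (hf (schulz (X + s • V))).hasFDerivAt.comp_hasDerivAt s (hasDerivAt_schulz X V s)
  rw [inner_riemMap, ← fderiv_eq_inner_matGrad]
  exact h2

end Gradient

/-! ### The merit function -/

section Merit

variable {n p : ℕ}

/-- Lipschitz-type constant of the gradient of `f ∘ schulz`. -/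
def schulzLip (L ρ β : ℝ) : ℝ := L + 3 * ρ * β

/-- Weight of the penalty in the merit function. -/
def penaltyWeight (L ρ β : ℝ) : ℝ := 2 * β ^ 2 + 2 * schulzLip L ρ β ^ 2 + 1

/-- The merit function: the cost at the approximate retraction plus a quadratic penalty. -/
def merit (L ρ β : ℝ) (f : Mat n p → ℝ) (X : Mat n p) : ℝ :=
  f (schulz X) + penaltyWeight L ρ β * ‖orthResidual X‖ ^ 2

/-- Coefficient of the second-order terms in the descent inequality. -/
def curvature (L ρ β : ℝ) : ℝ :=
  (2 * ρ + 1) * schulzLip L ρ β + L + penaltyWeight L ρ β * (1 + (2 * ρ + 1) ^ 2)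

/-- The properties of the global cost near the Stiefel manifold that enter the descent
inequality. -/
structure IsRiemSmooth (f : Mat n p → ℝ) (L ρ β M : ℝ) : Prop where
  differentiable : Differentiable ℝ f
  norm_le : ∀ X ∈ region n p, ‖X‖ ≤ ρ
  grad_le : ∀ X ∈ region n p, ‖matGrad f X‖ ≤ M
  lip : ∀ X ∈ region n p, ∀ Y ∈ region n p,
    ‖genRiemGrad f X - genRiemGrad f Y‖ ≤ L * ‖X - Y‖
  L_nonneg : 0 ≤ L
  ρ_nonneg : 0 ≤ ρ
  M_nonneg : 0 ≤ M
  one_le : 1 ≤ β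
  threshold : 6 + 21 * M ≤ 5 * β

variable {f : Mat n p → ℝ} {L ρ β M : ℝ}

theorem IsRiemSmooth.schulzLip_nonneg (h : IsRiemSmooth f L ρ β M) : 0 ≤ schulzLip L ρ β := by
  have := h.L_nonneg
  have := h.ρ_nonneg
  have := h.one_le
  unfold schulzLip
  positivity

/-- This is where the penalty threshold acts. The β-term contributes at least 5β/6 times the squared
residual, while the generalized gradient can take away at most (3/2)(11/10)M times it. -/
theorem IsRiemSmooth.le_inner_orthField_searchDir (h : IsRiemSmooth f L ρ β M) {X : Mat n p}
    (hX : X ∈ region n p) :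
    ‖orthResidual X‖ ^ 2 ≤ inner ℝ (orthField X) (searchDir β f X) := by
  rw [searchDir, genRiemGrad_eq, inner_add_right, inner_orthField_riemMap, inner_smul_right,
    real_inner_self_eq_norm_sq]
  have h1 : 5 / 6 * ‖orthResidual X‖ ^ 2 ≤ ‖orthField X‖ ^ 2 := le_norm_mul_sq_of_mem_region hX _
  have h2 : inner ℝ (orthResidual X * orthResidual X) (X.transpose * matGrad f X)
      ≤ ‖orthResidual X‖ ^ 2 * (11 / 10 * M) := by
    refine (real_inner_le_norm _ _).trans ?_
    have a1 := mat_norm_mul_le (orthResidual X) (orthResidual X)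
    have a2 := norm_transpose_mul_le_of_mem_region hX (matGrad f X)
    have a3 := h.grad_le X hX
    rw [sq]
    gcongr
    linarith
  have h3 := h.threshold
  have h4 := h.M_nonneg
  have h5 := sq_nonneg ‖orthResidual X‖
  have h6 := h.one_le
  nlinarith [mul_nonneg h4 h5, mul_le_mul_of_nonneg_left h1 (by linarith : 0 ≤ β)]

theorem IsRiemSmooth.norm_orthResidual_step_sq_le (h : IsRiemSmooth f L ρ β M) {X : Mat n p}
    (hX : X ∈ region n p) {V e : Mat n p} (hV : V = searchDir β f X + e) {η : ℝ} (hη : 0 ≤ η)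
    (hηV : η * ‖V‖ ≤ 1) :
    ‖orthResidual (X - η • V)‖ ^ 2 ≤ ‖orthResidual X‖ ^ 2 - 3 * η * ‖orthResidual X‖ ^ 2
      + 16 * η * ‖e‖ ^ 2 + (1 + (2 * ρ + 1) ^ 2) * η ^ 2 * ‖V‖ ^ 2 := by
  have e0 : ‖η • V‖ = η * ‖V‖ := by rw [norm_smul, Real.norm_of_nonneg hη]
  have h1 := norm_orthResidual_sub_sq_le hX (h.norm_le X hX) (Y := η • V) (by rwa [e0])
  rw [e0, inner_smul_right] at h1
  have h2 := h.le_inner_orthField_searchDir hX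
  have h3 : -(2 * ‖orthResidual X‖ * ‖e‖) ≤ inner ℝ (orthField X) e := by
    have a1 := abs_le.1 (abs_real_inner_le_norm (orthField X) e)
    have a2 := mul_le_mul_of_nonneg_right (norm_orthField_le hX) (norm_nonneg e)
    nlinarith [mul_nonneg (norm_nonneg (orthResidual X)) (norm_nonneg e)]
  have h4 : inner ℝ (orthField X) V = inner ℝ (orthField X) (searchDir β f X)
      + inner ℝ (orthField X) e := by rw [hV, inner_add_right]
  -- Of the coefficient 4 in front of the squared residual, one unit pays for the cross term 8‖R‖‖e‖
  -- by Young's inequality, where R is the residual.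
  have h5 : 3 * ‖orthResidual X‖ ^ 2 - 16 * ‖e‖ ^ 2 ≤ 4 * inner ℝ (orthField X) V := by
    rw [h4]
    nlinarith [sq_nonneg (‖orthResidual X‖ - 4 * ‖e‖)]
  have h6 := mul_le_mul_of_nonneg_left h5 hη
  nlinarith

/-- The squared residual contracts at rate 3η. At the boundary value 1/36 this gains η/12, which is
what the perturbation is allowed to cost. -/
theorem IsRiemSmooth.step_mem_region (h : IsRiemSmooth f L ρ β M) {X : Mat n p}
    (hX : X ∈ region n p) {V e : Mat n p} (hV : V = searchDir β f X + e) {η : ℝ} (hη : 0 ≤ η)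
    (hη3 : 3 * η ≤ 1) (hηV : η * ‖V‖ ≤ 1)
    (hsmall : 16 * ‖e‖ ^ 2 + (1 + (2 * ρ + 1) ^ 2) * η * ‖V‖ ^ 2 ≤ 1 / 12) :
    X - η • V ∈ region n p := by
  have h1 := h.norm_orthResidual_step_sq_le hX hV hη hηV
  have h2 : ‖orthResidual X‖ ≤ 1 / 6 := hX
  have h3 : ‖orthResidual X‖ ^ 2 ≤ 1 / 36 := by nlinarith [norm_nonneg (orthResidual X)]
  have h4 := mul_le_mul_of_nonneg_left hsmall hη
  have h5 : ‖orthResidual (X - η • V)‖ ^ 2 ≤ (1 / 6) ^ 2 := by nlinarith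
  exact (sq_le_sq₀ (norm_nonneg _) (by norm_num)).1 h5

/-- The base point is first moved from X to `schulz X` with the gradient of f fixed, and then the
Lipschitz bound for the generalized gradient is used. Both moves have length at most the residual. A
Lipschitz constant of the gradient of f is avoided, and the bound M on that gradient is replaced by
β. -/
theorem IsRiemSmooth.norm_riemMap_schulz_sub_le (h : IsRiemSmooth f L ρ β M) {X : Mat n p}
    (hX : X ∈ region n p) :
    ‖riemMap X (matGrad f (schulz X)) - genRiemGrad f X‖
      ≤ schulzLip L ρ β * ‖orthResidual X‖ := by
  have hY := schulz_mem_region hX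
  have h1 := h.lip (schulz X) hY X hX
  have h2 := norm_riemMap_sub_le (h.norm_le X hX) (h.norm_le _ hY) (matGrad f (schulz X))
  have h3 := h.grad_le _ hY
  have h4 := norm_sub_schulz_le hX
  have h5 : M ≤ β := by linarith [h.threshold, h.one_le, h.M_nonneg]
  have e : riemMap X (matGrad f (schulz X)) - genRiemGrad f X
      = (riemMap X (matGrad f (schulz X)) - riemMap (schulz X) (matGrad f (schulz X)))
        + (genRiemGrad f (schulz X) - genRiemGrad f X) := by
    rw [genRiemGrad_eq f (schulz X)]; abel
  rw [e]
  refine (norm_add_le _ _).trans ?_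
  rw [norm_sub_rev (schulz X) X] at h1
  have h6 : 3 * ρ * ‖X - schulz X‖ * ‖matGrad f (schulz X)‖ ≤ 3 * ρ * ‖X - schulz X‖ * β := by
    have := h.ρ_nonneg
    gcongr
    linarith
  have h7 := mul_le_mul_of_nonneg_left h4 h.schulzLip_nonneg
  unfold schulzLip at *
  linarith

/-- The mean value theorem gives the exact slope at an intermediate point. That slope is compared
with the generalized gradient at X, at the cost of the residual at the intermediate point and of the
distance travelled. -/
theorem IsRiemSmooth.comp_schulz_step_le (h : IsRiemSmooth f L ρ β M) {X V : Mat n p} {η : ℝ}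
    (hη : 0 ≤ η) (hηV : η * ‖V‖ ≤ 1)
    (hseg : ∀ s : ℝ, 0 ≤ s → s ≤ 1 → X - (s * η) • V ∈ region n p) :
    f (schulz (X - η • V)) ≤ f (schulz X) - η * inner ℝ (genRiemGrad f X) V
      + η * (schulzLip L ρ β * ‖orthResidual X‖ * ‖V‖)
      + ((2 * ρ + 1) * schulzLip L ρ β + L) * η ^ 2 * ‖V‖ ^ 2 := by
  have hX : X ∈ region n p := by simpa using hseg 0 le_rfl zero_le_one
  have hd := fun s => hasDerivAt_comp_schulz_line h.differentiable X (-(η • V)) s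
  obtain ⟨s, ⟨hs0, hs1⟩, hs⟩ := exists_hasDerivAt_eq_slope
    (fun t : ℝ => f (schulz (X + t • -(η • V)))) _ zero_lt_one
    (fun t _ => (hd t).continuousAt.continuousWithinAt) (fun t _ => hd t)
  have e0 : X + (1 : ℝ) • -(η • V) = X - η • V := by module
  have e1 : X + (0 : ℝ) • -(η • V) = X := by module
  have e2 : X + s • -(η • V) = X - (s * η) • V := by module
  simp only [e0, e1, e2, sub_zero, div_one, inner_neg_right, inner_smul_right] at hs
  set Z := X - (s * η) • V with hZ
  have hZr : Z ∈ region n p := hseg s hs0.le hs1.le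
  have hn : ‖(s * η) • V‖ ≤ η * ‖V‖ := by
    rw [norm_smul, Real.norm_of_nonneg (by positivity)]
    have : s * η ≤ η := by nlinarith
    gcongr
  have b1 := h.norm_riemMap_schulz_sub_le hZr
  have b2 : ‖genRiemGrad f Z - genRiemGrad f X‖ ≤ L * (η * ‖V‖) := by
    refine (h.lip Z hZr X hX).trans ?_
    have := h.L_nonneg
    gcongr
    rwa [hZ, sub_sub_cancel_left, norm_neg]
  have b3 : ‖orthResidual Z‖ ≤ ‖orthResidual X‖ + (2 * ρ + 1) * (η * ‖V‖) := by
    have a1 := norm_orthResidual_sub_le (h.norm_le X hX) (hn.trans hηV)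
    have a2 := norm_le_norm_add_norm_sub' (orthResidual Z) (orthResidual X)
    have a3 := mul_le_mul_of_nonneg_left hn (by linarith [h.ρ_nonneg] : 0 ≤ 2 * ρ + 1)
    linarith
  have b4 : inner ℝ (genRiemGrad f X) V - inner ℝ (riemMap Z (matGrad f (schulz Z))) V
      ≤ (schulzLip L ρ β * (‖orthResidual X‖ + (2 * ρ + 1) * (η * ‖V‖)) + L * (η * ‖V‖)) * ‖V‖ := by
    rw [← inner_sub_left]
    refine (real_inner_le_norm _ _).trans ?_
    gcongr
    have a1 := norm_sub_le_norm_sub_add_norm_sub (genRiemGrad f X) (genRiemGrad f Z)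
      (riemMap Z (matGrad f (schulz Z)))
    have a2 := mul_le_mul_of_nonneg_left b3 h.schulzLip_nonneg
    rw [norm_sub_rev] at b1 b2
    linarith
  have b5 := mul_le_mul_of_nonneg_left b4 hη
  nlinarith

/-- The cost part produces descent in the generalized gradient but leaves positive multiples of the
squared residual; the contraction of the residual, weighted by the penalty, removes them. The second
conclusion later bounds the displacement of the average by the stationarity measure. -/
theorem IsRiemSmooth.merit_step_le (h : IsRiemSmooth f L ρ β M) {X V e : Mat n p}
    (hV : V = searchDir β f X + e) {η : ℝ}
    (hη : 0 ≤ η) (hηV : η * ‖V‖ ≤ 1) (hηc : η * (24 * curvature L ρ β) ≤ 1)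
    (hseg : ∀ s : ℝ, 0 ≤ s → s ≤ 1 → X - (s * η) • V ∈ region n p) :
    merit L ρ β f (X - η • V) ≤ merit L ρ β f X
      - η / 4 * (‖genRiemGrad f X‖ ^ 2 + ‖orthResidual X‖ ^ 2)
      + (2 + 16 * penaltyWeight L ρ β) * η * ‖e‖ ^ 2 ∧
    ‖V‖ ^ 2 ≤ 3 * ‖genRiemGrad f X‖ ^ 2 + 12 * β ^ 2 * ‖orthResidual X‖ ^ 2 + 3 * ‖e‖ ^ 2 := by
  have hX : X ∈ region n p := by simpa using hseg 0 le_rfl zero_le_one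
  have h1 := h.comp_schulz_step_le hη hηV hseg
  have h2 := h.norm_orthResidual_step_sq_le hX hV hη hηV
  have hE := norm_orthField_le hX
  set g := genRiemGrad f X with hg
  set r := ‖orthResidual X‖ with hr
  set k := schulzLip L ρ β with hk
  set Γ := penaltyWeight L ρ β with hΓ
  have hr0 : 0 ≤ r := norm_nonneg _
  have hβ := h.one_le
  have hV' : V = g + β • orthField X + e := hV
  have hEb : ‖β • orthField X‖ ≤ 2 * β * r := by
    rw [norm_smul, Real.norm_of_nonneg (by linarith)]
    nlinarith
  have c1 : -inner ℝ g V ≤ -(1 / 2) * ‖g‖ ^ 2 + 4 * β ^ 2 * r ^ 2 + ‖e‖ ^ 2 := by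
    rw [hV', inner_add_right, inner_add_right, real_inner_self_eq_norm_sq]
    have a1 := (abs_le.1 (abs_real_inner_le_norm g (β • orthField X))).1
    have a2 := (abs_le.1 (abs_real_inner_le_norm g e)).1
    have a3 := mul_le_mul_of_nonneg_left hEb (norm_nonneg g)
    nlinarith [sq_nonneg (‖g‖ / 2 - 2 * β * r), sq_nonneg (‖g‖ / 2 - ‖e‖)]
  have c2 : ‖V‖ ^ 2 ≤ 3 * ‖g‖ ^ 2 + 12 * β ^ 2 * r ^ 2 + 3 * ‖e‖ ^ 2 := by
    have a1 : ‖V‖ ≤ ‖g‖ + 2 * β * r + ‖e‖ := by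
      rw [hV']
      exact (norm_add₃_le).trans (by linarith)
    have a2 : ‖V‖ ^ 2 ≤ (‖g‖ + 2 * β * r + ‖e‖) ^ 2 := by gcongr
    nlinarith [sq_nonneg (‖g‖ - 2 * β * r), sq_nonneg (‖g‖ - ‖e‖), sq_nonneg (2 * β * r - ‖e‖)]
  have c3 : k * r * ‖V‖ ≤ ‖V‖ ^ 2 / 24 + 6 * k ^ 2 * r ^ 2 := by
    nlinarith [sq_nonneg (‖V‖ - 12 * (k * r))]
  have c4 : curvature L ρ β * η ^ 2 * ‖V‖ ^ 2 ≤ η * (‖V‖ ^ 2 / 24) := by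
    have : curvature L ρ β * η ≤ 1 / 24 := by linarith
    nlinarith [mul_le_mul_of_nonneg_left this (mul_nonneg hη (sq_nonneg ‖V‖))]
  have hΓ0 : 0 ≤ Γ := by simp only [hΓ, penaltyWeight]; positivity
  have hΓe : Γ = 2 * β ^ 2 + 2 * k ^ 2 + 1 := rfl
  refine ⟨?_, c2⟩
  simp only [merit, ← hΓ, ← hr]
  have d1 := mul_le_mul_of_nonneg_left h2 hΓ0
  have d2 := mul_le_mul_of_nonneg_left c1 hη
  have d3 := mul_le_mul_of_nonneg_left c3 hη
  have d4 := mul_le_mul_of_nonneg_left c2 hη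
  have d5 : curvature L ρ β = (2 * ρ + 1) * k + L + Γ * (1 + (2 * ρ + 1) ^ 2) := rfl
  rw [d5] at c4
  -- The penalty gains 3Γr². The losses are 4β²r² from the cross term with `orthField`, 6k²r² from
  -- `c3`, and β²r² from the two terms ‖V‖²/24; what remains exceeds r²/4.
  have d6 : η * (r ^ 2 * (3 * Γ)) = η * (r ^ 2 * (6 * β ^ 2 + 6 * k ^ 2 + 3)) := by
    rw [hΓe]; ring
  have d7 : 0 ≤ η * r ^ 2 := by positivity
  have d8 : 0 ≤ η * ‖e‖ ^ 2 := by positivity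
  have d9 : 0 ≤ η * r ^ 2 * β ^ 2 := by positivity
  linarith

/-- Moving from X to `schulz X` stays in the region, where the gradient is at most M ≤ β, and covers
a distance less than one. It converts the initial merit value into the initial cost. -/
theorem IsRiemSmooth.merit_le (h : IsRiemSmooth f L ρ β M) {X : Mat n p} (hX : X ∈ region n p) :
    merit L ρ β f X ≤ f X + β + penaltyWeight L ρ β := by
  have hΓ0 : 0 ≤ penaltyWeight L ρ β := by simp only [penaltyWeight]; positivity
  have hr : ‖orthResidual X‖ ≤ 1 / 6 := hX
  have hr0 := norm_nonneg (orthResidual X)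
  have h5 : M ≤ β := by linarith [h.threshold, h.one_le, h.M_nonneg]
  have hd := fun s => hasDerivAt_comp_line h.differentiable X (-((1 / 2 : ℝ) • orthField X)) s
  obtain ⟨s, ⟨hs0, hs1⟩, hs⟩ := exists_hasDerivAt_eq_slope
    (fun t : ℝ => f (X + t • -((1 / 2 : ℝ) • orthField X))) _ zero_lt_one
    (fun t _ => (hd t).continuousAt.continuousWithinAt) (fun t _ => hd t)
  have e0 : X + (1 : ℝ) • -((1 / 2 : ℝ) • orthField X) = schulz X := by rw [schulz_eq]; module
  have e1 : X + (0 : ℝ) • -((1 / 2 : ℝ) • orthField X) = X := by module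
  have e2 : X + s • -((1 / 2 : ℝ) • orthField X) = X - (s / 2) • orthField X := by module
  simp only [e0, e1, e2, sub_zero, div_one, inner_neg_right, inner_smul_right] at hs
  have h1 := h.grad_le _ (sub_orthField_mem_region hX hs0.le hs1.le)
  have h2 := norm_orthField_le hX
  have h3 := (abs_le.1 (abs_real_inner_le_norm (matGrad f (X - (s / 2) • orthField X))
    (orthField X))).1
  have h4 : ‖matGrad f (X - (s / 2) • orthField X)‖ * ‖orthField X‖ ≤ β * 1 := by
    gcongr
    · linarith [h.one_le]
    · linarith
    · linarith
  have h6 : penaltyWeight L ρ β * ‖orthResidual X‖ ^ 2 ≤ penaltyWeight L ρ β * 1 := by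
    gcongr
    nlinarith
  have := h.one_le
  simp only [merit]
  linarith

end Merit

/-! ### Constants of the cost functions -/

section CostConstants

variable {n p d l : ℕ}

/-- The radius of `bigBall`. -/
def ballRadius (p d : ℕ) : ℝ := Real.sqrt (7 * (d : ℝ) * (p : ℝ) / 6) + Real.sqrt (d : ℝ)

theorem ballRadius_nonneg : 0 ≤ ballRadius p d := by unfold ballRadius; positivity

theorem norm_le_ballRadius {X : Mat n p} (hX : X ∈ bigBall n p d) : ‖X‖ ≤ ballRadius p d := hX

theorem zero_mem_bigBall : (0 : Mat n p) ∈ bigBall n p d := by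
  change ‖(0 : Mat n p)‖ ≤ ballRadius p d
  rw [norm_zero]
  exact ballRadius_nonneg

theorem stiefel_subset_bigBall (hd : 1 ≤ d) : stiefel n p ⊆ bigBall n p d := fun X hX =>
  region_subset_bigBall hd <| by
    have h : orthResidual X = 0 := sub_eq_zero.2 hX
    change ‖orthResidual X‖ ≤ 1 / 6
    rw [h, norm_zero]
    norm_num

theorem bigBall_eq : bigBall n p d = Metric.closedBall 0 (ballRadius p d) := by
  ext X
  rw [mem_closedBall_zero_iff]
  rfl

theorem norm_one_div_smul_sum_le {E : Type*} [NormedAddCommGroup E] [NormedSpace ℝ E] {m : ℕ}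
    (hm : 0 < m) {v : Fin m → E} {N : ℝ} (h : ∀ i, ‖v i‖ ≤ N) :
    ‖(1 / (m : ℝ)) • ∑ i, v i‖ ≤ N := by
  have hm' : (0 : ℝ) < m := by exact_mod_cast hm
  rw [norm_smul, Real.norm_of_nonneg (by positivity), one_div_mul_eq_div, div_le_iff₀ hm']
  refine (norm_sum_le _ _).trans ((Finset.sum_le_sum fun i _ => h i).trans ?_)
  simp [mul_comm]

/-- One term is at most the sum, at the price of a factor √l. This constant serves only to show that
the suprema in the definitions are finite, so its dependence on l never reaches the final bounds. -/
theorem IsMeanSquareLocallySmooth.exists_lipschitz {f : Costs n p d l}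
    (hf : IsMeanSquareLocallySmooth f) (hd : 1 ≤ d) : ∃ Λ : ℝ, 0 ≤ Λ ∧ ∀ i j,
    ∀ X ∈ bigBall n p d, ∀ Y ∈ bigBall n p d,
      ‖matGrad (f i j) X - matGrad (f i j) Y‖ ≤ Λ * ‖X - Y‖ := by
  obtain ⟨Λ, hΛ, h⟩ := hf.lipschitz (bigBall n p d)
    (by rw [bigBall_eq]; exact Metric.isBounded_closedBall) (stiefel_subset_bigBall hd)
  refine ⟨Real.sqrt l * Λ, by positivity, fun i j X hX Y hY => ?_⟩
  have hl : (0 : ℝ) < l := by exact_mod_cast j.pos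
  have h1 := h i X hX Y hY
  have h2 : ‖matGrad (f i j) X - matGrad (f i j) Y‖ ^ 2
      ≤ ∑ j, ‖matGrad (f i j) X - matGrad (f i j) Y‖ ^ 2 :=
    Finset.single_le_sum (f := fun j => ‖matGrad (f i j) X - matGrad (f i j) Y‖ ^ 2)
      (fun _ _ => sq_nonneg _) (Finset.mem_univ j)
  have h3 : ‖matGrad (f i j) X - matGrad (f i j) Y‖ ≤ Real.sqrt l * Real.sqrt ((1 / (l : ℝ)) *
      ∑ j, ‖matGrad (f i j) X - matGrad (f i j) Y‖ ^ 2) := by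
    rw [← Real.sqrt_mul hl.le, ← mul_assoc, mul_one_div_cancel hl.ne', one_mul]
    exact Real.le_sqrt_of_sq_le h2
  rw [mul_assoc]
  exact h3.trans (by gcongr)

theorem IsMeanSquareLocallySmooth.exists_bound {f : Costs n p d l}
    (hf : IsMeanSquareLocallySmooth f) (hd : 1 ≤ d) : ∃ N : ℝ, 0 ≤ N ∧ ∀ i j,
    ∀ X ∈ bigBall n p d, ‖matGrad (f i j) X‖ ≤ N := by
  obtain ⟨Λ, hΛ, h⟩ := hf.exists_lipschitz hd
  have hρ : 0 ≤ ballRadius p d := ballRadius_nonneg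
  refine ⟨∑ i, ∑ j, ‖matGrad (f i j) 0‖ + Λ * ballRadius p d, by positivity,
    fun i j X hX => ?_⟩
  have h1 := h i j X hX 0 zero_mem_bigBall
  have h2 : ‖matGrad (f i j) 0‖ ≤ ∑ i, ∑ j, ‖matGrad (f i j) 0‖ :=
    (Finset.single_le_sum (f := fun j => ‖matGrad (f i j) 0‖) (fun _ _ => norm_nonneg _)
      (Finset.mem_univ j)).trans
    (Finset.single_le_sum (f := fun i => ∑ j, ‖matGrad (f i j) 0‖)
      (fun _ _ => Finset.sum_nonneg fun _ _ => norm_nonneg _) (Finset.mem_univ i))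
  have h3 := norm_le_norm_add_norm_sub' (matGrad (f i j) X) (matGrad (f i j) 0)
  rw [sub_zero] at h1
  have h4 := mul_le_mul_of_nonneg_left (norm_le_ballRadius hX) hΛ
  linarith

/-- A real supremum of an unbounded set has the default value 0, so boundedness of the set must be
established before `dirSup` bounds anything. The same applies to `dirLip` and `gradSup` below. -/
theorem IsMeanSquareLocallySmooth.norm_genRiemGrad_le {f : Costs n p d l}
    (hf : IsMeanSquareLocallySmooth f) (hd : 1 ≤ d) {N : ℝ} (hN : dirSup f ≤ N) (i : Fin d)
    (j : Fin l) {X : Mat n p} (hX : X ∈ bigBall n p d) : ‖genRiemGrad (f i j) X‖ ≤ N := by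
  refine le_trans (b := dirSup f) (le_csSup ?_ ⟨i, j, X, hX, rfl⟩) hN
  obtain ⟨B, hB, h⟩ := hf.exists_bound hd
  refine ⟨(3 / 2 + 3 * ballRadius p d ^ 2) * B, ?_⟩
  rintro _ ⟨i, j, X, hX, rfl⟩
  refine (norm_riemMap_le (norm_le_ballRadius hX) _).trans ?_
  gcongr
  exact h i j X hX

theorem IsMeanSquareLocallySmooth.norm_genRiemGrad_sub_le {f : Costs n p d l}
    (hf : IsMeanSquareLocallySmooth f) (hd : 1 ≤ d) {L : ℝ} (hL : dirLip f ≤ L) (i : Fin d)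
    (j : Fin l) {X Y : Mat n p} (hX : X ∈ bigBall n p d) (hY : Y ∈ bigBall n p d) :
    ‖genRiemGrad (f i j) X - genRiemGrad (f i j) Y‖ ≤ L * ‖X - Y‖ := by
  rcases eq_or_ne X Y with rfl | hXY
  · simp
  have hpos : 0 < ‖X - Y‖ := norm_pos_iff.2 (sub_ne_zero.2 hXY)
  rw [← div_le_iff₀ hpos]
  refine le_trans (b := dirLip f) (le_csSup ?_ ⟨i, j, X, hX, Y, hY, hXY, rfl⟩) hL
  obtain ⟨B, hB, h⟩ := hf.exists_bound hd
  obtain ⟨Λ, hΛ, h'⟩ := hf.exists_lipschitz hd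
  refine ⟨(3 / 2 + 3 * ballRadius p d ^ 2) * Λ + 3 * ballRadius p d * B, ?_⟩
  rintro _ ⟨i, j, X, hX, Y, hY, hXY, rfl⟩
  rw [div_le_iff₀ (norm_pos_iff.2 (sub_ne_zero.2 hXY))]
  have e : genRiemGrad (f i j) X - genRiemGrad (f i j) Y
      = riemMap X (matGrad (f i j) X - matGrad (f i j) Y)
        + (riemMap X (matGrad (f i j) Y) - riemMap Y (matGrad (f i j) Y)) := by
    rw [riemMap_sub, genRiemGrad_eq, genRiemGrad_eq]; abel
  have h1 := norm_riemMap_le (norm_le_ballRadius hX) (matGrad (f i j) X - matGrad (f i j) Y)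
  have h2 := norm_riemMap_sub_le (norm_le_ballRadius hX) (norm_le_ballRadius hY)
    (matGrad (f i j) Y)
  have hρ : 0 ≤ ballRadius p d := ballRadius_nonneg
  have h3 : (3 / 2 + 3 * ballRadius p d ^ 2) * ‖matGrad (f i j) X - matGrad (f i j) Y‖
      ≤ (3 / 2 + 3 * ballRadius p d ^ 2) * (Λ * ‖X - Y‖) := by
    gcongr
    exact h' i j X hX Y hY
  have h4 : 3 * ballRadius p d * ‖X - Y‖ * ‖matGrad (f i j) Y‖
      ≤ 3 * ballRadius p d * ‖X - Y‖ * B := by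
    gcongr
    exact h i j Y hY
  rw [e]
  refine (norm_add_le _ _).trans ?_
  linarith

theorem norm_orthField_sub_le {ρ : ℝ} {X Y : Mat n p} (hX : ‖X‖ ≤ ρ) (hY : ‖Y‖ ≤ ρ) :
    ‖orthField X - orthField Y‖ ≤ (3 * ρ ^ 2 + 1) * ‖X - Y‖ := by
  have hρ : 0 ≤ ρ := (norm_nonneg X).trans hX
  have e : orthField X - orthField Y = (X - Y) * (X.transpose * X)
      + Y * ((X - Y).transpose * X) + Y * (Y.transpose * (X - Y)) - (X - Y) := by
    simp only [orthField, orthResidual, Matrix.transpose_sub, Matrix.sub_mul, Matrix.mul_sub,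
      Matrix.mul_one]
    abel
  have h : ∀ {a b c : ℕ} (A : Mat n a) (B : Mat a b) (C : Mat b c) {r s t : ℝ},
      ‖A‖ ≤ r → ‖B‖ ≤ s → ‖C‖ ≤ t → ‖A * (B * C)‖ ≤ r * (s * t) := by
    intro a b c A B C r s t hA hB hC
    have hr : 0 ≤ r := (norm_nonneg A).trans hA
    have hs : 0 ≤ s := (norm_nonneg B).trans hB
    refine (mat_norm_mul_le _ _).trans ?_
    gcongr
    exact (mat_norm_mul_le _ _).trans (by gcongr)
  have hT : ∀ {Z : Mat n p} {r : ℝ}, ‖Z‖ ≤ r → ‖Z.transpose‖ ≤ r := fun h => by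
    rwa [mat_norm_transpose]
  have h1 := h (X - Y) X.transpose X le_rfl (hT hX) hX
  have h2 := h Y (X - Y).transpose X hY (hT le_rfl) hX
  have h3 := h Y Y.transpose (X - Y) hY (hT hY) le_rfl
  rw [e]
  refine (norm_sub_le _ _).trans ?_
  have h4 := norm_add₃_le (a := (X - Y) * (X.transpose * X)) (b := Y * ((X - Y).transpose * X))
    (c := Y * (Y.transpose * (X - Y)))
  linarith

theorem norm_orthField_le_of_norm_le {ρ : ℝ} {X : Mat n p} (hX : ‖X‖ ≤ ρ) :
    ‖orthField X‖ ≤ (3 * ρ ^ 2 + 1) * ρ := by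
  have h := norm_orthField_sub_le hX (Y := 0) (by simpa using (norm_nonneg X).trans hX)
  have e : orthField (0 : Mat n p) = 0 := by simp [orthField]
  rw [e, sub_zero, sub_zero] at h
  exact h.trans (by gcongr)

/-- A Lipschitz constant of the search directions on `bigBall`. -/
def searchLip (L β : ℝ) (p d : ℕ) : ℝ := L + β * (3 * ballRadius p d ^ 2 + 1)

/-- A bound of the search directions on `bigBall`. -/
def searchBound (N β : ℝ) (p d : ℕ) : ℝ :=
  N + β * ((3 * ballRadius p d ^ 2 + 1) * ballRadius p d)

theorem IsMeanSquareLocallySmooth.norm_searchDir_le {f : Costs n p d l}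
    (hf : IsMeanSquareLocallySmooth f) (hd : 1 ≤ d) {N β : ℝ} (hN : dirSup f ≤ N) (hβ : 0 ≤ β)
    (i : Fin d) (j : Fin l) {X : Mat n p} (hX : X ∈ bigBall n p d) :
    ‖searchDir β (f i j) X‖ ≤ searchBound N β p d := by
  refine (norm_add_le _ _).trans (add_le_add (hf.norm_genRiemGrad_le hd hN i j hX) ?_)
  rw [norm_smul, Real.norm_of_nonneg hβ]
  gcongr
  exact norm_orthField_le_of_norm_le (norm_le_ballRadius hX)

theorem IsMeanSquareLocallySmooth.norm_searchDir_sub_le {f : Costs n p d l}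
    (hf : IsMeanSquareLocallySmooth f) (hd : 1 ≤ d) {L β : ℝ} (hL : dirLip f ≤ L) (hβ : 0 ≤ β)
    (i : Fin d) (j : Fin l) {X Y : Mat n p} (hX : X ∈ bigBall n p d) (hY : Y ∈ bigBall n p d) :
    ‖searchDir β (f i j) X - searchDir β (f i j) Y‖ ≤ searchLip L β p d * ‖X - Y‖ := by
  have e : searchDir β (f i j) X - searchDir β (f i j) Y
      = (genRiemGrad (f i j) X - genRiemGrad (f i j) Y) + β • (orthField X - orthField Y) := by
    simp only [searchDir, smul_sub]; abel
  rw [e, searchLip, add_mul]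
  refine (norm_add_le _ _).trans (add_le_add (hf.norm_genRiemGrad_sub_le hd hL i j hX hY) ?_)
  rw [norm_smul, Real.norm_of_nonneg hβ, mul_assoc]
  gcongr
  exact norm_orthField_sub_le (norm_le_ballRadius hX) (norm_le_ballRadius hY)

theorem IsMeanSquareLocallySmooth.norm_searchDir_localCost_le {f : Costs n p d l}
    (hf : IsMeanSquareLocallySmooth f) (hd : 1 ≤ d) (hl : 0 < l) {N β : ℝ} (hN : dirSup f ≤ N)
    (hβ : 0 ≤ β) (i : Fin d) {X : Mat n p} (hX : X ∈ bigBall n p d) :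
    ‖searchDir β (localCost f i) X‖ ≤ searchBound N β p d := by
  rw [searchDir_localCost hl hf.differentiable]
  exact norm_one_div_smul_sum_le hl fun j => hf.norm_searchDir_le hd hN hβ i j hX

theorem IsMeanSquareLocallySmooth.norm_searchDir_localCost_sub_le {f : Costs n p d l}
    (hf : IsMeanSquareLocallySmooth f) (hd : 1 ≤ d) (hl : 0 < l) {L β : ℝ} (hL : dirLip f ≤ L)
    (hβ : 0 ≤ β) (i : Fin d) {X Y : Mat n p} (hX : X ∈ bigBall n p d)
    (hY : Y ∈ bigBall n p d) :
    ‖searchDir β (localCost f i) X - searchDir β (localCost f i) Y‖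
      ≤ searchLip L β p d * ‖X - Y‖ := by
  rw [searchDir_localCost hl hf.differentiable, searchDir_localCost hl hf.differentiable,
    ← smul_sub, ← Finset.sum_sub_distrib]
  exact norm_one_div_smul_sum_le hl fun j => hf.norm_searchDir_sub_le hd hL hβ i j hX hY

theorem IsMeanSquareLocallySmooth.norm_genRiemGrad_globalCost_sub_le {f : Costs n p d l}
    (hf : IsMeanSquareLocallySmooth f) (hd : 1 ≤ d) (hl : 0 < l) {L : ℝ} (hL : dirLip f ≤ L)
    {X Y : Mat n p} (hX : X ∈ bigBall n p d) (hY : Y ∈ bigBall n p d) :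
    ‖genRiemGrad (globalCost f) X - genRiemGrad (globalCost f) Y‖ ≤ L * ‖X - Y‖ := by
  rw [genRiemGrad_globalCost hf.differentiable, genRiemGrad_globalCost hf.differentiable,
    ← smul_sub, ← Finset.sum_sub_distrib]
  refine norm_one_div_smul_sum_le hd fun i => ?_
  rw [genRiemGrad_localCost hf.differentiable, genRiemGrad_localCost hf.differentiable,
    ← smul_sub, ← Finset.sum_sub_distrib]
  exact norm_one_div_smul_sum_le hl fun j => hf.norm_genRiemGrad_sub_le hd hL i j hX hY

theorem IsMeanSquareLocallySmooth.norm_matGrad_globalCost_le {f : Costs n p d l}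
    (hf : IsMeanSquareLocallySmooth f) (hd : 1 ≤ d) (hl : 0 < l) {X : Mat n p}
    (hX : X ∈ region n p) : ‖matGrad (globalCost f) X‖ ≤ gradSup f := by
  refine le_csSup ?_ ⟨X, hX, rfl⟩
  obtain ⟨B, hB, h⟩ := hf.exists_bound hd
  refine ⟨B, ?_⟩
  rintro _ ⟨X, hX, rfl⟩
  have e : matGrad (globalCost f) X = (1 / (d : ℝ)) • ∑ i, matGrad (localCost f i) X :=
    matGrad_const_mul_sum _ (differentiable_localCost hf.differentiable) X
  rw [e]
  refine norm_one_div_smul_sum_le hd fun i => ?_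
  have e' : matGrad (localCost f i) X = (1 / (l : ℝ)) • ∑ j, matGrad (f i j) X :=
    matGrad_const_mul_sum _ (hf.differentiable i) X
  rw [e']
  exact norm_one_div_smul_sum_le hl fun j => h i j X (region_subset_bigBall hd hX)

theorem IsMeanSquareLocallySmooth.isRiemSmooth {f : Costs n p d l}
    (hf : IsMeanSquareLocallySmooth f) (hd : 1 ≤ d) (hl : 0 < l) {L β : ℝ} (hL : dirLip f ≤ L)
    (hL0 : 0 ≤ L) (hβ : penaltyThreshold f < β) :
    IsRiemSmooth (globalCost f) L (ballRadius p d) β (gradSup f) where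
  differentiable := differentiable_globalCost hf.differentiable
  norm_le X hX := norm_le_ballRadius (region_subset_bigBall hd hX)
  grad_le X hX := hf.norm_matGrad_globalCost_le hd hl hX
  lip X hX Y hY := hf.norm_genRiemGrad_globalCost_sub_le hd hl hL (region_subset_bigBall hd hX)
    (region_subset_bigBall hd hY)
  L_nonneg := hL0
  ρ_nonneg := ballRadius_nonneg
  M_nonneg := Real.sSup_nonneg (by rintro _ ⟨X, _, rfl⟩; exact norm_nonneg _)
  one_le := (le_max_left _ _).trans hβ.le
  threshold := by
    have h := (le_max_right 1 ((6 + 21 * gradSup f) / 5)).trans hβ.le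
    linarith

theorem dirLip_nonneg (f : Costs n p d l) : 0 ≤ dirLip f :=
  Real.sSup_nonneg (by rintro _ ⟨i, j, X, _, Y, _, _, rfl⟩; positivity)

theorem dirSup_nonneg (f : Costs n p d l) : 0 ≤ dirSup f :=
  Real.sSup_nonneg (by rintro _ ⟨i, j, X, _, rfl⟩; positivity)

theorem costInf_le {f : Costs n p d l} (hf : ∀ i j, Differentiable ℝ (f i j)) {X : Mat n p}
    (hX : X ∈ bigBall n p d) : costInf f ≤ globalCost f X := by
  refine csInf_le ?_ ⟨X, hX, rfl⟩
  have : ProperSpace (Mat n p) := FiniteDimensional.proper ℝ _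
  have hc : IsCompact (bigBall n p d) := by rw [bigBall_eq]; exact isCompact_closedBall _ _
  exact (hc.image (differentiable_globalCost hf).continuous).bddBelow

end CostConstants

/-! ### Mixing -/

section Mixing

variable {n p d : ℕ} {G : SimpleGraph (Fin d)} {W : Mat d d} {lam : ℝ}

theorem IsMixingMatrix.sum_mulVec (hW : IsMixingMatrix G W) (v : Fin d → ℝ) :
    ∑ i, W.mulVec v i = ∑ i, v i := by
  simp only [Matrix.mulVec, dotProduct]
  rw [Finset.sum_comm]
  simp [← Finset.sum_mul, hW.col_sum]

theorem secondEigenvalue_nonneg : 0 ≤ secondEigenvalue W :=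
  Real.sSup_nonneg (by rintro _ ⟨μ, v, _, _, _, rfl⟩; exact abs_nonneg _)

theorem abs_eigenvalue_le_secondEigenvalue {μ : ℝ} {v : Fin d → ℝ} (hv : v ≠ 0)
    (hsum : ∑ i, v i = 0) (hμ : W.mulVec v = μ • v) : |μ| ≤ secondEigenvalue W := by
  refine le_csSup ?_ ⟨μ, v, hv, hsum, hμ, rfl⟩
  refine ⟨‖LinearMap.toContinuousLinearMap (Matrix.mulVecLin W)‖, ?_⟩
  rintro _ ⟨μ, v, hv, _, hμ, rfl⟩
  have h := (LinearMap.toContinuousLinearMap (Matrix.mulVecLin W)).le_opNorm v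
  have e : LinearMap.toContinuousLinearMap (Matrix.mulVecLin W) v = μ • v := hμ
  rw [e, norm_smul] at h
  exact le_of_mul_le_mul_right h (norm_pos_iff.2 hv)

/-- The vectors of coordinate sum zero. -/
def sumZero (d : ℕ) : Submodule ℝ (EuclideanSpace ℝ (Fin d)) where
  carrier := {v | ∑ i, v i = 0}
  zero_mem' := by simp
  add_mem' {a b} ha hb := by
    simp only [Set.mem_ofPred_eq] at *
    simp [Finset.sum_add_distrib, ha, hb]
  smul_mem' c a ha := by
    simp only [Set.mem_ofPred_eq] at *
    simp [← Finset.mul_sum, ha]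

/-- W is symmetric and preserves the vectors of coordinate sum zero. In an orthonormal eigenbasis of
its restriction to that subspace, every eigenvalue is one of those over which `secondEigenvalue`
takes its supremum. -/
theorem IsMixingMatrix.sum_mulVec_sq_le (hW : IsMixingMatrix G W) (hlam : secondEigenvalue W ≤ lam)
    {v : Fin d → ℝ} (hv : ∑ i, v i = 0) :
    ∑ i, W.mulVec v i ^ 2 ≤ lam ^ 2 * ∑ i, v i ^ 2 := by
  set T : EuclideanSpace ℝ (Fin d) →ₗ[ℝ] EuclideanSpace ℝ (Fin d) := Matrix.toEuclideanLin W
    with hTdef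
  have hT : T.IsSymmetric := by
    rw [hTdef, Matrix.isSymmetric_toEuclideanLin_iff]
    rw [Matrix.IsHermitian, Matrix.conjTranspose_eq_transpose_of_trivial]
    exact hW.symm
  have hinv : ∀ u ∈ sumZero d, T u ∈ sumZero d := by
    intro u hu
    change ∑ i, W.mulVec (WithLp.ofLp u) i = 0
    rw [hW.sum_mulVec]
    exact hu
  have hS := hT.restrict_invariant hinv
  set b := hS.eigenvectorBasis rfl
  set u : sumZero d := ⟨WithLp.toLp 2 v, hv⟩ with hu
  have hb : ∀ i, |hS.eigenvalues rfl i| ≤ lam := by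
    intro i
    refine le_trans (abs_eigenvalue_le_secondEigenvalue
      (v := WithLp.ofLp (b i : EuclideanSpace ℝ (Fin d))) ?_ (b i).2 ?_) hlam
    · intro h0
      have h1 : b i = 0 := by
        apply Subtype.ext
        apply WithLp.ofLp_injective
        exact h0
      have := b.orthonormal.1 i
      rw [h1, norm_zero] at this
      exact zero_ne_one this
    · have h := hS.apply_eigenvectorBasis rfl i
      have h' := congrArg (fun z : sumZero d => WithLp.ofLp (z : EuclideanSpace ℝ (Fin d))) h
      exact h'
  have key : ‖T.restrict hinv u‖ ^ 2 ≤ lam ^ 2 * ‖u‖ ^ 2 := by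
    rw [← b.sum_sq_norm_inner_right, ← b.sum_sq_norm_inner_right u, Finset.mul_sum]
    refine Finset.sum_le_sum fun i _ => ?_
    have e : inner ℝ (b i) (T.restrict hinv u) = hS.eigenvalues rfl i * inner ℝ (b i) u := by
      rw [← hS, hS.apply_eigenvectorBasis rfl i, inner_smul_left]
      rfl
    rw [e, norm_mul, mul_pow]
    have := hb i
    have h0 : ‖hS.eigenvalues rfl i‖ ≤ lam := this
    gcongr
  have e1 : ‖T.restrict hinv u‖ ^ 2 = ∑ i, W.mulVec v i ^ 2 := by
    rw [Submodule.coe_norm, EuclideanSpace.norm_sq_eq]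
    refine Finset.sum_congr rfl fun i _ => ?_
    rw [Real.norm_eq_abs, sq_abs]
    rfl
  have e2 : ‖u‖ ^ 2 = ∑ i, v i ^ 2 := by
    rw [Submodule.coe_norm, EuclideanSpace.norm_sq_eq]
    refine Finset.sum_congr rfl fun i _ => ?_
    rw [Real.norm_eq_abs, sq_abs]
  rwa [e1, e2] at key

/-- The sum of the squared norms of the components. -/
def sqNorm (Z : Fin d → Mat n p) : ℝ := ∑ i, ‖Z i‖ ^ 2

/-- The deviation of the components from their average. -/
def deviation (Z : Fin d → Mat n p) : Fin d → Mat n p := fun i => Z i - average Z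

theorem sqNorm_nonneg (Z : Fin d → Mat n p) : 0 ≤ sqNorm Z :=
  Finset.sum_nonneg fun _ _ => sq_nonneg _

theorem norm_sq_le_sqNorm (Z : Fin d → Mat n p) (i : Fin d) : ‖Z i‖ ^ 2 ≤ sqNorm Z :=
  Finset.single_le_sum (f := fun i => ‖Z i‖ ^ 2) (fun _ _ => sq_nonneg _) (Finset.mem_univ i)

theorem sqNorm_le_sqNorm {Z Y : Fin d → Mat n p} (h : ∀ i, ‖Z i‖ ≤ ‖Y i‖) :
    sqNorm Z ≤ sqNorm Y :=
  Finset.sum_le_sum fun i _ => pow_le_pow_left₀ (norm_nonneg _) (h i) 2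

theorem sqNorm_le_card_mul {Z : Fin d → Mat n p} {r : ℝ} (h : ∀ i, ‖Z i‖ ≤ r) :
    sqNorm Z ≤ d * r ^ 2 :=
  (Finset.sum_le_sum fun i _ => pow_le_pow_left₀ (norm_nonneg _) (h i) 2).trans (by simp)

theorem sqNorm_smul (r : ℝ) (Z : Fin d → Mat n p) : sqNorm (r • Z) = r ^ 2 * sqNorm Z := by
  simp [sqNorm, Finset.mul_sum, norm_smul, mul_pow]

theorem norm_add_sq_le_two_mul {E : Type*} [SeminormedAddCommGroup E] (a b : E) :
    ‖a + b‖ ^ 2 ≤ 2 * ‖a‖ ^ 2 + 2 * ‖b‖ ^ 2 := by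
  have h : ‖a + b‖ ^ 2 ≤ (‖a‖ + ‖b‖) ^ 2 := by gcongr; exact norm_add_le _ _
  nlinarith [sq_nonneg (‖a‖ - ‖b‖)]

theorem sqNorm_add_le (Z Y : Fin d → Mat n p) : sqNorm (Z + Y) ≤ 2 * sqNorm Z + 2 * sqNorm Y := by
  simp only [sqNorm, Finset.mul_sum, ← Finset.sum_add_distrib]
  exact Finset.sum_le_sum fun i _ => norm_add_sq_le_two_mul _ _

theorem sqNorm_sub_le (Z Y : Fin d → Mat n p) : sqNorm (Z - Y) ≤ 2 * sqNorm Z + 2 * sqNorm Y := by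
  have h := sqNorm_add_le Z (-Y)
  have e : sqNorm (-Y) = sqNorm Y := by simp [sqNorm]
  rwa [e, ← sub_eq_add_neg] at h

theorem norm_add_sq_le_weighted {E : Type*} [SeminormedAddCommGroup E] {t : ℝ}
    (h1 : t < 1) (a b : E) : ‖a + b‖ ^ 2 ≤ (2 - t) * ‖a‖ ^ 2 + (1 + 1 / (1 - t)) * ‖b‖ ^ 2 := by
  have h : ‖a + b‖ ^ 2 ≤ (‖a‖ + ‖b‖) ^ 2 := by gcongr; exact norm_add_le _ _
  have h2 : 0 < 1 - t := by linarith
  have h3 : 2 * ‖a‖ * ‖b‖ ≤ (1 - t) * ‖a‖ ^ 2 + 1 / (1 - t) * ‖b‖ ^ 2 := by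
    have := sq_nonneg ((1 - t) * ‖a‖ - ‖b‖)
    rw [one_div_mul_eq_div, ← sub_le_iff_le_add', le_div_iff₀ h2]
    nlinarith
  nlinarith

/-- The weight 2 - t is chosen so that t²(2 - t) ≤ t, which is t(1 - t)² ≥ 0. After mixing by a
contraction with factor t, the squared deviation still contracts by t. -/
theorem sqNorm_add_le_weighted {t : ℝ} (h0 : 0 ≤ t) (h1 : t < 1) (Z Y : Fin d → Mat n p) :
    sqNorm (Z + Y) ≤ (2 - t) * sqNorm Z + 2 / (1 - t) * sqNorm Y := by
  have h2 : 0 < 1 - t := by linarith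
  have h3 : 1 + 1 / (1 - t) ≤ 2 / (1 - t) := by
    rw [← sub_nonneg]
    have : 2 / (1 - t) - (1 + 1 / (1 - t)) = t / (1 - t) := by field_simp; ring
    rw [this]
    positivity
  simp only [sqNorm, Finset.mul_sum, ← Finset.sum_add_distrib]
  refine Finset.sum_le_sum fun i _ => (norm_add_sq_le_weighted h1 _ _).trans ?_
  gcongr

/-! ### Averages and deviations from them -/

theorem netAverage_eq (Z : Fin d → Mat n p) : average Z = (1 / (d : ℝ)) • ∑ i, Z i := rfl

theorem average_add (Z Y : Fin d → Mat n p) : average (Z + Y) = average Z + average Y := by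
  simp [netAverage_eq, Finset.sum_add_distrib]

theorem average_sub (Z Y : Fin d → Mat n p) : average (Z - Y) = average Z - average Y := by
  simp [netAverage_eq, Finset.sum_sub_distrib, smul_sub]

theorem average_smul (r : ℝ) (Z : Fin d → Mat n p) : average (r • Z) = r • average Z := by
  simp only [netAverage_eq, Pi.smul_apply, ← Finset.smul_sum]
  rw [smul_comm]

theorem average_const (hd : 0 < d) (A : Mat n p) : average (fun _ : Fin d => A) = A := by
  have : (d : ℝ) ≠ 0 := by positivity
  simp only [netAverage_eq, Finset.sum_const, Finset.card_univ, Fintype.card_fin,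
    ← Nat.cast_smul_eq_nsmul ℝ]
  rw [smul_smul, one_div_mul_cancel this, one_smul]

theorem norm_average_le (hd : 0 < d) {Z : Fin d → Mat n p} {r : ℝ} (h : ∀ i, ‖Z i‖ ≤ r) :
    ‖average Z‖ ≤ r := norm_one_div_smul_sum_le hd h

theorem sum_eq_smul_average (hd : 0 < d) (Z : Fin d → Mat n p) :
    ∑ i, Z i = (d : ℝ) • average Z := by
  have : (d : ℝ) ≠ 0 := by positivity
  rw [netAverage_eq, smul_smul, mul_one_div_cancel this, one_smul]

theorem sqNorm_deviation (hd : 0 < d) (Z : Fin d → Mat n p) :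
    sqNorm (deviation Z) = sqNorm Z - d * ‖average Z‖ ^ 2 := by
  simp only [sqNorm, deviation, norm_sub_sq_real, Finset.sum_add_distrib, Finset.sum_sub_distrib,
    ← Finset.mul_sum, ← sum_inner]
  rw [sum_eq_smul_average hd, inner_smul_left, real_inner_self_eq_norm_sq]
  simp
  ring

theorem sqNorm_deviation_le (hd : 0 < d) (Z : Fin d → Mat n p) :
    sqNorm (deviation Z) ≤ sqNorm Z := by
  rw [sqNorm_deviation hd]
  have : 0 ≤ (d : ℝ) * ‖average Z‖ ^ 2 := by positivity
  linarith

theorem norm_average_sq_le (hd : 0 < d) (Z : Fin d → Mat n p) :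
    d * ‖average Z‖ ^ 2 ≤ sqNorm Z := by
  have h := sqNorm_deviation hd Z
  have := sqNorm_nonneg (deviation Z)
  linarith

theorem deviation_add (Z Y : Fin d → Mat n p) :
    deviation (Z + Y) = deviation Z + deviation Y := by
  funext i; simp only [deviation, Pi.add_apply, average_add]; abel

theorem deviation_sub (Z Y : Fin d → Mat n p) :
    deviation (Z - Y) = deviation Z - deviation Y := by
  funext i; simp only [deviation, Pi.sub_apply, average_sub]; abel

theorem deviation_smul (r : ℝ) (Z : Fin d → Mat n p) : deviation (r • Z) = r • deviation Z := by
  funext i; simp only [deviation, Pi.smul_apply, average_smul, smul_sub]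

theorem deviation_const (hd : 0 < d) (A : Mat n p) : deviation (fun _ : Fin d => A) = 0 := by
  funext i; simp [deviation, average_const hd]

theorem sum_deviation (hd : 0 < d) (Z : Fin d → Mat n p) : ∑ i, deviation Z i = 0 := by
  simp only [deviation, Finset.sum_sub_distrib]
  rw [sum_eq_smul_average hd]
  simp [← Nat.cast_smul_eq_nsmul ℝ]

theorem IsMixingMatrix.average_mix (hW : IsMixingMatrix G W) (Z : Fin d → Mat n p) :
    average (mix W Z) = average Z := by
  simp only [netAverage_eq, mix]
  rw [Finset.sum_comm]
  simp only [← Finset.sum_smul, hW.col_sum, one_smul]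

theorem IsMixingMatrix.deviation_mix (hW : IsMixingMatrix G W) (Z : Fin d → Mat n p) :
    deviation (mix W Z) = mix W (deviation Z) := by
  funext i
  rw [deviation, hW.average_mix]
  simp only [mix, deviation, smul_sub, Finset.sum_sub_distrib, ← Finset.sum_smul, hW.row_sum,
    one_smul]

/-- Mixing acts on each matrix entry separately, so the scalar contraction applies to every entry of
the deviations. -/
theorem IsMixingMatrix.sqNorm_mix_deviation_le (hW : IsMixingMatrix G W) (hd : 0 < d)
    (hlam : secondEigenvalue W ≤ lam) (Z : Fin d → Mat n p) :
    sqNorm (mix W (deviation Z)) ≤ lam ^ 2 * sqNorm (deviation Z) := by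
  have e : ∀ Y : Fin d → Mat n p, sqNorm Y = ∑ a, ∑ b, ∑ i, Y i a b ^ 2 := by
    intro Y
    simp only [sqNorm, mat_norm_sq]
    rw [Finset.sum_comm]
    exact Finset.sum_congr rfl fun _ _ => Finset.sum_comm
  rw [e, e, Finset.mul_sum]
  refine Finset.sum_le_sum fun a _ => ?_
  rw [Finset.mul_sum]
  refine Finset.sum_le_sum fun b _ => ?_
  have h0 : ∑ i, deviation Z i a b = 0 := by
    have := congrFun (congrFun (sum_deviation hd Z) a) b
    rwa [Matrix.sum_apply] at this
  refine le_trans (le_of_eq ?_) (hW.sum_mulVec_sq_le hlam h0)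
  refine Finset.sum_congr rfl fun i _ => ?_
  simp [mix, Matrix.sum_apply, Matrix.mulVec, dotProduct]

end Mixing

/-! ### Gradient tracking -/

section Tracking

variable {n p d : ℕ} {G : SimpleGraph (Fin d)} {W : Mat d d} {lam η : ℝ}

/-- One step of gradient tracking, with an arbitrary update of the local directions. -/
structure IsTrackingStep (W : Mat d d) (η : ℝ) (s s' : NetState n p d) : Prop where
  X_eq : s'.X = mix W (s.X - η • s.D)
  D_eq : s'.D = mix W s.D + (s'.S - s.S)

variable {s s' : NetState n p d}

theorem IsTrackingStep.average_X (h : IsTrackingStep W η s s') (hW : IsMixingMatrix G W) :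
    average s'.X = average s.X - η • average s.D := by
  rw [h.X_eq, hW.average_mix, average_sub, average_smul]

theorem IsTrackingStep.average_D (h : IsTrackingStep W η s s') (hW : IsMixingMatrix G W)
    (hs : average s.D = average s.S) : average s'.D = average s'.S := by
  rw [h.D_eq, average_add, hW.average_mix, average_sub, hs]
  abel

theorem IsTrackingStep.sqNorm_deviation_X_le (h : IsTrackingStep W η s s')
    (hW : IsMixingMatrix G W) (hd : 0 < d) (hlam : secondEigenvalue W ≤ lam) (h0 : 0 ≤ lam)
    (h1 : lam < 1) :
    sqNorm (deviation s'.X) ≤ lam * sqNorm (deviation s.X)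
      + 2 / (1 - lam) * (η ^ 2 * sqNorm (deviation s.D)) := by
  rw [h.X_eq, hW.deviation_mix]
  refine (hW.sqNorm_mix_deviation_le hd hlam _).trans ?_
  have e : deviation (s.X - η • s.D) = deviation s.X + (-η) • deviation s.D := by
    rw [deviation_sub, deviation_smul, sub_eq_add_neg, neg_smul]
  have hy := sqNorm_add_le_weighted h0 h1 (deviation s.X) ((-η) • deviation s.D)
  rw [sqNorm_smul, neg_sq] at hy
  rw [e]
  have hx := sqNorm_nonneg (deviation s.X)
  have hq : 0 ≤ 2 / (1 - lam) * (η ^ 2 * sqNorm (deviation s.D)) := by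
    have := sqNorm_nonneg (deviation s.D)
    have : 0 < 1 - lam := by linarith
    positivity
  have a1 := mul_le_mul_of_nonneg_left hy (sq_nonneg lam)
  have a2 : lam ^ 2 * (2 - lam) ≤ lam := by nlinarith [mul_nonneg h0 (sq_nonneg (lam - 1))]
  have a3 := mul_le_mul_of_nonneg_right a2 hx
  have a4 : lam ^ 2 ≤ 1 := by nlinarith
  have a5 := mul_le_mul_of_nonneg_right a4 hq
  linarith

theorem IsTrackingStep.sqNorm_deviation_D_le (h : IsTrackingStep W η s s')
    (hW : IsMixingMatrix G W) (hd : 0 < d) (hlam : secondEigenvalue W ≤ lam) (h0 : 0 ≤ lam)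
    (h1 : lam < 1) :
    sqNorm (deviation s'.D) ≤ lam * sqNorm (deviation s.D)
      + 2 / (1 - lam) * sqNorm (s'.S - s.S) := by
  have hy := sqNorm_add_le_weighted h0 h1 (mix W (deviation s.D)) (deviation (s'.S - s.S))
  rw [h.D_eq, deviation_add, hW.deviation_mix]
  have a1 := hW.sqNorm_mix_deviation_le hd hlam s.D
  have a2 : lam ^ 2 * (2 - lam) ≤ lam := by nlinarith [mul_nonneg h0 (sq_nonneg (lam - 1))]
  have a3 := mul_le_mul_of_nonneg_right a2 (sqNorm_nonneg (deviation s.D))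
  have a4 := mul_le_mul_of_nonneg_left a1 (by linarith : 0 ≤ 2 - lam)
  have a5 : 2 / (1 - lam) * sqNorm (deviation (s'.S - s.S))
      ≤ 2 / (1 - lam) * sqNorm (s'.S - s.S) := by
    have : 0 < 1 - lam := by linarith
    gcongr
    exact sqNorm_deviation_le hd _
  linarith

/-- The displacement consists of the mixing of the deviations, which moves the agents even when the
directions vanish, a step along the mixed tracking deviations, and the common step along the
average. -/
theorem IsTrackingStep.sqNorm_sub_X_le (h : IsTrackingStep W η s s')
    (hW : IsMixingMatrix G W) (hd : 0 < d) (hlam : secondEigenvalue W ≤ lam) (h0 : 0 ≤ lam)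
    (h1 : lam < 1) :
    sqNorm (s'.X - s.X) ≤ 8 * sqNorm (deviation s.X)
      + 4 * (η ^ 2 * sqNorm (deviation s.D)) + 4 * (η ^ 2 * (d * ‖average s.D‖ ^ 2)) := by
  have e : s'.X - s.X = (mix W (deviation s.X) - deviation s.X)
      - (η • mix W (deviation s.D) + η • fun _ => average s.D) := by
    have e1 : mix W (deviation s.X) = deviation s'.X + η • mix W (deviation s.D) := by
      rw [h.X_eq, hW.deviation_mix, deviation_sub, deviation_smul]
      funext i
      simp [mix, smul_sub, Finset.sum_sub_distrib, Finset.smul_sum, smul_comm η]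
    rw [e1]
    funext i
    simp only [Pi.sub_apply, Pi.add_apply, Pi.smul_apply, deviation, h.average_X hW]
    abel
  have hX := sqNorm_nonneg (deviation s.X)
  have hD := sqNorm_nonneg (deviation s.D)
  have hl : lam ^ 2 ≤ 1 := by nlinarith
  have b1 := hW.sqNorm_mix_deviation_le hd hlam s.X
  have b2 := hW.sqNorm_mix_deviation_le hd hlam s.D
  have b3 : sqNorm (fun _ : Fin d => average s.D) = d * ‖average s.D‖ ^ 2 := by simp [sqNorm]
  have c1 := sqNorm_sub_le (mix W (deviation s.X)) (deviation s.X)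
  have c2 := sqNorm_add_le (η • mix W (deviation s.D)) (η • fun _ => average s.D)
  have c3 := sqNorm_sub_le (mix W (deviation s.X) - deviation s.X)
    (η • mix W (deviation s.D) + η • fun _ => average s.D)
  rw [sqNorm_smul, sqNorm_smul, b3] at c2
  rw [e]
  have d1 := mul_le_mul_of_nonneg_right hl hX
  have d2 := mul_le_mul_of_nonneg_right hl hD
  have d3 := mul_le_mul_of_nonneg_left (b2.trans d2) (sq_nonneg η)
  linarith

end Tracking

/-! ### The variance of a batch -/

section Variance

variable {E : Type*} [NormedAddCommGroup E] [InnerProductSpace ℝ E]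

/-- Independent centred draws have vanishing cross terms. The induction splits off the first draw
and absorbs it into A, which is why A is arbitrary. The factor l on the left avoids dividing by the
number of samples. -/
theorem sum_norm_add_sum_sq {l : ℕ} {w : Fin l → E} (hw : ∑ j, w j = 0)
    (τ : ℕ) (A : E) : (∑ c : Fin τ → Fin l, ‖A + ∑ m, w (c m)‖ ^ 2) * l
      = (l : ℝ) ^ τ * (l * ‖A‖ ^ 2 + τ * ∑ j, ‖w j‖ ^ 2) := by
  induction τ generalizing A with
  | zero => simp [mul_comm]
  | succ τ ih =>
    have h1 : ∑ c : Fin (τ + 1) → Fin l, ‖A + ∑ m, w (c m)‖ ^ 2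
        = ∑ j : Fin l, ∑ c : Fin τ → Fin l, ‖(A + w j) + ∑ m, w (c m)‖ ^ 2 := by
      rw [← Fintype.sum_prod_type', ← (Fin.consEquiv fun _ : Fin (τ + 1) => Fin l).sum_comp]
      refine Finset.sum_congr rfl fun x _ => ?_
      simp [Fin.consEquiv, Fin.sum_univ_succ, add_assoc]
    have h2 : ∑ j, ‖A + w j‖ ^ 2 = l * ‖A‖ ^ 2 + ∑ j, ‖w j‖ ^ 2 := by
      simp only [norm_add_sq_real, Finset.sum_add_distrib, ← Finset.mul_sum, ← inner_sum, hw]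
      simp
    rw [h1, Finset.sum_mul]
    simp only [ih]
    rw [← Finset.mul_sum, Finset.sum_add_distrib, ← Finset.mul_sum, h2]
    simp
    ring

theorem integral_uniformOn_univ {α : Type*} [Fintype α] [MeasurableSpace α]
    [MeasurableSingletonClass α] (g : α → ℝ) :
    ∫ a, g a ∂(uniformOn (Set.univ : Set α)) = (1 / (Fintype.card α : ℝ)) * ∑ a, g a := by
  rw [integral_fintype (Integrable.of_finite), Finset.mul_sum]
  refine Finset.sum_congr rfl fun a _ => ?_
  rw [Measure.real, uniformOn_univ, Measure.count_singleton]
  simp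

/-- A batch average of i.i.d. uniform samples, centred at its mean, has variance at most the mean
square of a sample divided by the size of the batch. -/
theorem integral_batch_le {l τ : ℕ} (hl : 0 < l) (hτ : 0 < τ) (u : Fin l → E) (A : E) :
    ∫ c, ‖A + ((1 / (τ : ℝ)) • ∑ m, u (c m) - (1 / (l : ℝ)) • ∑ j, u j)‖ ^ 2
        ∂(uniformOn (Set.univ : Set (Fin τ → Fin l)))
      ≤ ‖A‖ ^ 2 + 1 / (τ : ℝ) * ((1 / (l : ℝ)) * ∑ j, ‖u j‖ ^ 2) := by
  have hl' : (0 : ℝ) < l := by exact_mod_cast hl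
  have hτ' : (0 : ℝ) < τ := by exact_mod_cast hτ
  set ub : E := (1 / (l : ℝ)) • ∑ j, u j with hub
  have hub' : ∑ j, u j = (l : ℝ) • ub := by
    rw [hub, smul_smul, mul_one_div_cancel hl'.ne', one_smul]
  set w : Fin l → E := fun j => (1 / (τ : ℝ)) • (u j - ub) with hw
  have hw0 : ∑ j, w j = 0 := by
    simp only [hw, ← Finset.smul_sum, Finset.sum_sub_distrib, hub']
    simp [← Nat.cast_smul_eq_nsmul ℝ]
  have e1 : ∀ c : Fin τ → Fin l, A + ((1 / (τ : ℝ)) • ∑ m, u (c m) - ub) = A + ∑ m, w (c m) := by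
    intro c
    simp only [hw, ← Finset.smul_sum, Finset.sum_sub_distrib, smul_sub]
    simp only [Finset.sum_const, Finset.card_univ, Fintype.card_fin, ← Nat.cast_smul_eq_nsmul ℝ]
    rw [smul_smul, one_div_mul_cancel hτ'.ne', one_smul]
  have h2 : ∑ j, ‖w j‖ ^ 2 ≤ (1 / (τ : ℝ)) ^ 2 * ∑ j, ‖u j‖ ^ 2 := by
    have : ∑ j, ‖u j - ub‖ ^ 2 = ∑ j, ‖u j‖ ^ 2 - l * ‖ub‖ ^ 2 := by
      simp only [norm_sub_sq_real, Finset.sum_add_distrib, Finset.sum_sub_distrib,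
        ← Finset.mul_sum, ← sum_inner, hub', inner_smul_left, real_inner_self_eq_norm_sq]
      simp
      ring
    simp only [hw, norm_smul, mul_pow, ← Finset.mul_sum, this]
    rw [Real.norm_of_nonneg (by positivity)]
    gcongr
    have : 0 ≤ (l : ℝ) * ‖ub‖ ^ 2 := by positivity
    linarith
  have h3 := sum_norm_add_sum_sq hw0 τ A
  rw [integral_uniformOn_univ]
  simp only [e1, Fintype.card_fun, Fintype.card_fin, Nat.cast_pow]
  have h4 : (1 / (l : ℝ) ^ τ) * ∑ c : Fin τ → Fin l, ‖A + ∑ m, w (c m)‖ ^ 2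
      = ‖A‖ ^ 2 + τ * (1 / l) * ∑ j, ‖w j‖ ^ 2 := by
    rw [eq_div_of_mul_eq hl'.ne' h3]
    field_simp
  rw [h4]
  have h5 := mul_le_mul_of_nonneg_left h2 (by positivity : (0 : ℝ) ≤ τ * (1 / l))
  have h6 : (τ : ℝ) * (1 / l) * ((1 / (τ : ℝ)) ^ 2 * ∑ j, ‖u j‖ ^ 2)
      = 1 / (τ : ℝ) * ((1 / (l : ℝ)) * ∑ j, ‖u j‖ ^ 2) := by
    field_simp
  linarith

end Variance

/-! ### The algorithm in linear time -/

section LinearTime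

variable {n p d l τ : ℕ} (f : Costs n p d l) (W : Mat d d) (η β : ℝ) (q : ℕ) (X₀ : Mat n p)

/-- The state after `m` steps of the algorithm, in which step `m` uses the batch `ζ m`, if it uses
one at all. -/
def linState (ζ : ℕ → Batch d l τ) : ℕ → NetState n p d
  | 0 => initState f β X₀
  | m + 1 => if m % (q + 1) = 0 then outerStep f W η β (linState ζ m)
      else innerStep f W η β (ζ m) (linState ζ m)

/-- The index of the batch of a step. -/
def batchIndex (m : ℕ) : ℕ × ℕ := (m / (q + 1) + 1, m % (q + 1))

theorem batchIndex_injective : Function.Injective (batchIndex q) := by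
  intro a b h
  simp only [batchIndex, Prod.mk.injEq, add_left_inj] at h
  rw [← Nat.div_add_mod a (q + 1), ← Nat.div_add_mod b (q + 1), h.1, h.2]

variable (C : ℕ → ℕ → Batch d l τ)

theorem innerLoop_eq_linState {k : ℕ}
    (hk : vrsgtOuter f W η β q X₀ C k
      = linState f W η β q X₀ (fun m => C (batchIndex q m).1 (batchIndex q m).2) (k * (q + 1)))
    {t : ℕ} (ht : t ≤ q) :
    innerLoop f W η β (C (k + 1)) (outerStep f W η β (vrsgtOuter f W η β q X₀ C k)) t
      = linState f W η β q X₀ (fun m => C (batchIndex q m).1 (batchIndex q m).2)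
        (k * (q + 1) + 1 + t) := by
  induction t with
  | zero =>
    rw [innerLoop, hk, add_zero, linState, if_pos (Nat.mul_mod_left _ _)]
  | succ t ih =>
    have h1 : (k * (q + 1) + 1 + t) % (q + 1) = t + 1 := by
      rw [show k * (q + 1) + 1 + t = t + 1 + k * (q + 1) by ring, Nat.add_mul_mod_self_right]
      exact Nat.mod_eq_of_lt (by omega)
    have h2 : (k * (q + 1) + 1 + t) / (q + 1) = k := by
      rw [show k * (q + 1) + 1 + t = t + 1 + k * (q + 1) by ring,
        Nat.add_mul_div_right _ _ (Nat.succ_pos q), Nat.div_eq_of_lt (by omega), zero_add]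
    rw [innerLoop, ih (by omega), ← add_assoc, linState, if_neg (by omega)]
    simp only [batchIndex, h1, h2]

theorem vrsgtOuter_eq_linState (k : ℕ) :
    vrsgtOuter f W η β q X₀ C k
      = linState f W η β q X₀ (fun m => C (batchIndex q m).1 (batchIndex q m).2)
        (k * (q + 1)) := by
  induction k with
  | zero => rw [vrsgtOuter, zero_mul, linState]
  | succ k ih =>
    rw [vrsgtOuter, innerLoop_eq_linState f W η β q X₀ C ih le_rfl]
    congr 1
    ring

/-- The position in linear time of the state with index `(k, t)`. -/
def linIndex (kt : ℕ × ℕ) : ℕ :=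
  if kt.2 = 0 then kt.1 * (q + 1) else (kt.1 - 1) * (q + 1) + kt.2

theorem vrsgt_eq_linState {K : ℕ} {kt : ℕ × ℕ} (hkt : kt ∈ iterIndices K q) :
    vrsgt f W η β q X₀ C kt.1 kt.2
      = linState f W η β q X₀ (fun m => C (batchIndex q m).1 (batchIndex q m).2)
        (linIndex q kt) := by
  obtain ⟨k, t⟩ := kt
  simp only [iterIndices, Finset.mem_filter, Finset.mem_product, Finset.mem_range] at hkt
  rcases t with _ | t
  · rw [vrsgt, vrsgtOuter_eq_linState, linIndex, if_pos rfl]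
  · rcases k with _ | k
    · exact absurd (hkt.2 rfl) (by simp)
    · rw [vrsgt, innerLoop_eq_linState f W η β q X₀ C
        (vrsgtOuter_eq_linState f W η β q X₀ C k) (by omega), linIndex, if_neg (by simp)]
      congr 1
      simp only [Nat.add_sub_cancel]
      ring

/-- The minimum over the index set is therefore at most the mean over the K(q + 1) + 1 linear times.
A multiple of q + 1 is the end of an outer iteration and is represented by an index with t = 0. -/
theorem exists_linIndex_eq {K m : ℕ} (hm : m ≤ K * (q + 1)) :
    ∃ kt ∈ iterIndices K q, linIndex q kt = m := by
  have hdm := Nat.div_add_mod m (q + 1)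
  have hlt := Nat.mod_lt m (Nat.succ_pos q)
  by_cases h : m % (q + 1) = 0
  · refine ⟨(m / (q + 1), 0), ?_, ?_⟩
    · simp only [iterIndices, Finset.mem_filter, Finset.mem_product, Finset.mem_range]
      refine ⟨⟨?_, by omega⟩, fun _ => trivial⟩
      exact Nat.lt_succ_of_le (Nat.div_le_of_le_mul (by rwa [mul_comm]))
    · rw [linIndex, if_pos rfl, mul_comm]
      dsimp only
      omega
  · refine ⟨(m / (q + 1) + 1, m % (q + 1)), ?_, ?_⟩
    · simp only [iterIndices, Finset.mem_filter, Finset.mem_product, Finset.mem_range]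
      refine ⟨⟨?_, hlt⟩, fun h0 => absurd h0 (by simp)⟩
      have : m / (q + 1) < K := by
        rw [Nat.div_lt_iff_lt_mul (Nat.succ_pos q)]
        refine lt_of_le_of_ne hm fun h' => h ?_
        rw [h', Nat.mul_mod_left]
      omega
    · rw [linIndex, if_neg h, Nat.add_sub_cancel, mul_comm]
      exact hdm

/-! ### Counts of communication rounds and samples -/

theorem innerLoop_rounds (B : ℕ → Batch d l τ) (s : NetState n p d) (t : ℕ) :
    (innerLoop f W η β B s t).rounds = s.rounds + 2 * t := by
  induction t with
  | zero => rfl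
  | succ t ih => rw [innerLoop, innerStep, ih]; ring

theorem innerLoop_samples (B : ℕ → Batch d l τ) (s : NetState n p d) (t : ℕ) :
    (innerLoop f W η β B s t).samples = s.samples + t * (d * τ) := by
  induction t with
  | zero => simp [innerLoop]
  | succ t ih => rw [innerLoop, innerStep, ih]; ring

theorem vrsgtOuter_rounds (k : ℕ) :
    (vrsgtOuter f W η β q X₀ C k).rounds = 2 * (k * (q + 1)) := by
  induction k with
  | zero => simp [vrsgtOuter, initState]
  | succ k ih => rw [vrsgtOuter, innerLoop_rounds, outerStep, ih]; ring

theorem vrsgtOuter_samples (k : ℕ) :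
    (vrsgtOuter f W η β q X₀ C k).samples = d * l + k * (d * l + q * (d * τ)) := by
  induction k with
  | zero => simp [vrsgtOuter, initState]
  | succ k ih => rw [vrsgtOuter, innerLoop_samples, outerStep, ih]; ring

theorem vrsgt_rounds_le {K : ℕ} {kt : ℕ × ℕ} (hkt : kt ∈ iterIndices K q) :
    (vrsgt f W η β q X₀ C kt.1 kt.2).rounds ≤ 2 * (K * (q + 1)) := by
  obtain ⟨k, t⟩ := kt
  simp only [iterIndices, Finset.mem_filter, Finset.mem_product, Finset.mem_range] at hkt
  rcases t with _ | t
  · rw [vrsgt, vrsgtOuter_rounds]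
    have : k * (q + 1) ≤ K * (q + 1) := Nat.mul_le_mul_right _ (by omega)
    dsimp only
    omega
  · rcases k with _ | k
    · exact absurd (hkt.2 rfl) (by simp)
    · rw [vrsgt, innerLoop_rounds, outerStep, vrsgtOuter_rounds]
      have : (k + 1) * (q + 1) ≤ K * (q + 1) := Nat.mul_le_mul_right _ (by omega)
      rw [add_mul] at this
      dsimp only
      omega

theorem vrsgt_samples_le {K : ℕ} {kt : ℕ × ℕ} (hkt : kt ∈ iterIndices K q) :
    (vrsgt f W η β q X₀ C kt.1 kt.2).samples ≤ d * l + K * (d * l + q * (d * τ)) := by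
  obtain ⟨k, t⟩ := kt
  simp only [iterIndices, Finset.mem_filter, Finset.mem_product, Finset.mem_range] at hkt
  rcases t with _ | t
  · rw [vrsgt, vrsgtOuter_samples]
    have : k * (d * l + q * (d * τ)) ≤ K * (d * l + q * (d * τ)) :=
      Nat.mul_le_mul_right _ (by omega)
    dsimp only
    omega
  · rcases k with _ | k
    · exact absurd (hkt.2 rfl) (by simp)
    · rw [vrsgt, innerLoop_samples, outerStep, vrsgtOuter_samples]
      have : (k + 1) * (d * l + q * (d * τ)) ≤ K * (d * l + q * (d * τ)) :=
        Nat.mul_le_mul_right _ (by omega)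
      rw [add_mul] at this
      have h2 : t * (d * τ) ≤ q * (d * τ) := Nat.mul_le_mul_right _ (by omega)
      dsimp only
      omega

/-- The state after `m` steps depends only on the batches of these steps. -/
theorem linState_congr {ζ ζ' : ℕ → Batch d l τ} {m : ℕ} (h : ∀ i < m, ζ i = ζ' i) :
    linState f W η β q X₀ ζ m = linState f W η β q X₀ ζ' m := by
  induction m with
  | zero => rfl
  | succ m ih =>
    rw [linState, linState, ih fun i hi => h i (by omega), h m (by omega)]

end LinearTime

/-! ### Deterministic control of the iterates -/

section Control

variable {n p d l : ℕ}

/-- The standing assumptions, with bounds for the constants. -/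
structure IsAdmissible (G : SimpleGraph (Fin d)) (W : Mat d d) (f : Costs n p d l)
    (lam β L N : ℝ) : Prop where
  d_pos : 0 < d
  l_pos : 0 < l
  mixing : IsMixingMatrix G W
  eigenvalue_le : secondEigenvalue W ≤ lam
  lam_lt : lam < 1
  smooth : IsMeanSquareLocallySmooth f
  lip_le : dirLip f ≤ L
  sup_le : dirSup f ≤ N
  threshold : penaltyThreshold f < β

/-- A bound of the local directions `S i`. -/
def dirBound (N β : ℝ) (p d : ℕ) : ℝ := searchBound N β p d + 1

/-- A bound of the deviation of the tracking variables. -/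
def trackBound (lam s : ℝ) (d : ℕ) : ℝ := 8 * d * s ^ 2 / (1 - lam) ^ 2

/-- A bound, relative to the step size, of the displacement in one step. -/
def moveBound (lam s : ℝ) (d : ℕ) : ℝ :=
  1 + 8 * (2 / (1 - lam) ^ 2 * trackBound lam s d) + 4 * trackBound lam s d + 4 * (d * s ^ 2)

/-- The step size is small enough for the iterates to stay near the Stiefel manifold. -/
structure IsSmallStep (lam β L N : ℝ) (p d q : ℕ) (η : ℝ) : Prop where
  pos : 0 < η
  three_le : 3 * η ≤ 1
  move_le : η * moveBound lam (dirBound N β p d) d ≤ 1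
  lip_move_le : searchLip L β p d * (η * moveBound lam (dirBound N β p d) d) ≤ 1 / 40
  loop_le : q * (2 * (searchLip L β p d * (η * moveBound lam (dirBound N β p d) d))) ≤ 1 / 40
  dir_le : η * dirBound N β p d ≤ 1
  dir_sq_le : η * (24 * (1 + (2 * ballRadius p d + 1) ^ 2) * dirBound N β p d ^ 2) ≤ 1
  curvature_le : η * (24 * curvature L (ballRadius p d) β) ≤ 1

/-- The errors of the estimates of the local directions. -/
def localErr (f : Costs n p d l) (β : ℝ) (s : NetState n p d) : Fin d → Mat n p :=
  fun i => s.S i - searchDir β (localCost f i) (s.X i)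

/-- The error of the averaged direction. -/
def globalErr (f : Costs n p d l) (β : ℝ) (s : NetState n p d) : Mat n p :=
  average s.S - searchDir β (globalCost f) (average s.X)

/-- The deterministic bounds satisfied by the state after `j` inner steps. -/
structure IsControlled (f : Costs n p d l) (lam β L N η : ℝ) (j : ℕ) (s : NetState n p d) :
    Prop where
  average_eq : average s.D = average s.S
  average_mem : average s.X ∈ region n p
  deviation_X_le : sqNorm (deviation s.X)
    ≤ η ^ 2 * (2 / (1 - lam) ^ 2 * trackBound lam (dirBound N β p d) d)
  deviation_D_le : sqNorm (deviation s.D) ≤ trackBound lam (dirBound N β p d) d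
  localErr_le : ∀ i, ‖localErr f β s i‖
    ≤ j * (2 * (searchLip L β p d * (η * moveBound lam (dirBound N β p d) d)))

variable {G : SimpleGraph (Fin d)} {W : Mat d d} {f : Costs n p d l} {lam β L N η : ℝ}
  {q j : ℕ} {s s' : NetState n p d}

theorem IsAdmissible.lam_nonneg (h : IsAdmissible G W f lam β L N) : 0 ≤ lam :=
  secondEigenvalue_nonneg.trans h.eigenvalue_le

theorem IsAdmissible.L_nonneg (h : IsAdmissible G W f lam β L N) : 0 ≤ L :=
  (dirLip_nonneg f).trans h.lip_le

theorem IsAdmissible.N_nonneg (h : IsAdmissible G W f lam β L N) : 0 ≤ N :=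
  (dirSup_nonneg f).trans h.sup_le

theorem IsAdmissible.one_le_β (h : IsAdmissible G W f lam β L N) : 1 ≤ β :=
  (le_max_left _ _).trans h.threshold.le

theorem IsAdmissible.β_nonneg (h : IsAdmissible G W f lam β L N) : 0 ≤ β :=
  zero_le_one.trans h.one_le_β

theorem IsAdmissible.isRiemSmooth (h : IsAdmissible G W f lam β L N) :
    IsRiemSmooth (globalCost f) L (ballRadius p d) β (gradSup f) :=
  h.smooth.isRiemSmooth h.d_pos h.l_pos h.lip_le h.L_nonneg h.threshold

theorem IsAdmissible.searchLip_nonneg (h : IsAdmissible G W f lam β L N) :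
    0 ≤ searchLip L β p d := by
  have := h.L_nonneg
  have := h.one_le_β
  unfold searchLip
  positivity

theorem IsAdmissible.searchBound_nonneg (h : IsAdmissible G W f lam β L N) :
    0 ≤ searchBound N β p d := by
  have := h.N_nonneg
  have := h.one_le_β
  have : 0 ≤ ballRadius p d := ballRadius_nonneg
  unfold searchBound
  positivity

theorem trackBound_nonneg (lam s : ℝ) (d : ℕ) : 0 ≤ trackBound lam s d := by
  unfold trackBound; positivity

theorem moveBound_nonneg (lam s : ℝ) (d : ℕ) : 0 ≤ moveBound lam s d := by
  have := trackBound_nonneg lam s d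
  unfold moveBound; positivity

/-- A nonnegative number is at most the square of itself plus one. This replaces a square root in
`moveBound`. -/
theorem moveBound_le_sq (lam s : ℝ) (d : ℕ) :
    8 * (2 / (1 - lam) ^ 2 * trackBound lam s d) + 4 * trackBound lam s d + 4 * (d * s ^ 2)
      ≤ moveBound lam s d ^ 2 := by
  have h := trackBound_nonneg lam s d
  have h1 : 1 ≤ moveBound lam s d := by
    unfold moveBound
    have : 0 ≤ 8 * (2 / (1 - lam) ^ 2 * trackBound lam s d) + 4 * trackBound lam s d
      + 4 * (d * s ^ 2) := by positivity
    linarith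
  have h2 : 8 * (2 / (1 - lam) ^ 2 * trackBound lam s d) + 4 * trackBound lam s d
      + 4 * (d * s ^ 2) = moveBound lam s d - 1 := by unfold moveBound; ring
  nlinarith

theorem norm_le_of_sqNorm_le {Z : Fin d → Mat n p} {r : ℝ} (hr : 0 ≤ r) (h : sqNorm Z ≤ r ^ 2)
    (i : Fin d) : ‖Z i‖ ≤ r :=
  (sq_le_sq₀ (norm_nonneg _) hr).1 ((norm_sq_le_sqNorm Z i).trans h)

theorem norm_deviation_le_of_sqNorm_le (hη : 0 ≤ η) {X : Fin d → Mat n p} {t : ℝ}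
    (h : sqNorm (deviation X) ≤ η ^ 2 * (2 / (1 - lam) ^ 2 * trackBound lam t d)) (i : Fin d) :
    ‖X i - average X‖ ≤ η * moveBound lam t d := by
  refine norm_le_of_sqNorm_le (Z := deviation X)
    (mul_nonneg hη (moveBound_nonneg _ _ _)) (h.trans ?_) i
  rw [mul_pow]
  have h1 := moveBound_le_sq lam t d
  have h2 := trackBound_nonneg lam t d
  have h3 : 0 ≤ 2 / (1 - lam) ^ 2 * trackBound lam t d := by positivity
  have h4 : 0 ≤ (d : ℝ) * t ^ 2 := by positivity
  gcongr
  linarith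

theorem mem_bigBall_of_sqNorm_le (hd : 0 < d) (hη : 0 ≤ η) {X : Fin d → Mat n p} {t : ℝ}
    (hmem : average X ∈ region n p) (hr : η * moveBound lam t d ≤ 1)
    (h : sqNorm (deviation X) ≤ η ^ 2 * (2 / (1 - lam) ^ 2 * trackBound lam t d)) (i : Fin d) :
    X i ∈ bigBall n p d := by
  have h1 := norm_deviation_le_of_sqNorm_le hη h i
  have h2 := norm_le_norm_add_norm_sub' (X i) (average X)
  have h3 := norm_le_of_mem_region (d := d) hd hmem
  change ‖X i‖ ≤ _
  linarith

theorem IsControlled.X_mem (hs : IsControlled f lam β L N η j s)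
    (hA : IsAdmissible G W f lam β L N) (hη : IsSmallStep lam β L N p d q η) (i : Fin d) :
    s.X i ∈ bigBall n p d :=
  mem_bigBall_of_sqNorm_le hA.d_pos hη.pos.le hs.average_mem hη.move_le hs.deviation_X_le i

theorem IsControlled.norm_localErr_le (hs : IsControlled f lam β L N η j s)
    (hA : IsAdmissible G W f lam β L N) (hη : IsSmallStep lam β L N p d q η) (hj : j ≤ q)
    (i : Fin d) : ‖localErr f β s i‖ ≤ 1 / 40 := by
  refine (hs.localErr_le i).trans (le_trans ?_ hη.loop_le)
  have := hA.searchLip_nonneg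
  have := hη.pos
  have := moveBound_nonneg lam (dirBound N β p d) d
  gcongr

theorem IsControlled.norm_S_le (hs : IsControlled f lam β L N η j s)
    (hA : IsAdmissible G W f lam β L N) (hη : IsSmallStep lam β L N p d q η) (hj : j ≤ q)
    (i : Fin d) : ‖s.S i‖ ≤ dirBound N β p d := by
  have h1 := hs.norm_localErr_le hA hη hj i
  have h2 := hA.smooth.norm_searchDir_localCost_le hA.d_pos hA.l_pos hA.sup_le
    hA.β_nonneg i (hs.X_mem hA hη i)
  have h3 := norm_le_norm_add_norm_sub' (s.S i) (searchDir β (localCost f i) (s.X i))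
  unfold localErr at h1
  unfold dirBound
  linarith

/-- The averaged direction errs for two reasons: the local estimates are inexact, and the local
directions are evaluated at the agents' own points instead of the average. -/
theorem globalErr_eq (hA : IsAdmissible G W f lam β L N) (s : NetState n p d) :
    globalErr f β s = average (localErr f β s) + average (fun i =>
      searchDir β (localCost f i) (s.X i) - searchDir β (localCost f i) (average s.X)) := by
  rw [globalErr, searchDir_globalCost hA.d_pos hA.smooth.differentiable, ← average_add,
    ← netAverage_eq, ← average_sub]
  congr 1
  funext i
  simp [localErr]

theorem IsControlled.norm_searchDir_sub_average_le (hs : IsControlled f lam β L N η j s)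
    (hA : IsAdmissible G W f lam β L N) (hη : IsSmallStep lam β L N p d q η) (i : Fin d) :
    ‖searchDir β (localCost f i) (s.X i) - searchDir β (localCost f i) (average s.X)‖
      ≤ searchLip L β p d * ‖deviation s.X i‖ :=
  hA.smooth.norm_searchDir_localCost_sub_le hA.d_pos hA.l_pos hA.lip_le
    hA.β_nonneg i (hs.X_mem hA hη i)
    (region_subset_bigBall hA.d_pos hs.average_mem)

theorem IsControlled.norm_globalErr_le (hs : IsControlled f lam β L N η j s)
    (hA : IsAdmissible G W f lam β L N) (hη : IsSmallStep lam β L N p d q η) (hj : j ≤ q) :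
    ‖globalErr f β s‖ ≤ 1 / 20 := by
  rw [globalErr_eq hA]
  refine (norm_add_le _ _).trans ?_
  have h1 := norm_average_le hA.d_pos (hs.norm_localErr_le hA hη hj)
  have h2 := norm_average_le hA.d_pos (fun i => (hs.norm_searchDir_sub_average_le hA hη i).trans
    ((mul_le_mul_of_nonneg_left (norm_deviation_le_of_sqNorm_le hη.pos.le hs.deviation_X_le i)
      hA.searchLip_nonneg).trans hη.lip_move_le))
  linarith

theorem norm_average_sq_le_sqNorm (hd : 0 < d) (Z : Fin d → Mat n p) :
    ‖average Z‖ ^ 2 ≤ sqNorm Z := by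
  refine le_trans ?_ (norm_average_sq_le hd Z)
  have : (1 : ℝ) ≤ d := by exact_mod_cast hd
  nlinarith [sq_nonneg ‖average Z‖]

theorem IsControlled.norm_globalErr_sq_le (hs : IsControlled f lam β L N η j s)
    (hA : IsAdmissible G W f lam β L N) (hη : IsSmallStep lam β L N p d q η) :
    ‖globalErr f β s‖ ^ 2 ≤ 2 * sqNorm (localErr f β s)
      + 2 * searchLip L β p d ^ 2 * sqNorm (deviation s.X) := by
  rw [globalErr_eq hA]
  refine (norm_add_sq_le_two_mul _ _).trans ?_
  have h1 := norm_average_sq_le_sqNorm hA.d_pos (localErr f β s)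
  have h2 := norm_average_sq_le_sqNorm hA.d_pos (fun i =>
    searchDir β (localCost f i) (s.X i) - searchDir β (localCost f i) (average s.X))
  have h3 : sqNorm (fun i =>
      searchDir β (localCost f i) (s.X i) - searchDir β (localCost f i) (average s.X))
      ≤ sqNorm (searchLip L β p d • deviation s.X) := by
    refine sqNorm_le_sqNorm fun i => ?_
    rw [Pi.smul_apply, norm_smul, Real.norm_of_nonneg hA.searchLip_nonneg]
    exact hs.norm_searchDir_sub_average_le hA hη i
  rw [sqNorm_smul] at h3
  linarith

theorem IsControlled.norm_average_S_le (hs : IsControlled f lam β L N η j s)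
    (hA : IsAdmissible G W f lam β L N) (hη : IsSmallStep lam β L N p d q η) (hj : j ≤ q) :
    ‖average s.S‖ ≤ dirBound N β p d :=
  norm_average_le hA.d_pos (hs.norm_S_le hA hη hj)

theorem average_S_eq (f : Costs n p d l) (β : ℝ) (s : NetState n p d) :
    average s.S = searchDir β (globalCost f) (average s.X) + globalErr f β s := by
  rw [globalErr]; abel

/-- The descent inequality needs the whole segment between consecutive averages in the region. Each
of its points is the result of a step with a smaller step size, so the invariance of the region
covers it. -/
theorem IsControlled.segment_mem (hs : IsControlled f lam β L N η j s)
    (hA : IsAdmissible G W f lam β L N) (hη : IsSmallStep lam β L N p d q η) (hj : j ≤ q)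
    {t : ℝ} (ht0 : 0 ≤ t) (ht1 : t ≤ 1) :
    average s.X - (t * η) • average s.S ∈ region n p := by
  have hpos := hη.pos
  have hle : t * η ≤ η := by nlinarith
  have h0 : 0 ≤ t * η := by positivity
  have hS := hs.norm_average_S_le hA hη hj
  have hS0 := norm_nonneg (average s.S)
  have he := hs.norm_globalErr_le hA hη hj
  refine hA.isRiemSmooth.step_mem_region hs.average_mem (average_S_eq f β s) h0
    (by linarith [hη.three_le]) ?_ ?_
  · refine le_trans ?_ hη.dir_le
    gcongr
  -- The budget 1/12 is met because 16/400 + 1/24 is smaller.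
  · have h1 : ‖globalErr f β s‖ ^ 2 ≤ (1 / 20) ^ 2 := by gcongr
    have h2 : (1 + (2 * ballRadius p d + 1) ^ 2) * (t * η) * ‖average s.S‖ ^ 2
        ≤ (1 + (2 * ballRadius p d + 1) ^ 2) * η * dirBound N β p d ^ 2 := by gcongr
    have h3 := hη.dir_sq_le
    linarith

theorem IsControlled.merit_le (hs : IsControlled f lam β L N η j s)
    (hA : IsAdmissible G W f lam β L N) (hη : IsSmallStep lam β L N p d q η) (hj : j ≤ q)
    (h : IsTrackingStep W η s s') :
    merit L (ballRadius p d) β (globalCost f) (average s'.X)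
      ≤ merit L (ballRadius p d) β (globalCost f) (average s.X)
      - η / 4 * (‖genRiemGrad (globalCost f) (average s.X)‖ ^ 2
        + ‖orthResidual (average s.X)‖ ^ 2)
      + (2 + 16 * penaltyWeight L (ballRadius p d) β) * η * ‖globalErr f β s‖ ^ 2 ∧
    ‖average s.D‖ ^ 2 ≤ 3 * ‖genRiemGrad (globalCost f) (average s.X)‖ ^ 2
      + 12 * β ^ 2 * ‖orthResidual (average s.X)‖ ^ 2 + 3 * ‖globalErr f β s‖ ^ 2 := by
  rw [h.average_X hA.mixing, hs.average_eq]
  refine hA.isRiemSmooth.merit_step_le (average_S_eq f β s) hη.pos.le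
    (le_trans ?_ hη.dir_le) hη.curvature_le fun t h0 h1 => hs.segment_mem hA hη hj h0 h1
  have := hη.pos
  have := hs.norm_average_S_le hA hη hj
  gcongr

theorem IsControlled.average_step_mem (hs : IsControlled f lam β L N η j s)
    (hA : IsAdmissible G W f lam β L N) (hη : IsSmallStep lam β L N p d q η) (hj : j ≤ q)
    (h : IsTrackingStep W η s s') : average s'.X ∈ region n p := by
  have := hs.segment_mem hA hη hj zero_le_one le_rfl
  rwa [h.average_X hA.mixing, hs.average_eq, ← one_mul η]

/-- The bound is the fixed point of the recursion for the squared deviation, so it reproduces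
itself. The same holds for `trackBound`. -/
theorem IsControlled.deviation_step_X_le (hs : IsControlled f lam β L N η j s)
    (hA : IsAdmissible G W f lam β L N) (h : IsTrackingStep W η s s') :
    sqNorm (deviation s'.X) ≤ η ^ 2 * (2 / (1 - lam) ^ 2 * trackBound lam (dirBound N β p d) d) := by
  have h1 := h.sqNorm_deviation_X_le hA.mixing hA.d_pos hA.eigenvalue_le hA.lam_nonneg hA.lam_lt
  have h2 : 0 < 1 - lam := by linarith [hA.lam_lt]
  have h3 := mul_le_mul_of_nonneg_left hs.deviation_X_le hA.lam_nonneg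
  have h4 : 2 / (1 - lam) * (η ^ 2 * sqNorm (deviation s.D))
      ≤ 2 / (1 - lam) * (η ^ 2 * trackBound lam (dirBound N β p d) d) := by
    have := hs.deviation_D_le
    gcongr
  refine h1.trans ((add_le_add h3 h4).trans (le_of_eq ?_))
  field_simp
  ring

theorem IsControlled.X_step_mem (hs : IsControlled f lam β L N η j s)
    (hA : IsAdmissible G W f lam β L N) (hη : IsSmallStep lam β L N p d q η) (hj : j ≤ q)
    (h : IsTrackingStep W η s s') (i : Fin d) : s'.X i ∈ bigBall n p d :=
  mem_bigBall_of_sqNorm_le hA.d_pos hη.pos.le (hs.average_step_mem hA hη hj h) hη.move_le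
    (hs.deviation_step_X_le hA h) i

theorem IsControlled.norm_move_le (hs : IsControlled f lam β L N η j s)
    (hA : IsAdmissible G W f lam β L N) (hη : IsSmallStep lam β L N p d q η) (hj : j ≤ q)
    (h : IsTrackingStep W η s s') (i : Fin d) :
    ‖s'.X i - s.X i‖ ≤ η * moveBound lam (dirBound N β p d) d := by
  have hpos := hη.pos
  refine norm_le_of_sqNorm_le (Z := s'.X - s.X)
    (mul_nonneg hpos.le (moveBound_nonneg _ _ _)) ?_ i
  have h1 := h.sqNorm_sub_X_le hA.mixing hA.d_pos hA.eigenvalue_le hA.lam_nonneg hA.lam_lt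
  have h2 := hs.deviation_X_le
  have h3 := mul_le_mul_of_nonneg_left hs.deviation_D_le (sq_nonneg η)
  have h4 : η ^ 2 * (d * ‖average s.D‖ ^ 2) ≤ η ^ 2 * (d * dirBound N β p d ^ 2) := by
    rw [hs.average_eq]
    have := hs.norm_average_S_le hA hη hj
    gcongr
  have h5 := mul_le_mul_of_nonneg_left (moveBound_le_sq lam (dirBound N β p d) d) (sq_nonneg η)
  rw [mul_pow]
  linarith

/-- Apart from the estimation error, which differs between opening and inner steps and is supplied
by the caller, all bounds reproduce themselves in any tracking step. -/
theorem IsControlled.step (hs : IsControlled f lam β L N η j s)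
    (hA : IsAdmissible G W f lam β L N) (hη : IsSmallStep lam β L N p d q η) (hj : j ≤ q)
    (h : IsTrackingStep W η s s') {j' : ℕ} (hj' : j' ≤ q)
    (herr : ∀ i, ‖localErr f β s' i‖
      ≤ j' * (2 * (searchLip L β p d * (η * moveBound lam (dirBound N β p d) d)))) :
    IsControlled f lam β L N η j' s' where
  average_eq := h.average_D hA.mixing hs.average_eq
  average_mem := hs.average_step_mem hA hη hj h
  deviation_X_le := hs.deviation_step_X_le hA h
  localErr_le := herr
  deviation_D_le := by
    have h1 := h.sqNorm_deviation_D_le hA.mixing hA.d_pos hA.eigenvalue_le hA.lam_nonneg hA.lam_lt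
    have h2 : 0 < 1 - lam := by linarith [hA.lam_lt]
    have h3 := mul_le_mul_of_nonneg_left hs.deviation_D_le hA.lam_nonneg
    have hS' : ∀ i, ‖s'.S i‖ ≤ dirBound N β p d := by
      intro i
      have a1 : ‖localErr f β s' i‖ ≤ 1 / 40 := by
        refine (herr i).trans (le_trans ?_ hη.loop_le)
        have := hA.searchLip_nonneg
        have := hη.pos
        have := moveBound_nonneg lam (dirBound N β p d) d
        gcongr
      have a2 := hA.smooth.norm_searchDir_localCost_le hA.d_pos hA.l_pos hA.sup_le
        hA.β_nonneg i (hs.X_step_mem hA hη hj h i)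
      have a3 := norm_le_norm_add_norm_sub' (s'.S i) (searchDir β (localCost f i) (s'.X i))
      unfold localErr at a1
      unfold dirBound
      linarith
    have h4 : sqNorm (s'.S - s.S) ≤ d * (2 * dirBound N β p d) ^ 2 := by
      refine sqNorm_le_card_mul fun i => (norm_sub_le _ _).trans ?_
      linarith [hS' i, hs.norm_S_le hA hη hj i]
    have h5 : 2 / (1 - lam) * sqNorm (s'.S - s.S)
        ≤ 2 / (1 - lam) * (d * (2 * dirBound N β p d) ^ 2) := by gcongr
    refine h1.trans ((add_le_add h3 h5).trans (le_of_eq ?_))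
    unfold trackBound
    field_simp
    ring

/-! ### Opening steps and inner steps -/

theorem isTrackingStep_outerStep (f : Costs n p d l) (W : Mat d d) (η β : ℝ)
    (s : NetState n p d) : IsTrackingStep W η s (outerStep f W η β s) where
  X_eq := rfl
  D_eq := by
    funext i
    simp only [outerStep, Pi.add_apply, Pi.sub_apply]
    abel

theorem isTrackingStep_innerStep {τ : ℕ} (f : Costs n p d l) (W : Mat d d) (η β : ℝ)
    (C : Batch d l τ) (s : NetState n p d) : IsTrackingStep W η s (innerStep f W η β C s) where
  X_eq := rfl
  D_eq := by
    funext i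
    simp only [innerStep, Pi.add_apply, Pi.sub_apply]
    abel

theorem localErr_outerStep (s : NetState n p d) :
    localErr f β (outerStep f W η β s) = 0 := by
  funext i
  simp [localErr, outerStep]

/-- The increment is a batch mean minus the full mean of the same differences: centred given the
past, and of the size of the displacement in every realization. -/
theorem localErr_innerStep {τ : ℕ} (hA : IsAdmissible G W f lam β L N) (C : Batch d l τ)
    (s : NetState n p d) (i : Fin d) :
    localErr f β (innerStep f W η β C s) i = localErr f β s i
      + ((1 / (τ : ℝ)) • ∑ m, (searchDir β (f i (C i m)) (stepX W η s i)
          - searchDir β (f i (C i m)) (s.X i))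
        - (1 / (l : ℝ)) • ∑ j, (searchDir β (f i j) (stepX W η s i)
          - searchDir β (f i j) (s.X i))) := by
  rw [Finset.sum_sub_distrib (s := Finset.univ (α := Fin l)), smul_sub,
    ← searchDir_localCost hA.l_pos hA.smooth.differentiable,
    ← searchDir_localCost hA.l_pos hA.smooth.differentiable]
  simp only [localErr, innerStep, innerS]
  abel

theorem IsControlled.norm_sample_sub_le (hs : IsControlled f lam β L N η j s)
    (hA : IsAdmissible G W f lam β L N) (hη : IsSmallStep lam β L N p d q η) (hj : j ≤ q)
    (i : Fin d) (m : Fin l) :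
    ‖searchDir β (f i m) (stepX W η s i) - searchDir β (f i m) (s.X i)‖
      ≤ searchLip L β p d * ‖stepX W η s i - s.X i‖ :=
  hA.smooth.norm_searchDir_sub_le hA.d_pos hA.lip_le hA.β_nonneg i m
    (hs.X_step_mem hA hη hj (isTrackingStep_outerStep f W η β s) i) (hs.X_mem hA hη i)

theorem IsControlled.outerStep (hs : IsControlled f lam β L N η j s)
    (hA : IsAdmissible G W f lam β L N) (hη : IsSmallStep lam β L N p d q η) (hj : j ≤ q) :
    IsControlled f lam β L N η 0 (outerStep f W η β s) :=
  hs.step hA hη hj (isTrackingStep_outerStep f W η β s) (Nat.zero_le _) fun i => by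
    rw [localErr_outerStep]
    simp

theorem IsControlled.innerStep {τ : ℕ} (hτ : 0 < τ) (hs : IsControlled f lam β L N η j s)
    (hA : IsAdmissible G W f lam β L N) (hη : IsSmallStep lam β L N p d q η) (hj : j + 1 ≤ q)
    (C : Batch d l τ) : IsControlled f lam β L N η (j + 1) (innerStep f W η β C s) := by
  refine hs.step hA hη (by omega) (isTrackingStep_innerStep f W η β C s) hj fun i => ?_
  have h1 : ∀ m, ‖searchDir β (f i m) (stepX W η s i) - searchDir β (f i m) (s.X i)‖
      ≤ searchLip L β p d * (η * moveBound lam (dirBound N β p d) d) := fun m =>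
    (hs.norm_sample_sub_le hA hη (by omega) i m).trans (mul_le_mul_of_nonneg_left
      (hs.norm_move_le hA hη (by omega) (isTrackingStep_outerStep f W η β s) i)
      hA.searchLip_nonneg)
  have h2 := norm_one_div_smul_sum_le hτ fun m => h1 (C i m)
  have h3 := norm_one_div_smul_sum_le hA.l_pos h1
  have h4 := hs.localErr_le i
  rw [localErr_innerStep hA]
  refine (norm_add_le _ _).trans ?_
  push_cast
  have h5 := norm_sub_le ((1 / (τ : ℝ)) • ∑ m, (searchDir β (f i (C i m)) (stepX W η s i)
          - searchDir β (f i (C i m)) (s.X i))) ((1 / (l : ℝ)) • ∑ j,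
          (searchDir β (f i j) (stepX W η s i) - searchDir β (f i j) (s.X i)))
  linarith

theorem IsControlled.sqNorm_innerStep_sub_le {τ : ℕ} (hτ : 0 < τ)
    (hs : IsControlled f lam β L N η j s) (hA : IsAdmissible G W f lam β L N)
    (hη : IsSmallStep lam β L N p d q η) (hj : j ≤ q) (C : Batch d l τ) :
    sqNorm ((_root_.innerStep f W η β C s).S - s.S)
      ≤ searchLip L β p d ^ 2 * sqNorm (stepX W η s - s.X) := by
  rw [← sqNorm_smul]
  refine sqNorm_le_sqNorm fun i => ?_
  rw [Pi.smul_apply, norm_smul, Real.norm_of_nonneg hA.searchLip_nonneg]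
  have e : ((_root_.innerStep f W η β C s).S - s.S) i = (1 / (τ : ℝ)) • ∑ m,
      (searchDir β (f i (C i m)) (stepX W η s i) - searchDir β (f i (C i m)) (s.X i)) := by
    simp [_root_.innerStep, innerS]
  rw [e]
  exact norm_one_div_smul_sum_le hτ fun m => hs.norm_sample_sub_le hA hη hj i (C i m)

theorem IsControlled.sqNorm_outerStep_sub_le (hs : IsControlled f lam β L N η j s)
    (hA : IsAdmissible G W f lam β L N) (hη : IsSmallStep lam β L N p d q η) (hj : j ≤ q) :
    sqNorm ((_root_.outerStep f W η β s).S - s.S)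
      ≤ 2 * searchLip L β p d ^ 2 * sqNorm (stepX W η s - s.X)
        + 2 * sqNorm (localErr f β s) := by
  have e : (_root_.outerStep f W η β s).S - s.S = (fun i =>
      searchDir β (localCost f i) (stepX W η s i) - searchDir β (localCost f i) (s.X i))
      - localErr f β s := by
    funext i
    simp [_root_.outerStep, localErr]
  rw [e]
  refine (sqNorm_sub_le _ _).trans ?_
  have h : sqNorm (fun i =>
      searchDir β (localCost f i) (stepX W η s i) - searchDir β (localCost f i) (s.X i))
      ≤ searchLip L β p d ^ 2 * sqNorm (stepX W η s - s.X) := by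
    rw [← sqNorm_smul]
    refine sqNorm_le_sqNorm fun i => ?_
    rw [Pi.smul_apply, norm_smul, Real.norm_of_nonneg hA.searchLip_nonneg]
    exact hA.smooth.norm_searchDir_localCost_sub_le hA.d_pos hA.l_pos hA.lip_le
      hA.β_nonneg i
      (hs.X_step_mem hA hη hj (isTrackingStep_outerStep f W η β s) i) (hs.X_mem hA hη i)
  linarith

theorem sqNorm_initState_D_le (hA : IsAdmissible G W f lam β L N) {X₀ : Mat n p}
    (hX₀ : X₀ ∈ region n p) : sqNorm (deviation (initState f β X₀).D)
      ≤ d * searchBound N β p d ^ 2 :=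
  (sqNorm_deviation_le hA.d_pos _).trans <| sqNorm_le_card_mul fun i =>
    hA.smooth.norm_searchDir_localCost_le hA.d_pos hA.l_pos hA.sup_le
      hA.β_nonneg i (region_subset_bigBall hA.d_pos hX₀)

theorem isControlled_initState (hA : IsAdmissible G W f lam β L N)
    {X₀ : Mat n p} (hX₀ : X₀ ∈ region n p) :
    IsControlled f lam β L N η 0 (initState f β X₀) where
  average_eq := rfl
  average_mem := by
    change average (fun _ : Fin d => X₀) ∈ region n p
    rwa [average_const hA.d_pos]
  deviation_X_le := by
    have e : deviation (initState f β X₀).X = 0 := deviation_const hA.d_pos X₀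
    have := trackBound_nonneg lam (dirBound N β p d) d
    rw [e]
    simp only [sqNorm, Pi.zero_apply, norm_zero]
    simp
    positivity
  localErr_le i := by simp [localErr, initState]
  deviation_D_le := by
    refine (sqNorm_initState_D_le hA hX₀).trans ?_
    have h1 : 0 < 1 - lam := by linarith [hA.lam_lt]
    have h2 : (1 - lam) ^ 2 ≤ 1 := by nlinarith [hA.lam_nonneg]
    have h3 := hA.searchBound_nonneg
    unfold trackBound dirBound
    rw [le_div_iff₀ (by positivity)]
    have h4 : d * searchBound N β p d ^ 2 ≤ d * (searchBound N β p d + 1) ^ 2 := by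
      gcongr; linarith
    have h5 : 0 ≤ d * searchBound N β p d ^ 2 := by positivity
    nlinarith

/-- The counter is the number of inner steps since the last opening step. At m = 0 truncated
subtraction makes it 0, which is right since the initial directions are exact. -/
theorem isControlled_linState {τ : ℕ} (hτ : 0 < τ) (hA : IsAdmissible G W f lam β L N)
    (hη : IsSmallStep lam β L N p d q η) {X₀ : Mat n p} (hX₀ : X₀ ∈ region n p)
    (ζ : ℕ → Batch d l τ) (m : ℕ) :
    IsControlled f lam β L N η ((m - 1) % (q + 1)) (linState f W η β q X₀ ζ m) := by
  induction m with
  | zero =>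
    rw [linState]
    exact isControlled_initState hA hX₀
  | succ m ih =>
    have hlt := Nat.mod_lt (m - 1) (by omega : 0 < q + 1)
    rw [linState, Nat.add_sub_cancel]
    split_ifs with h
    · rw [h]
      exact ih.outerStep hA hη (by omega)
    · obtain ⟨k, rfl⟩ : ∃ k, m = k + 1 := Nat.exists_eq_succ_of_ne_zero (by rintro rfl; simp at h)
      have h2 : (k + 1) % (q + 1) = k % (q + 1) + 1 := by
        rw [Nat.add_mod_eq_ite] at h ⊢
        have h3 := Nat.mod_lt k (by omega : 0 < q + 1)
        rcases Nat.eq_zero_or_pos q with rfl | hq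
        · simp [Nat.mod_one] at h
        · rw [Nat.mod_eq_of_lt (by omega : 1 < q + 1)] at h ⊢
          split_ifs at h ⊢ with h4
          · omega
          · rfl
      rw [Nat.add_sub_cancel] at ih
      have h3 := Nat.mod_lt (k + 1) (by omega : 0 < q + 1)
      rw [h2] at h3 ⊢
      exact ih.innerStep hτ hA hη (by omega) (ζ (k + 1))

end Control

/-! ### Summation of the recursions -/

section Recursion

/-- Summing the recursion telescopes once the last term x N is kept on the left during the
induction. -/
theorem one_sub_mul_sum_le {t c : ℝ} {x y : ℕ → ℝ} (hx : ∀ m, 0 ≤ x m)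
    (h : ∀ m, x (m + 1) ≤ t * x m + c * y m) (N : ℕ) :
    (1 - t) * ∑ m ∈ Finset.range N, x m ≤ x 0 + c * ∑ m ∈ Finset.range N, y m := by
  have key : (1 - t) * ∑ m ∈ Finset.range N, x m + x N
      ≤ x 0 + c * ∑ m ∈ Finset.range N, y m := by
    induction N with
    | zero => simp
    | succ N ih =>
      rw [Finset.sum_range_succ, Finset.sum_range_succ, mul_add, mul_add]
      linarith [h N]
  linarith [hx N]

/-- A sequence of errors that is reset every `q + 1` steps and otherwise grows by multiples of a
second sequence. -/
theorem sum_reset_le {q : ℕ} {c : ℝ} (hc : 0 ≤ c) {u y : ℕ → ℝ} (hu : ∀ m, 0 ≤ u m)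
    (hy : ∀ m, 0 ≤ y m) (h0 : u 0 = 0) (hreset : ∀ m, m % (q + 1) = 0 → u (m + 1) = 0)
    (h : ∀ m, m % (q + 1) ≠ 0 → u (m + 1) ≤ u m + c * y m) (N : ℕ) :
    ∑ m ∈ Finset.range N, u m ≤ q * c * ∑ m ∈ Finset.range N, y m := by
  have hsucc : ∀ m : ℕ, (m + 1) % (q + 1) = if m % (q + 1) = q then 0 else m % (q + 1) + 1 := by
    intro m
    have hlt := Nat.mod_lt m (by omega : 0 < q + 1)
    split_ifs with h1
    · rw [Nat.add_mod, h1]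
      rcases Nat.eq_zero_or_pos q with rfl | hq
      · simp
      · rw [Nat.mod_eq_of_lt (by omega : 1 < q + 1), Nat.mod_self]
    · rw [Nat.add_mod, Nat.mod_eq_of_lt (by omega : 1 < q + 1), Nat.mod_eq_of_lt (by omega)]
  -- The number of indices from m on, m included, until the next reset. The reset shows one index
  -- after a multiple of q + 1, so residue 0 is the last of a cycle and has weight 1, and residue 1
  -- has weight q + 1.
  set g : ℕ → ℝ := fun m => if m % (q + 1) = 0 then 1 else (q : ℝ) + 2 - (m % (q + 1) : ℕ) with hg
  have hg1 : ∀ m, 1 ≤ g m := by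
    intro m
    simp only [hg]
    split_ifs
    · exact le_rfl
    · have h2 : m % (q + 1) ≤ q := by have := Nat.mod_lt m (by omega : 0 < q + 1); omega
      have h3 : ((m % (q + 1) : ℕ) : ℝ) ≤ q := by exact_mod_cast h2
      linarith
  have hgq : ∀ m, m % (q + 1) ≠ 0 → g m - 1 ≤ q := by
    intro m hm
    simp only [hg, if_neg hm]
    have : (1 : ℝ) ≤ (m % (q + 1) : ℕ) := by exact_mod_cast Nat.one_le_iff_ne_zero.2 hm
    linarith
  have hgs : ∀ m, m % (q + 1) ≠ 0 → g (m + 1) = g m - 1 := by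
    intro m hm
    simp only [hg, if_neg hm, hsucc]
    by_cases h1 : m % (q + 1) = q
    · simp [h1]; ring
    · simp [h1]; ring
  have hqc : 0 ≤ (q : ℝ) * c := by positivity
  -- The potential g N * u N prepays the present error for the rest of its cycle. An increment made
  -- at time m is then charged at most q times.
  have key : ∑ m ∈ Finset.range N, u m + g N * u N ≤ q * c * ∑ m ∈ Finset.range N, y m := by
    induction N with
    | zero => simp [h0]
    | succ N ih =>
      rw [Finset.sum_range_succ, Finset.sum_range_succ, mul_add]
      have hyN : 0 ≤ q * c * y N := mul_nonneg hqc (hy N)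
      by_cases hN : N % (q + 1) = 0
      · rw [hreset N hN]
        nlinarith [hg1 N, hu N]
      · rw [hgs N hN]
        have h2 := mul_le_mul_of_nonneg_left (h N hN) (by linarith [hg1 N] : 0 ≤ g N - 1)
        have h3 := mul_le_mul_of_nonneg_right (hgq N hN) (mul_nonneg hc (hy N))
        nlinarith
  have := mul_nonneg (zero_le_one.trans (hg1 N)) (hu N)
  linarith

/-- Coefficient of the accumulated displacement in the estimate of the direction errors. -/
def errCoef (c A : ℝ) (d : ℕ) : ℝ := 4 * A * ((8 * c + 4) + c + 4 * d)

/-- The conditions on the step size under which the accumulated inequalities can be solved. -/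
structure IsSummableStep (c A B E D : ℝ) (d : ℕ) (η : ℝ) : Prop where
  pos : 0 < η
  le_one : η ≤ 1
  track_le : η * (8 * c * A * (8 * c + 4)) ≤ 1
  dir_le : η * (32 * c * A * d) ≤ 1
  err_le : η * (6 * errCoef c A d) ≤ 1
  absorb_le : η * (192 * E * errCoef c A d * B) ≤ 1
  init_le : η * (2 * E * errCoef c A d * D) ≤ 1
  init_le' : η * (3 * c * D) ≤ 1
  consensus_le : η * (24 * c * B) ≤ 1

/-- A small-gain argument. Every feedback coefficient carries η², so each quantity can be solved for
in turn: tracking deviation in terms of the averaged directions, these in terms of the stationarity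
measure, and finally the latter from the descent inequality. The dispersion D at the start appears
only with such factors and leaves additive constants. -/
theorem sum_gap_le {c A B E D η : ℝ} {d : ℕ} (h : IsSummableStep c A B E D d η) (hc : 0 ≤ c)
    (hA : 0 ≤ A) (hE : 0 ≤ E) (hD : 0 ≤ D) (hB : 0 ≤ B)
    {sX sD sY sU sV sG sE Φ : ℝ} (hD0 : 0 ≤ sD) (hV0 : 0 ≤ sV) (hG0 : 0 ≤ sG)
    (h1 : sX ≤ c * (η ^ 2 * sD)) (h2 : sD ≤ D + 2 * c * (A * sY + sU)) (hU : sU ≤ A * sY)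
    (h3 : sY ≤ 8 * sX + 4 * (η ^ 2 * sD) + 4 * (η ^ 2 * (d * sV)))
    (h4 : sV ≤ 12 * B * sG + 3 * sE) (h5 : sE ≤ 2 * sU + 2 * A * sX)
    (h6 : η / 4 * sG ≤ Φ + E * η * sE) :
    sG + sX ≤ 16 * (Φ + 1) / η + 1 := by
  have hη := h.pos
  have hsq : ∀ k : ℝ, 0 ≤ k → η * k ≤ 1 → η ^ 2 * k ≤ 1 := by
    intro k hk hk1
    have := h.le_one
    nlinarith [mul_nonneg hη.le hk]
  have hd0 : (0 : ℝ) ≤ d := Nat.cast_nonneg d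
  have hC0 : 0 ≤ errCoef c A d := by unfold errCoef; positivity
  have k1 := hsq _ (by positivity) h.track_le
  have k2 := hsq _ (by positivity) h.dir_le
  have k3 := hsq _ (by positivity) h.err_le
  have k4 := hsq _ (by positivity) h.absorb_le
  have k5 := hsq _ (by positivity) h.init_le
  have k6 := hsq _ (by positivity) h.init_le'
  have k7 := hsq _ (by positivity) h.consensus_le
  have hη2 : 0 ≤ η ^ 2 := sq_nonneg η
  -- displacement
  have a1 : sY ≤ (8 * c + 4) * (η ^ 2 * sD) + 4 * (η ^ 2 * (d * sV)) := by linarith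
  have a2 : sD ≤ D + 4 * c * (A * sY) := by
    have := mul_le_mul_of_nonneg_left hU (by positivity : 0 ≤ 2 * c)
    linarith
  -- The feedback through the displacement is at most sD/2 + sV/2, and sD/2 is moved to the left.
  have a3 : sD ≤ 2 * D + sV := by
    have b1 := mul_le_mul_of_nonneg_left a1 (by positivity : 0 ≤ 4 * c * A)
    have b2 := mul_le_mul_of_nonneg_right k1 hD0
    have b3 := mul_le_mul_of_nonneg_right k2 hV0
    linarith
  have a4 := mul_le_mul_of_nonneg_left a3 hη2
  have a5 : sX ≤ c * (η ^ 2 * (2 * D + sV)) := h1.trans (mul_le_mul_of_nonneg_left a4 hc)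
  have a6 : sY ≤ (8 * c + 4) * (η ^ 2 * (2 * D + sV)) + 4 * (η ^ 2 * (d * sV)) := by
    have := mul_le_mul_of_nonneg_left a4 (by positivity : 0 ≤ 8 * c + 4)
    linarith
  -- direction errors
  have a7 : sE ≤ η ^ 2 * errCoef c A d * (D + sV) := by
    have b1 := mul_le_mul_of_nonneg_left a6 (by positivity : 0 ≤ 2 * A)
    have b2 := mul_le_mul_of_nonneg_left a5 (by positivity : 0 ≤ 2 * A)
    have b3 : 0 ≤ η ^ 2 * A * d * D := by positivity
    have b4 : 0 ≤ η ^ 2 * A * c * sV := by positivity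
    have b5 : 0 ≤ η ^ 2 * A * sV := by positivity
    have b6 : 0 ≤ η ^ 2 * A * d * sV := by positivity
    unfold errCoef
    nlinarith
  have a8 : sV ≤ 24 * B * sG + D := by
    have := mul_le_mul_of_nonneg_right k3 (add_nonneg hD hV0)
    linarith
  have a9 : sE ≤ η ^ 2 * errCoef c A d * (2 * D + 24 * B * sG) := by
    refine a7.trans (mul_le_mul_of_nonneg_left (by linarith) (by positivity))
  -- The errors caused by sG itself cost at most half of the descent η/4 * sG; those caused by D
  -- cost at most 1.
  have a10 : η / 8 * sG ≤ Φ + 1 := by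
    have b1 := mul_le_mul_of_nonneg_left a9 (by positivity : 0 ≤ E * η)
    have b2 := mul_le_mul_of_nonneg_right k4 (by positivity : 0 ≤ η * sG)
    have b3 := mul_le_mul_of_nonneg_left k5 hη.le
    have b4 := h.le_one
    linarith
  have a11 : sX ≤ 1 + sG := by
    have b1 := mul_le_mul_of_nonneg_left a8 (mul_nonneg hc hη2)
    have b2 := mul_le_mul_of_nonneg_right k7 hG0
    linarith
  have a12 : 2 * sG ≤ 16 * (Φ + 1) / η := by
    rw [le_div_iff₀ hη]
    linarith
  linarith

end Recursion

/-! ### Functions of finitely many draws -/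

section FiniteRange

variable {Ω : Type*} [MeasurableSpace Ω]

/-- A random element with finitely many values, each of them taken on a measurable event. -/
structure IsFiniteValued {α : Type*} (g : Ω → α) : Prop where
  finite : (Set.range g).Finite
  measurable : ∀ y, MeasurableSet (g ⁻¹' {y})

variable {α γ : Type*}

theorem isFiniteValued_const (a : α) : IsFiniteValued fun _ : Ω => a where
  finite := Set.finite_range_const
  measurable y := measurable_const (MeasurableSpace.measurableSet_top (s := {y}))

/-- Finitely many fibres cover any preimage, so no σ-algebra on the values, in particular on network
states, is needed. -/
theorem IsFiniteValued.measurableSet_preimage {g : Ω → α} (hg : IsFiniteValued g) (s : Set α) :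
    MeasurableSet (g ⁻¹' s) := by
  have e : g ⁻¹' s = ⋃ y ∈ Set.range g ∩ s, g ⁻¹' {y} := by
    ext ω
    simp
  rw [e]
  exact (hg.finite.inter_of_left s).measurableSet_biUnion fun y _ => hg.measurable y

theorem IsFiniteValued.comp {g : Ω → α} (hg : IsFiniteValued g) (F : α → γ) :
    IsFiniteValued fun ω => F (g ω) where
  finite := by
    have e : Set.range (fun ω => F (g ω)) = F '' Set.range g := Set.range_comp F g
    rw [e]
    exact hg.finite.image F
  measurable y := hg.measurableSet_preimage (F ⁻¹' {y})

theorem IsFiniteValued.prodMk {g : Ω → α} {h : Ω → γ} (hg : IsFiniteValued g)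
    (hh : IsFiniteValued h) : IsFiniteValued fun ω => (g ω, h ω) where
  finite := (hg.finite.prod hh.finite).subset (by rintro _ ⟨ω, rfl⟩; exact ⟨⟨ω, rfl⟩, ⟨ω, rfl⟩⟩)
  measurable y := by
    have e : (fun ω => (g ω, h ω)) ⁻¹' {y} = g ⁻¹' {y.1} ∩ h ⁻¹' {y.2} := by
      ext ω
      simp [Prod.ext_iff]
    rw [e]
    exact (hg.measurable _).inter (hh.measurable _)

theorem Measurable.isFiniteValued [Finite α] [MeasurableSpace α] [MeasurableSingletonClass α]
    {g : Ω → α} (hg : Measurable g) : IsFiniteValued g where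
  finite := Set.toFinite _
  measurable y := hg (measurableSet_singleton y)

theorem IsFiniteValued.integrable {g : Ω → ℝ} (hg : IsFiniteValued g) (P : Measure Ω)
    [IsFiniteMeasure P] : Integrable g P := by
  have hm : Measurable g := fun s _ => hg.measurableSet_preimage s
  obtain ⟨B, hB⟩ := (hg.finite.image (fun x => ‖x‖)).bddAbove
  exact Integrable.of_bound hm.aestronglyMeasurable B
    (Filter.Eventually.of_forall fun ω => hB ⟨g ω, ⟨ω, rfl⟩, rfl⟩)

/-- Conditioning on X in elementary form: by independence the joint law is a product, and Fubini
integrates Y with the value of X frozen. -/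
theorem integral_le_of_indepFun [Finite α] [MeasurableSpace α] [MeasurableSingletonClass α]
    [Finite γ] [MeasurableSpace γ] [MeasurableSingletonClass γ] {P : Measure Ω}
    [IsProbabilityMeasure P] {X : Ω → α} {Y : Ω → γ} (hX : Measurable X) (hY : Measurable Y)
    (hXY : IndepFun X Y P) {g : α → γ → ℝ} {v : α → ℝ}
    (h : ∀ a, ∫ b, g a b ∂(P.map Y) ≤ v a) :
    ∫ ω, g (X ω) (Y ω) ∂P ≤ ∫ ω, v (X ω) ∂P := by
  have : IsProbabilityMeasure (P.map X) := Measure.isProbabilityMeasure_map hX.aemeasurable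
  have : IsProbabilityMeasure (P.map Y) := Measure.isProbabilityMeasure_map hY.aemeasurable
  have hlaw := (indepFun_iff_map_prod_eq_prod_map_map hX.aemeasurable hY.aemeasurable).1 hXY
  have e1 : ∫ ω, g (X ω) (Y ω) ∂P = ∫ z, g z.1 z.2 ∂(P.map fun ω => (X ω, Y ω)) :=
    (integral_map (f := fun z : α × γ => g z.1 z.2) (hX.prodMk hY).aemeasurable
      (measurable_of_finite _).aestronglyMeasurable).symm
  have e2 : ∫ ω, v (X ω) ∂P = ∫ a, v a ∂(P.map X) :=
    (integral_map hX.aemeasurable (measurable_of_finite _).aestronglyMeasurable).symm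
  rw [e1, hlaw, integral_prod _ Integrable.of_finite, e2]
  exact integral_mono Integrable.of_finite Integrable.of_finite h

end FiniteRange

/-! ### Expectations along the algorithm -/

section Expectation

variable {n p d l τ : ℕ} {Ω : Type*} [MeasurableSpace Ω] {P : Measure Ω}
  {ξ : ℕ → ℕ → Ω → Batch d l τ} {f : Costs n p d l} {W : Mat d d} {η β : ℝ} {q : ℕ}
  {X₀ : Mat n p}

theorem IsSampling.isFiniteValued_innerLoop (hξ : IsSampling P ξ) {s : Ω → NetState n p d}
    (hs : IsFiniteValued s) (k t : ℕ) :
    IsFiniteValued fun ω => innerLoop f W η β (fun t => ξ k t ω) (s ω) t := by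
  induction t with
  | zero => exact hs
  | succ t ih =>
    exact (((hξ.measurable k (t + 1)).isFiniteValued).prodMk ih).comp
      fun z => innerStep f W η β z.1 z.2

theorem IsSampling.isFiniteValued_vrsgtOuter (hξ : IsSampling P ξ) (k : ℕ) :
    IsFiniteValued fun ω => vrsgtOuter f W η β q X₀ (fun k t => ξ k t ω) k := by
  induction k with
  | zero => exact isFiniteValued_const _
  | succ k ih =>
    exact hξ.isFiniteValued_innerLoop (ih.comp fun s => outerStep f W η β s) (k + 1) q

theorem IsSampling.isFiniteValued_vrsgt (hξ : IsSampling P ξ) (k t : ℕ) :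
    IsFiniteValued fun ω => vrsgt f W η β q X₀ (fun k t => ξ k t ω) k t := by
  rcases t with _ | t
  · simp only [vrsgt]
    exact hξ.isFiniteValued_vrsgtOuter k
  · rcases k with _ | k
    · exact isFiniteValued_const _
    · exact hξ.isFiniteValued_innerLoop
        ((hξ.isFiniteValued_vrsgtOuter k).comp fun s => outerStep f W η β s) (k + 1) t

/-- The batches in linear time. -/
def linBatch (q : ℕ) (ξ : ℕ → ℕ → Ω → Batch d l τ) (ω : Ω) (m : ℕ) : Batch d l τ :=
  ξ (batchIndex q m).1 (batchIndex q m).2 ω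

theorem IsSampling.isFiniteValued_linState (hξ : IsSampling P ξ) (m : ℕ) :
    IsFiniteValued fun ω => linState f W η β q X₀ (linBatch q ξ ω) m := by
  induction m with
  | zero => exact isFiniteValued_const _
  | succ m ih =>
    exact (((hξ.measurable (batchIndex q m).1 (batchIndex q m).2).isFiniteValued).prodMk ih).comp
      fun z => if m % (q + 1) = 0 then outerStep f W η β z.2 else innerStep f W η β z.1 z.2

theorem IsSampling.integrable_linState [IsProbabilityMeasure P] (hξ : IsSampling P ξ)
    (F : NetState n p d → ℝ) (m : ℕ) :
    Integrable (fun ω => F (linState f W η β q X₀ (linBatch q ξ ω) m)) P :=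
  ((hξ.isFiniteValued_linState m).comp F).integrable P

/-- The batch of a step is independent of the previous ones. -/
theorem IsSampling.indepFun_linBatch (hξ : IsSampling P ξ) (q m : ℕ) (i : Fin d) :
    IndepFun (fun ω (k : Finset.range m) => linBatch q ξ ω k) (fun ω => linBatch q ξ ω m i) P := by
  have h := (hξ.indep.precomp (batchIndex_injective q)).indepFun_finset (Finset.range m) {m}
    (by simp) fun k => hξ.measurable _ _
  exact h.comp (φ := id)
    (ψ := fun z : (({m} : Finset ℕ) → Batch d l τ) => z ⟨m, Finset.mem_singleton_self m⟩ i)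
    measurable_id (measurable_of_finite _)

variable {G : SimpleGraph (Fin d)} {lam L N : ℝ}

/-- Given the past, the batch of one agent is uniform, so the variance bound applies to that agent's
error. The errors of different agents are only added, never multiplied, and the joint law of their
draws plays no role. -/
theorem IsSampling.integral_localErr_le [IsProbabilityMeasure P] (hξ : IsSampling P ξ)
    (hτ : 0 < τ) (hA : IsAdmissible G W f lam β L N) (hη : IsSmallStep lam β L N p d q η)
    (hX₀ : X₀ ∈ region n p) {m : ℕ} (hm : m % (q + 1) ≠ 0) :
    ∫ ω, sqNorm (localErr f β (linState f W η β q X₀ (linBatch q ξ ω) (m + 1))) ∂P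
      ≤ ∫ ω, sqNorm (localErr f β (linState f W η β q X₀ (linBatch q ξ ω) m)) ∂P
        + 1 / (τ : ℝ) * searchLip L β p d ^ 2 *
          ∫ ω, sqNorm (stepX W η (linState f W η β q X₀ (linBatch q ξ ω) m)
            - (linState f W η β q X₀ (linBatch q ξ ω) m).X) ∂P := by
  set st : Ω → NetState n p d := fun ω => linState f W η β q X₀ (linBatch q ξ ω) m with hst
  have hint : ∀ F : NetState n p d → ℝ, Integrable (fun ω => F (st ω)) P := fun F =>
    hξ.integrable_linState F m
  have hint' : ∀ F : NetState n p d → ℝ, Integrable (fun ω =>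
    F (linState f W η β q X₀ (linBatch q ξ ω) (m + 1))) P := fun F =>
    hξ.integrable_linState F (m + 1)
  have key : ∀ i, ∫ ω, ‖localErr f β (linState f W η β q X₀ (linBatch q ξ ω) (m + 1)) i‖ ^ 2 ∂P
      ≤ ∫ ω, (‖localErr f β (st ω) i‖ ^ 2
        + 1 / (τ : ℝ) * searchLip L β p d ^ 2 * ‖stepX W η (st ω) i - (st ω).X i‖ ^ 2) ∂P := by
    intro i
    -- The state before the step is written as a function of the finitely many past batches. The
    -- batches from m on are filled with an arbitrary default, which that state does not see.
    set ext : (Finset.range m → Batch d l τ) → ℕ → Batch d l τ := fun a k =>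
      if h : k ∈ Finset.range m then a ⟨k, h⟩ else fun _ _ => ⟨0, hA.l_pos⟩ with hext
    set sa : (Finset.range m → Batch d l τ) → NetState n p d := fun a =>
      linState f W η β q X₀ (ext a) m with hsa
    have hsa' : ∀ ω, st ω = sa (fun k : Finset.range m => linBatch q ξ ω k) := by
      intro ω
      refine linState_congr f W η β q X₀ fun k hk => ?_
      simp only [hext, dif_pos (Finset.mem_range.2 hk)]
    have hmeas : Measurable fun ω (k : Finset.range m) => linBatch q ξ ω k :=
      measurable_pi_lambda _ fun k => hξ.measurable _ _
    have hmeas' : Measurable fun ω => linBatch q ξ ω m i :=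
      (measurable_pi_apply i).comp (hξ.measurable _ _)
    have h := integral_le_of_indepFun hmeas hmeas' (hξ.indepFun_linBatch q m i)
      (g := fun a c => ‖localErr f β (sa a) i
        + ((1 / (τ : ℝ)) • ∑ m, (searchDir β (f i (c m)) (stepX W η (sa a) i)
            - searchDir β (f i (c m)) ((sa a).X i))
          - (1 / (l : ℝ)) • ∑ j, (searchDir β (f i j) (stepX W η (sa a) i)
            - searchDir β (f i j) ((sa a).X i)))‖ ^ 2)
      (v := fun a => ‖localErr f β (sa a) i‖ ^ 2
        + 1 / (τ : ℝ) * searchLip L β p d ^ 2 * ‖stepX W η (sa a) i - (sa a).X i‖ ^ 2) ?_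
    · simp only [← hsa'] at h
      refine le_trans (le_of_eq ?_) h
      refine integral_congr_ae (Filter.Eventually.of_forall fun ω => ?_)
      dsimp only
      rw [linState, if_neg hm, localErr_innerStep hA]
    · intro a
      have hlaw : P.map (fun ω => linBatch q ξ ω m i)
          = uniformOn (Set.univ : Set (Fin τ → Fin l)) := hξ.law _ _ i
      rw [hlaw]
      refine (integral_batch_le hA.l_pos hτ (fun j => searchDir β (f i j) (stepX W η (sa a) i)
            - searchDir β (f i j) ((sa a).X i)) _).trans ?_
      rw [mul_assoc]
      refine add_le_add le_rfl (mul_le_mul_of_nonneg_left ?_ (by positivity))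
      -- The deterministic control holds for every sequence of batches, hence also for this
      -- artificial one, and puts both points of the displacement in `bigBall`.
      have hc := isControlled_linState hτ hA hη hX₀ (ext a) m
      have hq : (m - 1) % (q + 1) ≤ q := by
        have := Nat.mod_lt (m - 1) (by omega : 0 < q + 1); omega
      have hl : (0 : ℝ) < l := by exact_mod_cast hA.l_pos
      rw [one_div_mul_eq_div, div_le_iff₀ hl]
      refine (Finset.sum_le_sum fun j _ => pow_le_pow_left₀ (norm_nonneg _)
        (hc.norm_sample_sub_le hA hη hq i j) 2).trans ?_
      simp only [Finset.sum_const, Finset.card_univ, Fintype.card_fin, nsmul_eq_mul, mul_pow]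
      exact le_of_eq (by ring)
  simp only [sqNorm]
  rw [integral_finsetSum _ fun i _ => hint' fun s => ‖localErr f β s i‖ ^ 2,
    integral_finsetSum _ fun i _ => hint fun s => ‖localErr f β s i‖ ^ 2,
    integral_finsetSum _ fun i _ => hint fun s => ‖(stepX W η s - s.X) i‖ ^ 2,
    Finset.mul_sum, ← Finset.sum_add_distrib]
  refine Finset.sum_le_sum fun i _ => (key i).trans (le_of_eq ?_)
  rw [integral_add (hint fun s => ‖localErr f β s i‖ ^ 2)
    ((hint fun s => ‖stepX W η s i - s.X i‖ ^ 2).const_mul _), integral_const_mul]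
  rfl

end Expectation

/-! ### The expected stationarity gap -/

section Gap

variable {n p d l τ : ℕ} {Ω : Type*} [MeasurableSpace Ω] {P : Measure Ω}
  {ξ : ℕ → ℕ → Ω → Batch d l τ} {f : Costs n p d l} {W : Mat d d} {η β : ℝ} {q : ℕ}
  {X₀ : Mat n p} {G : SimpleGraph (Fin d)} {lam L N : ℝ}

theorem isTrackingStep_linState (ζ : ℕ → Batch d l τ) (m : ℕ) :
    IsTrackingStep W η (linState f W η β q X₀ ζ m) (linState f W η β q X₀ ζ (m + 1)) := by
  rw [linState]
  split_ifs
  · exact isTrackingStep_outerStep f W η β _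
  · exact isTrackingStep_innerStep f W η β _ _

theorem IsControlled.sqNorm_linState_sub_le (hτ : 0 < τ) (hA : IsAdmissible G W f lam β L N)
    (hη : IsSmallStep lam β L N p d q η) (ζ : ℕ → Batch d l τ) (m : ℕ) {j : ℕ} (hj : j ≤ q)
    (hs : IsControlled f lam β L N η j (linState f W η β q X₀ ζ m)) :
    sqNorm ((linState f W η β q X₀ ζ (m + 1)).S - (linState f W η β q X₀ ζ m).S)
      ≤ 2 * (searchLip L β p d ^ 2 * sqNorm (stepX W η (linState f W η β q X₀ ζ m)
          - (linState f W η β q X₀ ζ m).X))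
        + 2 * sqNorm (localErr f β (linState f W η β q X₀ ζ m)) := by
  rw [linState]
  split_ifs
  · rw [← mul_assoc]
    exact hs.sqNorm_outerStep_sub_le hA hη hj
  · refine (hs.sqNorm_innerStep_sub_le hτ hA hη hj (ζ m)).trans ?_
    have h1 := mul_nonneg (sq_nonneg (searchLip L β p d)) (sqNorm_nonneg
      (stepX W η (linState f W η β q X₀ ζ m) - (linState f W η β q X₀ ζ m).X))
    have h2 := sqNorm_nonneg (localErr f β (linState f W η β q X₀ ζ m))
    linarith

/-- The expectation of a function of the state after `m` steps. -/
def stateMean (P : Measure Ω) (f : Costs n p d l) (W : Mat d d) (η β : ℝ) (q : ℕ) (X₀ : Mat n p)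
    (ξ : ℕ → ℕ → Ω → Batch d l τ) (F : NetState n p d → ℝ) (m : ℕ) : ℝ :=
  ∫ ω, F (linState f W η β q X₀ (linBatch q ξ ω) m) ∂P

theorem IsSampling.stateMean_add [IsProbabilityMeasure P] (hξ : IsSampling P ξ)
    (F H : NetState n p d → ℝ) (m : ℕ) :
    stateMean P f W η β q X₀ ξ (fun s => F s + H s) m
      = stateMean P f W η β q X₀ ξ F m + stateMean P f W η β q X₀ ξ H m :=
  integral_add (hξ.integrable_linState F m) (hξ.integrable_linState H m)

theorem stateMean_mul (c : ℝ) (F : NetState n p d → ℝ) (m : ℕ) :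
    stateMean P f W η β q X₀ ξ (fun s => c * F s) m = c * stateMean P f W η β q X₀ ξ F m :=
  integral_const_mul _ _

theorem IsSampling.stateMean_mono [IsProbabilityMeasure P] (hξ : IsSampling P ξ)
    {F H : NetState n p d → ℝ} {m k : ℕ}
    (h : ∀ ζ, F (linState f W η β q X₀ ζ m) ≤ H (linState (τ := τ) f W η β q X₀ ζ k)) :
    stateMean P f W η β q X₀ ξ F m ≤ stateMean P f W η β q X₀ ξ H k :=
  integral_mono (hξ.integrable_linState F m) (hξ.integrable_linState H k) fun _ => h _

theorem stateMean_nonneg {F : NetState n p d → ℝ} (hF : ∀ s, 0 ≤ F s) (m : ℕ) :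
    0 ≤ stateMean P f W η β q X₀ ξ F m := integral_nonneg fun _ => hF _

theorem stateMean_zero [IsProbabilityMeasure P] (F : NetState n p d → ℝ) :
    stateMean P f W η β q X₀ ξ F 0 = F (initState f β X₀) := by
  simp [stateMean, linState]

/-- The squared stationarity measures of the averaged iterate. -/
def stationarity (f : Costs n p d l) (s : NetState n p d) : ℝ :=
  ‖genRiemGrad (globalCost f) (average s.X)‖ ^ 2 + ‖orthResidual (average s.X)‖ ^ 2

theorem stationarity_nonneg (f : Costs n p d l) (s : NetState n p d) : 0 ≤ stationarity f s := by
  unfold stationarity; positivity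

theorem staGap_le (hd : 0 < d) (hf : ∀ i j, Differentiable ℝ (f i j)) (s : NetState n p d) :
    staGap f s.X ≤ stationarity f s + sqNorm (deviation s.X) := by
  have hd' : (1 : ℝ) ≤ d := by exact_mod_cast hd
  have h1 : 1 / (d : ℝ) * sqNorm (deviation s.X) ≤ 1 * sqNorm (deviation s.X) := by
    have := sqNorm_nonneg (deviation s.X)
    gcongr
    rw [div_le_one (by linarith)]
    exact hd'
  have e : staGap f s.X = ‖genRiemGrad (globalCost f) (average s.X)‖ ^ 2
      + 1 / (d : ℝ) * sqNorm (deviation s.X) + ‖orthResidual (average s.X)‖ ^ 2 := by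
    rw [genRiemGrad_globalCost hf]
    rfl
  rw [e, stationarity]
  linarith

theorem staGap_nonneg (f : Costs n p d l) (X : Fin d → Mat n p) : 0 ≤ staGap f X := by
  unfold staGap; positivity

/-- The sum of the expected stationarity gaps. -/
theorem IsSampling.sum_stateMean_staGap_le [IsProbabilityMeasure P] (hξ : IsSampling P ξ)
    (hτ : 0 < τ) (hτq : τ = q)
    (hA : IsAdmissible G W f lam β L N) (hη : IsSmallStep lam β L N p d q η)
    (hS : IsSummableStep (2 / (1 - lam) ^ 2) (searchLip L β p d ^ 2) (β ^ 2)
      (2 + 16 * penaltyWeight L (ballRadius p d) β) (d * searchBound N β p d ^ 2 / (1 - lam)) d η)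
    (hX₀ : X₀ ∈ region n p) (M : ℕ) :
    ∑ m ∈ Finset.range M, stateMean P f W η β q X₀ ξ (fun s => staGap f s.X) m
      ≤ 17 * (1 + β + penaltyWeight L (ballRadius p d) β)
        * (globalCost f X₀ - costInf f + 1) / η := by
  set Ex := stateMean P f W η β q X₀ ξ with hEx
  set x : ℕ → ℝ := Ex fun s => sqNorm (deviation s.X) with hx
  set D : ℕ → ℝ := Ex fun s => sqNorm (deviation s.D) with hD
  set u : ℕ → ℝ := Ex fun s => sqNorm (localErr f β s) with hu
  set y : ℕ → ℝ := Ex fun s => sqNorm (stepX W η s - s.X) with hy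
  set v : ℕ → ℝ := Ex fun s => ‖average s.D‖ ^ 2 with hv
  set g : ℕ → ℝ := Ex fun s => stationarity f s with hg
  set e : ℕ → ℝ := Ex fun s => ‖globalErr f β s‖ ^ 2 with he
  set φ : ℕ → ℝ := Ex fun s => merit L (ballRadius p d) β (globalCost f) (average s.X) with hφ
  set A := searchLip L β p d ^ 2 with hAdef
  set Γ := penaltyWeight L (ballRadius p d) β with hΓ
  have hl1 : 0 < 1 - lam := by linarith [hA.lam_lt]
  have hA0 : 0 ≤ A := sq_nonneg _
  have hΓ0 : 0 ≤ Γ := by simp only [hΓ, penaltyWeight]; positivity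
  have hpos := hη.pos
  have hc : ∀ (ζ : ℕ → Batch d l τ) m, IsControlled f lam β L N η ((m - 1) % (q + 1))
      (linState f W η β q X₀ ζ m) := isControlled_linState hτ hA hη hX₀
  have hq : ∀ m, (m - 1) % (q + 1) ≤ q := fun m => by
    have := Nat.mod_lt (m - 1) (by omega : 0 < q + 1); omega
  have hadd : ∀ (F H : NetState n p d → ℝ) m, Ex (fun s => F s + H s) m = Ex F m + Ex H m :=
    hξ.stateMean_add
  have hmul : ∀ (c : ℝ) (F : NetState n p d → ℝ) m, Ex (fun s => c * F s) m = c * Ex F m :=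
    stateMean_mul
  have h1 : ∀ m, x (m + 1) ≤ lam * x m + 2 / (1 - lam) * (η ^ 2 * D m) := fun m => by
    simp only [hx, hD, ← hadd, ← hmul]
    exact hξ.stateMean_mono fun ζ => (isTrackingStep_linState ζ m).sqNorm_deviation_X_le hA.mixing
      hA.d_pos hA.eigenvalue_le hA.lam_nonneg hA.lam_lt
  have h2 : ∀ m, D (m + 1) ≤ lam * D m + 2 / (1 - lam) * (2 * (A * y m) + 2 * u m) := fun m => by
    simp only [hD, hu, hy, ← hadd, ← hmul]
    refine hξ.stateMean_mono fun ζ => ((isTrackingStep_linState ζ m).sqNorm_deviation_D_le hA.mixing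
      hA.d_pos hA.eigenvalue_le hA.lam_nonneg hA.lam_lt).trans ?_
    gcongr
    exact (hc ζ m).sqNorm_linState_sub_le hτ hA hη ζ m (hq m)
  have h3 : ∀ m, y m ≤ 8 * x m + 4 * (η ^ 2 * D m) + 4 * (η ^ 2 * (d * v m)) := fun m => by
    simp only [hx, hD, hy, hv, ← hadd, ← hmul]
    -- The update of X is the same in both kinds of steps, so the opening step may stand in for the
    -- actual one.
    exact hξ.stateMean_mono fun ζ => (isTrackingStep_outerStep f W η β _).sqNorm_sub_X_le hA.mixing
      hA.d_pos hA.eigenvalue_le hA.lam_nonneg hA.lam_lt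
  have h4 : ∀ m, v m ≤ 12 * β ^ 2 * g m + 3 * e m := fun m => by
    simp only [hv, hg, he, ← hadd, ← hmul]
    refine hξ.stateMean_mono fun ζ => ((hc ζ m).merit_le hA hη (hq m)
      (isTrackingStep_linState ζ m)).2.trans ?_
    have b1 : 1 ≤ β ^ 2 := one_le_pow₀ hA.one_le_β
    have b2 := mul_le_mul_of_nonneg_right b1
      (sq_nonneg ‖genRiemGrad (globalCost f) (average (linState f W η β q X₀ ζ m).X)‖)
    have b3 := sq_nonneg ‖genRiemGrad (globalCost f) (average (linState f W η β q X₀ ζ m).X)‖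
    unfold stationarity
    linarith
  have h5 : ∀ m, e m ≤ 2 * u m + 2 * A * x m := fun m => by
    simp only [he, hu, hx, ← hadd, ← hmul]
    exact hξ.stateMean_mono fun ζ => (hc ζ m).norm_globalErr_sq_le hA hη
  have h6 : ∀ m, φ (m + 1) + η / 4 * g m ≤ φ m + (2 + 16 * Γ) * η * e m := fun m => by
    have : φ (m + 1) ≤ Ex (fun s => merit L (ballRadius p d) β (globalCost f) (average s.X)
        + (-(η / 4) * stationarity f s + (2 + 16 * Γ) * η * ‖globalErr f β s‖ ^ 2)) m := by
      refine hξ.stateMean_mono fun ζ => ((hc ζ m).merit_le hA hη (hq m)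
        (isTrackingStep_linState ζ m)).1.trans (le_of_eq ?_)
      unfold stationarity
      ring
    rw [hadd, hadd, hmul, hmul] at this
    simp only [hφ, hg, he] at this ⊢
    linarith
  have hx0 : ∀ m, 0 ≤ x m := stateMean_nonneg fun s => sqNorm_nonneg _
  have hD0 : ∀ m, 0 ≤ D m := stateMean_nonneg fun s => sqNorm_nonneg _
  have hu0 : ∀ m, 0 ≤ u m := stateMean_nonneg fun s => sqNorm_nonneg _
  have hy0 : ∀ m, 0 ≤ y m := stateMean_nonneg fun s => sqNorm_nonneg _
  have hv0 : ∀ m, 0 ≤ v m := stateMean_nonneg fun s => sq_nonneg _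
  have hg0 : ∀ m, 0 ≤ g m := stateMean_nonneg fun s => stationarity_nonneg f s
  have hxi : x 0 = 0 := by
    simp only [hx, hEx, stateMean_zero]
    have : deviation (initState f β X₀).X = 0 := deviation_const hA.d_pos X₀
    rw [this]
    simp [sqNorm]
  have hDi : D 0 ≤ d * searchBound N β p d ^ 2 := by
    simp only [hD, hEx, stateMean_zero]
    exact sqNorm_initState_D_le hA hX₀
  have hui : u 0 = 0 := by
    simp only [hu, hEx, stateMean_zero]
    simp [sqNorm, localErr, initState]
  have hφi : φ 0 ≤ globalCost f X₀ + β + Γ := by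
    simp only [hφ, hEx, stateMean_zero]
    have : average (initState f β X₀).X = X₀ := average_const hA.d_pos X₀
    rw [this]
    exact hA.isRiemSmooth.merit_le hX₀
  -- The average stays in the region, `schulz` maps the region to itself, and the region lies in the
  -- ball over which the infimum is taken.
  have hφM : costInf f ≤ φ M := by
    have : Ex (fun _ => costInf f) M ≤ φ M := by
      refine hξ.stateMean_mono fun ζ => ?_
      have hmem := (hc ζ M).average_mem
      have b1 := costInf_le hA.smooth.differentiable
        (region_subset_bigBall hA.d_pos (schulz_mem_region hmem))
      unfold merit
      have b2 := mul_nonneg hΓ0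
        (sq_nonneg ‖orthResidual (average (linState f W η β q X₀ ζ M).X)‖)
      linarith
    simpa [hEx, stateMean] using this
  have hureset : ∀ m, m % (q + 1) = 0 → u (m + 1) = 0 := by
    intro m hm
    simp only [hu, hEx, stateMean, linState, if_pos hm, localErr_outerStep]
    simp [sqNorm]
  have hustep : ∀ m, m % (q + 1) ≠ 0 → u (m + 1) ≤ u m + 1 / (τ : ℝ) * A * y m := fun m hm =>
    hξ.integral_localErr_le hτ hA hη hX₀ hm
  have hτ0 : (0 : ℝ) < τ := by exact_mod_cast hτ
  have sU := sum_reset_le (by positivity) hu0 hy0 hui hureset hustep M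
  -- The balance τ = q: the length of the inner loop cancels the variance reduction by the batch.
  have eU : (q : ℝ) * (1 / (τ : ℝ) * A) = A := by
    rw [← hτq]; field_simp
  rw [eU] at sU
  have sX := one_sub_mul_sum_le hx0 h1 M
  rw [hxi, zero_add, ← Finset.mul_sum] at sX
  have sD := one_sub_mul_sum_le hD0 h2 M
  rw [Finset.sum_add_distrib, ← Finset.mul_sum, ← Finset.mul_sum, ← Finset.mul_sum] at sD
  have sY := Finset.sum_le_sum fun m (_ : m ∈ Finset.range M) => h3 m
  have sV := Finset.sum_le_sum fun m (_ : m ∈ Finset.range M) => h4 m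
  have sE := Finset.sum_le_sum fun m (_ : m ∈ Finset.range M) => h5 m
  simp only [Finset.sum_add_distrib, ← Finset.mul_sum] at sY sV sE
  have sΦ : η / 4 * ∑ m ∈ Finset.range M, g m ≤ (φ 0 - φ M)
      + (2 + 16 * Γ) * η * ∑ m ∈ Finset.range M, e m := by
    rw [← Finset.sum_range_sub' φ M, Finset.mul_sum, Finset.mul_sum, ← Finset.sum_add_distrib]
    exact Finset.sum_le_sum fun m _ => by linarith [h6 m]
  have hX' : ∑ m ∈ Finset.range M, x m ≤ 2 / (1 - lam) ^ 2
      * (η ^ 2 * ∑ m ∈ Finset.range M, D m) := by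
    rw [← le_div_iff₀' hl1] at sX
    refine sX.trans (le_of_eq ?_)
    field_simp
  have hD' : ∑ m ∈ Finset.range M, D m ≤ d * searchBound N β p d ^ 2 / (1 - lam)
      + 2 * (2 / (1 - lam) ^ 2) * (A * ∑ m ∈ Finset.range M, y m
        + ∑ m ∈ Finset.range M, u m) := by
    have b := sD.trans (add_le_add hDi le_rfl)
    rw [← le_div_iff₀' hl1] at b
    refine b.trans (le_of_eq ?_)
    field_simp
  have key := sum_gap_le hS (by positivity) hA0 (by linarith) (by positivity) (sq_nonneg β)
    (Finset.sum_nonneg fun m _ => hD0 m) (Finset.sum_nonneg fun m _ => hv0 m)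
    (Finset.sum_nonneg fun m _ => hg0 m) hX' hD' sU sY sV sE sΦ
  have hgap : ∑ m ∈ Finset.range M, Ex (fun s => staGap f s.X) m
      ≤ ∑ m ∈ Finset.range M, g m + ∑ m ∈ Finset.range M, x m := by
    rw [← Finset.sum_add_distrib]
    refine Finset.sum_le_sum fun m _ => ?_
    simp only [hg, hx, ← hadd]
    exact hξ.stateMean_mono fun ζ => staGap_le hA.d_pos hA.smooth.differentiable _
  refine hgap.trans (key.trans ?_)
  have hf0 : 0 ≤ globalCost f X₀ - costInf f :=
    sub_nonneg.2 (costInf_le hA.smooth.differentiable (region_subset_bigBall hA.d_pos hX₀))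
  rw [div_add_one hpos.ne', div_le_div_iff_of_pos_right hpos]
  have hβ1 := hA.one_le_β
  have := hS.le_one
  have b1 := mul_nonneg hf0 (add_nonneg hA.β_nonneg hΓ0)
  nlinarith

end Gap

/-! ### The admissible step sizes -/

section StepSize

variable {p d q : ℕ} {lam β L N η : ℝ}

/-- The constants whose products with the step size have to be at most one. -/
def stepCoefs (lam β L N : ℝ) (p d : ℕ) : List ℝ :=
  [3, moveBound lam (dirBound N β p d) d,
    40 * (searchLip L β p d * moveBound lam (dirBound N β p d) d),
    80 * (searchLip L β p d * moveBound lam (dirBound N β p d) d),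
    dirBound N β p d,
    24 * (1 + (2 * ballRadius p d + 1) ^ 2) * dirBound N β p d ^ 2,
    24 * curvature L (ballRadius p d) β,
    1,
    8 * (2 / (1 - lam) ^ 2) * searchLip L β p d ^ 2 * (8 * (2 / (1 - lam) ^ 2) + 4),
    32 * (2 / (1 - lam) ^ 2) * searchLip L β p d ^ 2 * d,
    6 * errCoef (2 / (1 - lam) ^ 2) (searchLip L β p d ^ 2) d,
    192 * (2 + 16 * penaltyWeight L (ballRadius p d) β)
      * errCoef (2 / (1 - lam) ^ 2) (searchLip L β p d ^ 2) d * β ^ 2,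
    2 * (2 + 16 * penaltyWeight L (ballRadius p d) β)
      * errCoef (2 / (1 - lam) ^ 2) (searchLip L β p d ^ 2) d
      * (d * searchBound N β p d ^ 2 / (1 - lam)),
    3 * (2 / (1 - lam) ^ 2) * (d * searchBound N β p d ^ 2 / (1 - lam)),
    24 * (2 / (1 - lam) ^ 2) * β ^ 2]

/-- The constant `c` in the bound `c / √l` of the step size. -/
def stepThreshold (lam β L N : ℝ) (p d : ℕ) : ℝ :=
  1 / (1 + ((stepCoefs lam β L N p d).map fun k => |k|).sum)

theorem list_sum_map_abs_nonneg (s : List ℝ) : 0 ≤ (s.map fun k => |k|).sum :=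
  List.sum_nonneg (by simp)

theorem stepThreshold_pos (lam β L N : ℝ) (p d : ℕ) : 0 < stepThreshold lam β L N p d := by
  have := list_sum_map_abs_nonneg (stepCoefs lam β L N p d)
  unfold stepThreshold
  positivity

theorem mul_stepCoef_le (hη : 0 < η) (h : q * η < stepThreshold lam β L N p d) {k : ℝ}
    (hk : k ∈ stepCoefs lam β L N p d) : q * η * k ≤ 1 := by
  have h0 := list_sum_map_abs_nonneg (stepCoefs lam β L N p d)
  have h1 : |k| ≤ ((stepCoefs lam β L N p d).map fun k => |k|).sum :=
    List.single_le_sum (by simp) _ (List.mem_map.2 ⟨k, hk, rfl⟩)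
  unfold stepThreshold at h
  rw [lt_div_iff₀ (by linarith)] at h
  have h2 : 0 ≤ q * η := by positivity
  have h3 := mul_le_mul_of_nonneg_left ((le_abs_self k).trans h1) h2
  linarith

/-- The case distinction on the sign of k avoids checking that the listed coefficients are
nonnegative. -/
theorem mul_stepCoef_le_one (hq : 1 ≤ q) (hη : 0 < η)
    (h : q * η < stepThreshold lam β L N p d) {k : ℝ}
    (hk : k ∈ stepCoefs lam β L N p d) : η * k ≤ 1 := by
  have h1 := mul_stepCoef_le hη h hk
  have hq' : (1 : ℝ) ≤ q := by exact_mod_cast hq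
  rcases le_total k 0 with hk0 | hk0
  · nlinarith
  · nlinarith [mul_nonneg hη.le hk0]

theorem isSmallStep_of_lt (hq : 1 ≤ q) (hη : 0 < η)
    (h : q * η < stepThreshold lam β L N p d) : IsSmallStep lam β L N p d q η := by
  have key : ∀ k ∈ stepCoefs lam β L N p d, η * k ≤ 1 := fun k hk =>
    mul_stepCoef_le_one hq hη h hk
  -- The only condition in which the factor q is needed: the estimation error accumulates over an
  -- inner loop. The others follow from the bound on η alone.
  have h3 := mul_stepCoef_le hη h (k := 80 * (searchLip L β p d *
    moveBound lam (dirBound N β p d) d)) (by simp [stepCoefs])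
  simp only [stepCoefs, List.forall_mem_cons] at key
  obtain ⟨k1, k2, k3, -, k5, k6, k7, -⟩ := key
  exact ⟨hη, by linarith, k2, by linarith, by linarith, k5, k6, k7⟩

theorem isSummableStep_of_lt (hq : 1 ≤ q) (hη : 0 < η)
    (h : q * η < stepThreshold lam β L N p d) :
    IsSummableStep (2 / (1 - lam) ^ 2) (searchLip L β p d ^ 2) (β ^ 2)
      (2 + 16 * penaltyWeight L (ballRadius p d) β) (d * searchBound N β p d ^ 2 / (1 - lam))
      d η := by
  have key : ∀ k ∈ stepCoefs lam β L N p d, η * k ≤ 1 := fun k hk =>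
    mul_stepCoef_le_one hq hη h hk
  simp only [stepCoefs, List.forall_mem_cons] at key
  obtain ⟨-, -, -, -, -, -, -, k8, k9, k10, k11, k12, k13, k14, k15, -⟩ := key
  exact ⟨hη, by linarith, k9, k10, k11, k12, k13, k14, k15⟩

end StepSize

/-! ### The main result -/

section Complexity

variable {n p d l τ : ℕ} {Ω : Type*} [MeasurableSpace Ω] {P : Measure Ω}
  {ξ : ℕ → ℕ → Ω → Batch d l τ} {f : Costs n p d l} {W : Mat d d} {η β : ℝ} {q : ℕ}
  {X₀ : Mat n p}

theorem expectedGap_nonneg (kt : ℕ × ℕ) : 0 ≤ expectedGap P f W η β q X₀ ξ kt :=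
  integral_nonneg fun _ => staGap_nonneg f _

theorem expectedGap_eq_stateMean {K : ℕ} {kt : ℕ × ℕ} (hkt : kt ∈ iterIndices K q) :
    expectedGap P f W η β q X₀ ξ kt
      = stateMean P f W η β q X₀ ξ (fun s => staGap f s.X) (linIndex q kt) := by
  simp only [expectedGap, stateMean, vrsgt_eq_linState f W η β q X₀ _ hkt]
  rfl

/-- The minimum is at most the mean over K(q + 1) + 1 ≥ qK linear times, and the sum of the gaps is
bounded independently of how many are added. -/
theorem inf_expectedGap_le {C : ℝ} (hC : ∀ M, ∑ m ∈ Finset.range M,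
    stateMean P f W η β q X₀ ξ (fun s => staGap f s.X) m ≤ C) {K : ℕ} (hK : 1 ≤ K) (hq : 0 < q) :
    (iterIndices K q).inf' (iterIndices_nonempty K q) (expectedGap P f W η β q X₀ ξ)
      ≤ C / (q * K) := by
  set I := (iterIndices K q).inf' (iterIndices_nonempty K q) (expectedGap P f W η β q X₀ ξ)
    with hI
  have hI0 : 0 ≤ I := Finset.le_inf' _ _ fun kt _ => expectedGap_nonneg kt
  have hK' : (0 : ℝ) < K := by exact_mod_cast hK
  have hq' : (0 : ℝ) < q := by exact_mod_cast hq
  have h1 : ∀ m ∈ Finset.range (K * (q + 1) + 1),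
      I ≤ stateMean P f W η β q X₀ ξ (fun s => staGap f s.X) m := by
    intro m hm
    obtain ⟨kt, hkt, rfl⟩ := exists_linIndex_eq q (K := K) (m := m)
      (Nat.lt_succ_iff.1 (Finset.mem_range.1 hm))
    rw [← expectedGap_eq_stateMean hkt]
    exact Finset.inf'_le _ hkt
  have h2 := (Finset.card_nsmul_le_sum _ _ _ h1).trans (hC _)
  rw [Finset.card_range, nsmul_eq_mul] at h2
  push_cast at h2
  rw [le_div_iff₀ (by positivity)]
  nlinarith [mul_nonneg hI0 hK'.le, mul_nonneg hI0 hq'.le]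

theorem exists_complexity {C : ℝ} (hq : 0 < q) (hlq : l = q * q) (hτq : τ = q)
    (h : ∀ K : ℕ, 1 ≤ K → (iterIndices K q).inf' (iterIndices_nonempty K q)
      (expectedGap P f W η β q X₀ ξ) ≤ C / (q * K)) {ε : ℝ} (hε : 0 < ε) (hεC : ε ≤ C / q) :
    ∃ K : ℕ, ∃ kt ∈ iterIndices K q, expectedGap P f W η β q X₀ ξ kt ≤ ε ∧
      ∀ ω, ((vrsgt f W η β q X₀ (fun k t => ξ k t ω) kt.1 kt.2).rounds : ℝ) ≤ 8 * C / ε ∧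
        ((vrsgt f W η β q X₀ (fun k t => ξ k t ω) kt.1 kt.2).samples : ℝ)
          ≤ 8 * C * (d * q) / ε := by
  have hq' : (1 : ℝ) ≤ q := by exact_mod_cast hq
  have hqC : ε * q ≤ C := (le_div_iff₀ (by linarith)).1 hεC
  have hx : 1 ≤ C / (q * ε) := by
    rw [le_div_iff₀ (by positivity)]
    linarith
  set K := ⌈C / (q * ε)⌉₊ with hK
  have hK1 : 1 ≤ K := Nat.one_le_ceil_iff.2 (by linarith)
  have hK1' : (1 : ℝ) ≤ K := by exact_mod_cast hK1
  have hKge : C / (q * ε) ≤ K := Nat.le_ceil _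
  -- The assumption on ε makes the quotient at least 1, so rounding up at most doubles it. This
  -- keeps the costs proportional to 1/ε.
  have hKle : K * (q * ε) ≤ 2 * C := by
    have h1 : (K : ℝ) < C / (q * ε) + 1 := Nat.ceil_lt_add_one (by linarith)
    have h2 : (K : ℝ) ≤ 2 * (C / (q * ε)) := by linarith
    have h3 : 2 * (C / (q * ε)) = 2 * C / (q * ε) := by ring
    rwa [h3, le_div_iff₀ (by positivity)] at h2
  obtain ⟨kt, hkt, he⟩ := Finset.exists_mem_eq_inf' (iterIndices_nonempty K q)
    (expectedGap P f W η β q X₀ ξ)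
  refine ⟨K, kt, hkt, ?_, fun ω => ⟨?_, ?_⟩⟩
  · rw [← he]
    refine (h K hK1).trans ?_
    rw [div_le_iff₀ (by positivity)] at hKge ⊢
    linarith
  · have h1 : ((vrsgt f W η β q X₀ (fun k t => ξ k t ω) kt.1 kt.2).rounds : ℝ)
        ≤ 2 * (K * (q + 1)) := by
      exact_mod_cast vrsgt_rounds_le f W η β q X₀ (fun k t => ξ k t ω) hkt
    rw [le_div_iff₀ hε]
    have h2 : 2 * (K * ((q : ℝ) + 1)) ≤ 2 * (K * (q + q)) := by gcongr
    have h3 := mul_le_mul_of_nonneg_right (h1.trans h2) hε.le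
    linarith
  · have h1 : ((vrsgt f W η β q X₀ (fun k t => ξ k t ω) kt.1 kt.2).samples : ℝ)
        ≤ d * l + K * (d * l + q * (d * τ)) := by
      exact_mod_cast vrsgt_samples_le f W η β q X₀ (fun k t => ξ k t ω) hkt
    have e1 : (l : ℝ) = q * q := by rw [hlq]; push_cast; ring
    have e2 : (τ : ℝ) = q := by rw [hτq]
    rw [e1, e2] at h1
    rw [le_div_iff₀ hε]
    have hd0 : (0 : ℝ) ≤ d * (q * q) := by positivity
    have h2 := mul_le_mul_of_nonneg_right hK1' hd0
    -- With l = q² and τ = q, an opening step and the q inner steps together cost 2dq² samples; the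
    -- initialization is charged to K ≥ 1.
    have h3 : (d : ℝ) * (q * q) + K * (d * (q * q) + q * (d * q)) ≤ 3 * (K * (d * (q * q))) := by
      linarith
    have h4 := mul_le_mul_of_nonneg_right (h1.trans h3) hε.le
    have h5 := mul_le_mul_of_nonneg_left hKle (by positivity : 0 ≤ 3 * ((d : ℝ) * q))
    have h6 : 0 ≤ (d : ℝ) * q * C := by
      have : 0 ≤ C := le_trans (by positivity) hqC
      positivity
    linarith

end Complexity

end

theorem theorem1 (n p d : ℕ) (lam β LG : ℝ) (hlam : lam < 1) :
    ∃ C₁ : ℝ, 0 < C₁ ∧ ∀ MG : ℝ, ∃ c : ℝ, 0 < c ∧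
      ∀ (G : SimpleGraph (Fin d)) (W : Mat d d), G.Connected → IsMixingMatrix G W →
        secondEigenvalue W ≤ lam →
      ∀ (l τ q : ℕ), 0 < l → (τ : ℝ) = Real.sqrt l → (q : ℝ) = Real.sqrt l →
      ∀ f : Costs n p d l, IsMeanSquareLocallySmooth f →
        dirLip f ≤ LG → dirSup f ≤ MG → penaltyThreshold f < β →
      ∀ Xinit ∈ region n p, ∀ η : ℝ, 0 < η → η < c / Real.sqrt l →
      ∀ C : ℝ, C = C₁ * (globalCost f Xinit - costInf f + 1) / η →
      ∀ (Ω : Type*) [MeasurableSpace Ω] (P : Measure Ω) [IsProbabilityMeasure P]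
        (ξ : ℕ → ℕ → Ω → Batch d l τ), IsSampling P ξ →
        0 < C ∧
        (∀ k t, Integrable
          (fun ω => staGap f (vrsgt f W η β q Xinit (fun k t => ξ k t ω) k t).X) P) ∧
        (∀ K : ℕ, 1 ≤ K →
          (iterIndices K q).inf' (iterIndices_nonempty K q)
            (expectedGap P f W η β q Xinit ξ) ≤ C / (Real.sqrt l * K)) ∧
        (∀ ε : ℝ, 0 < ε → ε ≤ C / Real.sqrt l →
          ∃ K : ℕ, ∃ kt ∈ iterIndices K q,
            expectedGap P f W η β q Xinit ξ kt ≤ ε ∧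
            ∀ ω, ((vrsgt f W η β q Xinit (fun k t => ξ k t ω) kt.1 kt.2).rounds : ℝ) ≤
                8 * C / ε ∧
              ((vrsgt f W η β q Xinit (fun k t => ξ k t ω) kt.1 kt.2).samples : ℝ) ≤
                8 * C * (d * Real.sqrt l) / ε) := by
  -- This constant has to be positive before anything is known about β, hence the absolute value. It
  -- is chosen before MG, which is possible because the dispersion of the initial directions was
  -- absorbed by the step size.
  refine ⟨17 * (1 + |β| + penaltyWeight LG (ballRadius p d) β), ?_, fun MG =>
    ⟨stepThreshold lam β LG MG p d, stepThreshold_pos _ _ _ _ _ _, ?_⟩⟩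
  · unfold penaltyWeight
    positivity
  intro G W hG hW hWlam l τ q hl hτl hql f hf hLG hMG hβ Xinit hX η hη hηc C hC Ω _ P _ ξ hξ
  have hd : 0 < d := Fin.pos_iff_nonempty.2 hG.nonempty
  have hA : IsAdmissible G W f lam β LG MG := ⟨hd, hl, hW, hWlam, hlam, hf, hLG, hMG, hβ⟩
  have hlpos : (0 : ℝ) < Real.sqrt l := Real.sqrt_pos.2 (by exact_mod_cast hl)
  have hqpos : 0 < q := by
    rw [← hql] at hlpos
    exact_mod_cast hlpos
  have hτq : τ = q := by
    have h : (τ : ℝ) = q := hτl.trans hql.symm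
    exact_mod_cast h
  have hlq : l = q * q := by
    have h : (l : ℝ) = q * q := by rw [hql, Real.mul_self_sqrt (Nat.cast_nonneg l)]
    exact_mod_cast h
  rw [lt_div_iff₀ hlpos, mul_comm, ← hql] at hηc
  have hstep := isSmallStep_of_lt (lam := lam) (β := β) (L := LG) (N := MG) (p := p) (d := d)
    hqpos hη hηc
  have hsum : ∀ M, ∑ m ∈ Finset.range M,
      stateMean P f W η β q Xinit ξ (fun s => staGap f s.X) m ≤ C := fun M => by
    rw [hC, abs_of_nonneg hA.β_nonneg]
    exact hξ.sum_stateMean_staGap_le (hτq ▸ hqpos) hτq hA hstep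
      (isSummableStep_of_lt hqpos hη hηc) hX M
  have hmin : ∀ K : ℕ, 1 ≤ K → (iterIndices K q).inf' (iterIndices_nonempty K q)
      (expectedGap P f W η β q Xinit ξ) ≤ C / (q * K) := fun K hK =>
    inf_expectedGap_le hsum hK hqpos
  rw [← hql]
  refine ⟨?_, fun k t => ?_, hmin, fun ε hε hεC => exists_complexity hqpos hlq hτq hmin hε hεC⟩
  · have h0 : 0 ≤ globalCost f Xinit - costInf f :=
      sub_nonneg.2 (costInf_le hf.differentiable (region_subset_bigBall hd hX))
    have h1 : 0 ≤ penaltyWeight LG (ballRadius p d) β := by unfold penaltyWeight; positivity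
    rw [hC]
    positivity
  · exact ((hξ.isFiniteValued_vrsgt k t).comp fun s => staGap f s.X).integrable P
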